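/- **Conventions.** All systems are nonzero finite-dimensional Hilbert spaces and $\log$ is to base two. A state is a positive semidefinite operator of trace one, a sub-normalized state a positive semidefinite operator of trace at most one; $X\ll Y$ means $\operatorname{supp}X\subseteq\operatorname{supp}Y$. A channel is a completely positive trace-preserving linear map, a subchannel a completely positive trace-non-increasing linear map; $J_{\mathcal N}=(\mathrm{id}\otimes\mathcal N)(|\Phi\rangle\langle\Phi|)$ with $|\Phi\rangle=\sum_i|i\rangle|i\rangle$ is the Choi matrix. For positive definite $X,Y$ let $$G_\beta(X,Y)=X^{1/2}\big(X^{-1/2}YX^{-1/2}\big)^{\beta}X^{1/2},$$ and for positive semidefinite $X,Y$ let $G_\beta(X,Y)=\lim_{\varepsilon\downarrow0}G_\beta(X+\varepsilon 1,Y+\varepsilon 1)$ (for $\beta\in[-1,0)$ the limit exists if $X\ll Y$). For $\rho\ll\sigma$ let $$\widehat D_\alpha(\rho\|\sigma)=\tfrac1{\alpha-1}\log\operatorname{tr}G_{1-\alpha}(\rho,\sigma),\quad \widehat D(\rho\|\sigma)=\operatorname{tr}\rho\log(\rho^{1/2}\sigma^{-1}\rho^{1/2}),\quad D(\rho\|\sigma)=\operatorname{tr}\rho(\log\rho-\log\sigma),$$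 with inverses and logarithms taken on supports; all three are $+\infty$ if $\rho\not\ll\sigma$. Let $D_{\max}(\rho\|\sigma)=\min\{\log t:\rho\le t\sigma\}$, which is $+\infty$ if no such $t$ exists. For $\mathbf D\in\{\widehat D_\alpha,\widehat D\}$, a channel $\mathcal N_{A'\to B}$ and a subchannel $\mathcal M_{A'\to B}$, where $A\cong A'$, let $$\mathbf D(\mathcal N\|\mathcal M)=\sup_{\rho_A}\mathbf D\big(\mathcal N_{A'\to B}(\phi_{AA'})\,\big\|\,\mathcal M_{A'\to B}(\phi_{AA'})\big),$$ the supremum being over states $\rho_A$ with purification $\phi_{AA'}$. Finally let $$\widehat D^{A}_\alpha(\mathcal N\|\mathcal M)=\sup_{R,\rho_{RA},\sigma_{RA}}\big[\widehat D_\alpha(\mathcal N_{A\to B}(\rho_{RA})\|\mathcal M_{A\to B}(\sigma_{RA}))-\widehat D_\alpha(\rho_{RA}\|\sigma_{RA})\big]$$ over finite-dimensional $R$ and states $\rho_{RA}\ll\sigma_{RA}$. **Theorem.** Let $\alpha\in(1,2]$. 1. (Comparison) If $\rho$ is a state, $\sigma$ a sub-normalized state and $\rho\ll\sigma$, then $D(\rho\|\sigma)\le\widehat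 D_\alpha(\rho\|\sigma)\le D_{\max}(\rho\|\sigma)$. 2. (Closed form) For a channel $\mathcal N_{A'\to B}$ and a subchannel $\mathcal M_{A'\to B}$ with $J_{\mathcal N}\ll J_{\mathcal M}$, $$\widehat D_\alpha(\mathcal N\|\mathcal M)=\tfrac1{\alpha-1}\log\big\|\operatorname{tr}_B G_{1-\alpha}(J_{\mathcal N},J_{\mathcal M})\big\|_\infty,\qquad \widehat D(\mathcal N\|\mathcal M)=\Big\|\operatorname{tr}_B\big\{J_{\mathcal N}^{1/2}\log\big[J_{\mathcal N}^{1/2}J_{\mathcal M}^{-1}J_{\mathcal N}^{1/2}\big]J_{\mathcal N}^{1/2}\big\}\Big\|_\infty ;$$ if $J_{\mathcal N}\not\ll J_{\mathcal M}$, both channel divergences are $+\infty$. 3. (Additivity) For channels $\mathcal N_1,\mathcal N_2$ and subchannels $\mathcal M_1,\mathcal M_2$, $\widehat D_\alpha(\mathcal N_1\otimes\mathcal N_2\|\mathcal M_1\otimes\mathcal M_2)=\widehat D_\alpha(\mathcal N_1\|\mathcal M_1)+\widehat D_\alpha(\mathcal N_2\|\mathcal M_2)$. 4. (Chain rule) For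 a state $\rho_{RA}$, a sub-normalized state $\sigma_{RA}$, a channel $\mathcal N_{A\to B}$ and a subchannel $\mathcal M_{A\to B}$, $\widehat D_\alpha(\mathcal N(\rho_{RA})\|\mathcal M(\sigma_{RA}))\le\widehat D_\alpha(\rho_{RA}\|\sigma_{RA})+\widehat D_\alpha(\mathcal N\|\mathcal M)$. Moreover amortization collapses: $\widehat D^{A}_\alpha(\mathcal N\|\mathcal M)=\widehat D_\alpha(\mathcal N\|\mathcal M)$. 5. (Sub-additivity) For channels $\mathcal N_1:A\to B$, $\mathcal N_2:B\to C$ and subchannels $\mathcal M_1:A\to B$, $\mathcal M_2:B\to C$, $\widehat D_\alpha(\mathcal N_2\circ\mathcal N_1\|\mathcal M_2\circ\mathcal M_1)\le\widehat D_\alpha(\mathcal N_1\|\mathcal M_1)+\widehat D_\alpha(\mathcal N_2\|\mathcal M_2)$. 6. (Semidefinite representation) Call a subset of a real vector space semidefinite representable if it is the set of all $x$ for which a linear matrix inequality in $x$ and finitely many auxiliary real variables is solvable. Let $\mathcal V$ be a semidefinite representable set of subchannels from $A$ to $B$, $\mathcal N_{A\to B}$ a channel and $\alpha=1+2^{-\ell}$,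 $\ell\in\{0,1,2,\dots\}$. Consider the minimization of $y$ over real $y$ and Hermitian $M,N_0,\dots,N_\ell,J_{\mathcal M}$ on $AB$ subject to $$\begin{pmatrix}M&J_{\mathcal N}\\J_{\mathcal N}&N_\ell\end{pmatrix}\ge0,\quad \begin{pmatrix}J_{\mathcal N}&N_i\\N_i&N_{i-1}\end{pmatrix}\ge0\ (1\le i\le\ell),\quad N_0=J_{\mathcal M},\quad y1_A-\operatorname{tr}_BM\ge0,\quad \mathcal M\in\mathcal V .$$ This is a semidefinite program, that is, its feasible set is semidefinite representable. Its objective $y$ is bounded below on the feasible set, and $$\inf_{\mathcal M\in\mathcal V}\widehat D_\alpha(\mathcal N\|\mathcal M)=2^\ell\log\inf y,$$ where both sides are $+\infty$ if the program is infeasible. If $\mathcal V$ is closed, then the infimum on the left is a minimum if $\mathcal V\neq\emptyset$, and the infimum on the right is a minimum if the program is feasible. -/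

import Mathlib

open Matrix Filter Topology
open scoped Kronecker ComplexOrder

universe u

noncomputable section

/-! ### Operators and states

A quantum system is a finite type `A` (an orthonormal basis of the Hilbert space), operators on it
are complex matrices `Matrix A A ℂ`, and a bipartite system `AB` is the product type `A × B`. -/

/-- A quantum state: positive semidefinite with trace one. -/
def IsState {n : Type*} [Fintype n] (ρ : Matrix n n ℂ) : Prop :=
  ρ.PosSemidef ∧ ρ.trace = 1

/-- A sub-normalized state: positive semidefinite with trace at most one. -/
def IsSubState {n : Type*} [Fintype n] (σ : Matrix n n ℂ) : Prop :=
  σ.PosSemidef ∧ σ.trace.re ≤ 1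

/-- `X ≪ Y`: inclusion of supports. (The support of a Hermitian operator is its range.) -/
def SuppLE {n : Type*} [Fintype n] (X Y : Matrix n n ℂ) : Prop :=
  LinearMap.range X.mulVecLin ≤ LinearMap.range Y.mulVecLin

/-- The partial trace over the second tensor factor. -/
def trRight {A B : Type*} [Fintype B] (X : Matrix (A × B) (A × B) ℂ) : Matrix A A ℂ :=
  Matrix.of fun a a' => ∑ b, X (a, b) (a', b)

/-- The operator norm `‖X‖_∞` (largest singular value). -/
def opNorm {n : Type*} [Fintype n] [DecidableEq n] (X : Matrix n n ℂ) : ℝ :=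
  ‖Matrix.toEuclideanCLM (n := n) (𝕜 := ℂ) X‖

/-- The rank-one operator `|φ⟩⟨φ|`. -/
def ketBra {n : Type*} (φ : n → ℂ) : Matrix n n ℂ :=
  Matrix.vecMulVec φ (star φ)

/-! ### Linear maps between matrix algebras -/

/-- `id_R ⊗ N`. -/
def idTensor (R : Type*) {A B : Type*} (N : Matrix A A ℂ →ₗ[ℂ] Matrix B B ℂ) :
    Matrix (R × A) (R × A) ℂ →ₗ[ℂ] Matrix (R × B) (R × B) ℂ where
  toFun X := Matrix.of fun p q => N (Matrix.of fun a a' => X (p.1, a) (q.1, a')) p.2 q.2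
  map_add' X Y := by
    ext p q
    have h : (Matrix.of fun a a' => (X + Y) (p.1, a) (q.1, a')) =
        (Matrix.of fun a a' => X (p.1, a) (q.1, a')) +
          (Matrix.of fun a a' => Y (p.1, a) (q.1, a')) := rfl
    simp only [Matrix.of_apply, Matrix.add_apply]
    exact (congrFun (congrFun ((congrArg N h).trans (map_add N _ _)) p.2) q.2)
  map_smul' c X := by
    ext p q
    have h : (Matrix.of fun a a' => (c • X) (p.1, a) (q.1, a')) =
        c • (Matrix.of fun a a' => X (p.1, a) (q.1, a')) := rfl
    simp only [Matrix.of_apply, Matrix.smul_apply, RingHom.id_apply]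
    exact (congrFun (congrFun ((congrArg N h).trans (map_smul N _ _)) p.2) q.2)

/-- The exchange of the two tensor factors. -/
def swapMap (A B : Type*) :
    Matrix (A × B) (A × B) ℂ →ₗ[ℂ] Matrix (B × A) (B × A) ℂ where
  toFun X := Matrix.of fun p q => X (p.2, p.1) (q.2, q.1)
  map_add' _ _ := rfl
  map_smul' _ _ := rfl

/-- The tensor product `N₁ ⊗ N₂` of two linear maps, as `(N₁ ⊗ id) ∘ (id ⊗ N₂)`. -/
def tensorMap {A₁ B₁ A₂ B₂ : Type*} (N₁ : Matrix A₁ A₁ ℂ →ₗ[ℂ] Matrix B₁ B₁ ℂ)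
    (N₂ : Matrix A₂ A₂ ℂ →ₗ[ℂ] Matrix B₂ B₂ ℂ) :
    Matrix (A₁ × A₂) (A₁ × A₂) ℂ →ₗ[ℂ] Matrix (B₁ × B₂) (B₁ × B₂) ℂ :=
  swapMap B₂ B₁ ∘ₗ idTensor B₂ N₁ ∘ₗ swapMap A₁ B₂ ∘ₗ idTensor A₁ N₂

theorem tensorMap_kronecker {A₁ B₁ A₂ B₂ : Type*} (N₁ : Matrix A₁ A₁ ℂ →ₗ[ℂ] Matrix B₁ B₁ ℂ)
    (N₂ : Matrix A₂ A₂ ℂ →ₗ[ℂ] Matrix B₂ B₂ ℂ) (X : Matrix A₁ A₁ ℂ) (Y : Matrix A₂ A₂ ℂ) :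
    tensorMap N₁ N₂ (X ⊗ₖ Y) = N₁ X ⊗ₖ N₂ Y := by
  have h2 : ∀ a a' b b', N₂ (Matrix.of fun c c' => X a a' * Y c c') b b' = X a a' * N₂ Y b b' := by
    intro a a' b b'
    have h : (Matrix.of fun c c' => X a a' * Y c c') = X a a' • Y := rfl
    rw [h, map_smul]; rfl
  have h1 : ∀ b b' c c', N₁ (Matrix.of fun a a' => X a a' * N₂ Y b b') c c'
      = N₁ X c c' * N₂ Y b b' := by
    intro b b' c c'
    have h : (Matrix.of fun a a' => X a a' * N₂ Y b b') = N₂ Y b b' • X := by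
      ext a a'; simp [mul_comm]
    rw [h, map_smul, Matrix.smul_apply, smul_eq_mul, mul_comm]
  ext p q
  refine Eq.trans ?_ (h1 p.2 q.2 p.1 q.1)
  change N₁ (Matrix.of fun a a' => N₂ (Matrix.of fun c c' => X a a' * Y c c') p.2 q.2) p.1 q.1 = _
  simp only [h2]

/-- Complete positivity: `id_k ⊗ N` preserves positive semidefiniteness for every `k`. -/
def IsCP {A B : Type*} [Fintype A] [Fintype B] (N : Matrix A A ℂ →ₗ[ℂ] Matrix B B ℂ) : Prop :=
  ∀ (k : ℕ) (X : Matrix (Fin k × A) (Fin k × A) ℂ), X.PosSemidef → (idTensor (Fin k) N X).PosSemidef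

/-- A quantum channel: completely positive and trace preserving. -/
def IsChannel {A B : Type*} [Fintype A] [Fintype B] (N : Matrix A A ℂ →ₗ[ℂ] Matrix B B ℂ) : Prop :=
  IsCP N ∧ ∀ X, (N X).trace = X.trace

/-- A subchannel: completely positive and trace non-increasing. -/
def IsSubchannel {A B : Type*} [Fintype A] [Fintype B] (M : Matrix A A ℂ →ₗ[ℂ] Matrix B B ℂ) :
    Prop :=
  IsCP M ∧ ∀ X : Matrix A A ℂ, X.PosSemidef → (M X).trace.re ≤ X.trace.re

/-- The Choi matrix `J_{AB} = (id_A ⊗ N)(|Φ⟩⟨Φ|)` with `|Φ⟩ = ∑ᵢ |i⟩|i⟩`. -/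
def choi {A B : Type*} [DecidableEq A] (N : Matrix A A ℂ →ₗ[ℂ] Matrix B B ℂ) :
    Matrix (A × B) (A × B) ℂ :=
  idTensor A N (ketBra fun p : A × A => if p.1 = p.2 then 1 else 0)

/-! ### Weighted matrix geometric mean and divergences (logarithms in base two) -/

/-- `X^{1/2} (X^{-1/2} Y X^{-1/2})^β X^{1/2}` for positive definite `X` and `Y`. -/
def geoMeanPos {n : Type*} [Fintype n] [DecidableEq n] (β : ℝ) (X Y : Matrix n n ℂ) :
    Matrix n n ℂ :=
  cfc (fun x : ℝ => √x) X *
    cfc (fun x : ℝ => x ^ β) (cfc (fun x : ℝ => (√x)⁻¹) X * Y * cfc (fun x : ℝ => (√x)⁻¹) X) *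
    cfc (fun x : ℝ => √x) X

/-- The weighted matrix geometric mean `G_β(X, Y)`, extended by continuity from positive definite
to positive semidefinite operators: the limit of `G_β(X + ε, Y + ε)` as `ε ↓ 0`. For `β ∈ [-1, 0)`
the limit exists whenever `X ≪ Y`. -/
def geoMean {n : Type*} [Fintype n] [DecidableEq n] (β : ℝ) (X Y : Matrix n n ℂ) :
    Matrix n n ℂ :=
  limUnder (𝓝[>] (0 : ℝ)) fun ε : ℝ => geoMeanPos β (X + (ε : ℂ) • 1) (Y + (ε : ℂ) • 1)

open Classical in
/-- The geometric Rényi divergence, with value `+∞` outside `ρ ≪ σ`. -/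
def geoRenyi {n : Type*} [Fintype n] [DecidableEq n] (α : ℝ) (ρ σ : Matrix n n ℂ) : EReal :=
  if SuppLE ρ σ then ((1 / (α - 1) * Real.logb 2 (geoMean (1 - α) ρ σ).trace.re : ℝ) : EReal)
  else ⊤

open Classical in
/-- The Umegaki relative entropy `tr ρ (log ρ - log σ)` (logarithms taken on the supports, which
is the convention `log 0 = 0` below), with value `+∞` outside `ρ ≪ σ`. -/
def umegaki {n : Type*} [Fintype n] [DecidableEq n] (ρ σ : Matrix n n ℂ) : EReal :=
  if SuppLE ρ σ then
    (((ρ * (cfc (Real.logb 2) ρ - cfc (Real.logb 2) σ)).trace.re : ℝ) : EReal)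
  else ⊤

/-- The max-relative entropy `min {log t | ρ ≤ t σ}` (`+∞` if there is no such `t`). -/
def dMax {n : Type*} [Fintype n] (ρ σ : Matrix n n ℂ) : EReal :=
  sInf {x : EReal | ∃ t : ℝ, 0 < t ∧ ((t : ℂ) • σ - ρ).PosSemidef ∧ x = (Real.logb 2 t : ℝ)}

/-- `log (X^{1/2} Y⁻¹ X^{1/2})`, where inverse and logarithm are taken on the supports (in the
functional calculus: `0⁻¹ = 0` and `log 0 = 0`). -/
def bsLog {n : Type*} [Fintype n] [DecidableEq n] (X Y : Matrix n n ℂ) : Matrix n n ℂ :=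
  cfc (Real.logb 2)
    (cfc (fun x : ℝ => √x) X * cfc (fun x : ℝ => x⁻¹) Y * cfc (fun x : ℝ => √x) X)

open Classical in
/-- The Belavkin–Staszewski relative entropy `tr ρ log (ρ^{1/2} σ⁻¹ ρ^{1/2})`, with value `+∞`
outside `ρ ≪ σ`. -/
def bsDiv {n : Type*} [Fintype n] [DecidableEq n] (ρ σ : Matrix n n ℂ) : EReal :=
  if SuppLE ρ σ then (((ρ * bsLog ρ σ).trace.re : ℝ) : EReal) else ⊤

/-- The operator `X^{1/2} log (X^{1/2} Y⁻¹ X^{1/2}) X^{1/2}`. -/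
def bsOp {n : Type*} [Fintype n] [DecidableEq n] (X Y : Matrix n n ℂ) : Matrix n n ℂ :=
  cfc (fun x : ℝ => √x) X * bsLog X Y * cfc (fun x : ℝ => √x) X

/-! ### Channel divergences -/

/-- The vector `φ ∈ A ⊗ A'`, with `A'` a copy of `A`, purifies `ρ`. -/
def IsPurification {A : Type*} [Fintype A] (φ : A × A → ℂ) (ρ : Matrix A A ℂ) : Prop :=
  trRight (ketBra φ) = ρ

/-- The channel divergence generated by a divergence `D`: the supremum over states `ρ_A` and
purifications `φ_{AA'}` of `ρ_A` of `D(N_{A'→B}(φ_{AA'}) ‖ M_{A'→B}(φ_{AA'}))`. -/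
def channelDiv {A B : Type*} [Fintype A]
    (D : Matrix (A × B) (A × B) ℂ → Matrix (A × B) (A × B) ℂ → EReal)
    (N M : Matrix A A ℂ →ₗ[ℂ] Matrix B B ℂ) : EReal :=
  ⨆ (ρ : Matrix A A ℂ) (_ : IsState ρ) (φ : A × A → ℂ) (_ : IsPurification φ ρ),
    D (idTensor A N (ketBra φ)) (idTensor A M (ketBra φ))

section
variable {A B : Type*} [Fintype A] [DecidableEq A] [Fintype B] [DecidableEq B]

/-- The geometric Rényi channel divergence. -/
def geoRenyiChannel (α : ℝ) (N M : Matrix A A ℂ →ₗ[ℂ] Matrix B B ℂ) : EReal :=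
  channelDiv (geoRenyi α) N M

/-- The Belavkin–Staszewski channel divergence. -/
def bsChannel (N M : Matrix A A ℂ →ₗ[ℂ] Matrix B B ℂ) : EReal :=
  channelDiv bsDiv N M

/-- The amortized geometric Rényi channel divergence: the supremum over all finite-dimensional
reference systems `R` and states `ρ_{RA} ≪ σ_{RA}` (so that the subtracted term is finite) of the
increase of the divergence. -/
def amortizedGeoRenyi (α : ℝ) (N M : Matrix A A ℂ →ₗ[ℂ] Matrix B B ℂ) : EReal :=
  ⨆ (k : ℕ) (ρ : Matrix (Fin k × A) (Fin k × A) ℂ) (σ : Matrix (Fin k × A) (Fin k × A) ℂ)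
    (_ : IsState ρ) (_ : IsState σ) (_ : SuppLE ρ σ),
    geoRenyi α (idTensor (Fin k) N ρ) (idTensor (Fin k) M σ) - geoRenyi α ρ σ

end

/-! ### Semidefinite programming -/

/-- A set that is described by semidefinite conditions: it is the set of all `x` for which a linear
matrix inequality in `x` and finitely many auxiliary real variables `z` has a solution `z`. -/
def IsSemidefRep {E : Type*} [AddCommGroup E] [Module ℝ E] (S : Set E) : Prop :=
  ∃ (k s : ℕ) (F : (E × (Fin k → ℝ)) →ᵃ[ℝ] Matrix (Fin s) (Fin s) ℂ),
    (∀ p, (F p).IsHermitian) ∧ S = {x | ∃ z, (F (x, z)).PosSemidef}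

section
variable {A B : Type*} [Fintype A] [DecidableEq A] [Fintype B] [DecidableEq B]

/-- The variables of the program: `M`, `(N_i)_{i=0}^ℓ`, `J_M` and `y`. -/
abbrev ProgramVars (A B : Type*) (ℓ : ℕ) : Type _ :=
  Matrix (A × B) (A × B) ℂ × (Fin (ℓ + 1) → Matrix (A × B) (A × B) ℂ) ×
    Matrix (A × B) (A × B) ℂ × ℝ

/-- The feasible set of the program attached to the channel `N` and the set `V` of subchannels. -/
def programFeasible (ℓ : ℕ) (N : Matrix A A ℂ →ₗ[ℂ] Matrix B B ℂ)
    (V : Set (Matrix A A ℂ →ₗ[ℂ] Matrix B B ℂ)) : Set (ProgramVars A B ℓ) :=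
  {p | match p with
    | (M, Ns, J, y) =>
      M.IsHermitian ∧ (∀ i, (Ns i).IsHermitian) ∧ J.IsHermitian ∧
      (Matrix.fromBlocks M (choi N) (choi N) (Ns (Fin.last ℓ))).PosSemidef ∧
      (∀ i : Fin ℓ, (Matrix.fromBlocks (choi N) (Ns i.succ) (Ns i.succ) (Ns i.castSucc)).PosSemidef) ∧
      Ns 0 - J = 0 ∧
      ((y : ℂ) • (1 : Matrix A A ℂ) - trRight M).PosSemidef ∧
      ∃ 𝓜 ∈ V, choi 𝓜 = J}

/-- The set of objective values `y` of feasible points. -/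
def programValues (ℓ : ℕ) (N : Matrix A A ℂ →ₗ[ℂ] Matrix B B ℂ)
    (V : Set (Matrix A A ℂ →ₗ[ℂ] Matrix B B ℂ)) : Set ℝ :=
  (fun p : ProgramVars A B ℓ => p.2.2.2) '' programFeasible ℓ N V

end

end

set_option linter.unusedSectionVars false

/-! ### Functional calculus of Hermitian matrices -/

section FunctionalCalculus

variable {n m : Type*} [Fintype n] [DecidableEq n] [Fintype m] [DecidableEq m]

/-! Everything reduces to one object, `perspective f X Y`, written P_f(X, Y) here: Y^{1/2}
f(Y^{-1/2} X Y^{-1/2}) Y^{1/2}. For X ≪ Y the mean G_{1-α}(X, Y) is the perspective of x^α, and the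
Belavkin–Staszewski operator is that of x log x (`geoMean_eq_perspective`, `bsOp_eq_perspective`).
Such a pair is classical up to congruence: Y = W Wᴴ and X = W D Wᴴ with D diagonal, and then P_f(X,
Y) = W f(D) Wᴴ (`exists_congr_diag`).

The engine is the transformer inequality P_f(K X Kᴴ, K Y Kᴴ) ≤ K P_f(X, Y) Kᴴ, with equality for
invertible K (`IsPowOrLog.transformer`, `IsPowOrLog.transformer_eq`). It follows from the operator
Jensen inequality for contractions. For x^α that inequality comes from Löwner–Heinz with the
exponent α - 1 ∈ [0, 1], which is where α ≤ 2 enters; for x log x it is the derivative at α = 1.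

Comparison. Traces of perspectives of states are classical sums ∑ q_i f(d_i), with q_i the squared
column norms of W. So the Belavkin–Staszewski entropy lies below the geometric Rényi divergence by
concavity of log, and the latter lies below the max-relative entropy because ρ ≤ tσ forces d_i ≤ t.
That the Umegaki entropy lies below the Belavkin–Staszewski entropy is shown by writing log as an
integral of x / (1 + τx) and comparing the two resolvent sums by a variational formula
(`umegaki_resolvent_le`).

Channels. A pure input with coefficient matrix K turns a Choi matrix J into (K ⊗ 1) J (K ⊗ 1)ᴴ. The
transformer inequality bounds the output trace by tr K (tr_B P_f) Kᴴ, hence by the operator norm of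
tr_B P_f. Equality for invertible K, which are dense, gives the closed forms. A mixed input gives
the link product, a congruence of ρ ⊗ J; the transformer inequality and multiplicativity of
perspectives of powers under ⊗ yield the chain rule (`trace_perspective_link_le`). Sub-additivity
and the amortization collapse follow from it, and additivity follows from the closed form and
multiplicativity of the norm.

Semidefinite program. A block inequality with blocks X, N_i, N_i, N_{i-1} is a Schur complement
condition and forces the normalized N_i below the square root of the normalized N_{i-1}. Iterating
with operator monotone roots and taking one last Schur complement gives M ≥ P_{x^α}(X, Y) for α = 1
+ 2^{-ℓ}. Equality is reached by N_i = W D^{1 - 2^{-i}} Wᴴ. Attainment is compactness of the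
sublevel sets. -/

theorem continuousOn_spectrum_matrix (A : Matrix n n ℂ) (f : ℝ → ℝ) :
    ContinuousOn f (spectrum ℝ A) :=
  (Matrix.finite_real_spectrum (A := A)).continuousOn f

/-- A function of two Hermitian matrices is given by one polynomial. -/
theorem exists_polynomial_cfc_eq {A : Matrix n n ℂ} {B : Matrix m m ℂ} (hA : A.IsHermitian)
    (hB : B.IsHermitian) (f : ℝ → ℝ) :
    ∃ p : Polynomial ℝ, cfc f A = Polynomial.aeval A p ∧ cfc f B = Polynomial.aeval B p := by
  classical
  -- Interpolating on the union of both spectra gives one polynomial for two matrices of different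
  -- sizes, as rectangular intertwiners require.
  have hfin : (spectrum ℝ A ∪ spectrum ℝ B).Finite :=
    (Matrix.finite_real_spectrum (A := A)).union (Matrix.finite_real_spectrum (A := B))
  have key : ∀ x ∈ spectrum ℝ A ∪ spectrum ℝ B,
      f x = (Lagrange.interpolate hfin.toFinset id f).eval x := by
    intro x hx
    have := Lagrange.eval_interpolate_at_node (s := hfin.toFinset) (v := id) f
      Function.injective_id.injOn (hfin.mem_toFinset.2 hx)
    exact this.symm
  refine ⟨Lagrange.interpolate hfin.toFinset id f, ?_, ?_⟩
  · rw [← cfc_polynomial _ A hA]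
    exact cfc_congr fun x hx => key x (Or.inl hx)
  · rw [← cfc_polynomial _ B hB]
    exact cfc_congr fun x hx => key x (Or.inr hx)

theorem aeval_intertwine {A : Matrix n n ℂ} {B : Matrix m m ℂ} {C : Matrix n m ℂ}
    (h : A * C = C * B) (p : Polynomial ℝ) :
    Polynomial.aeval A p * C = C * Polynomial.aeval B p := by
  induction p using Polynomial.induction_on' with
  | add p q hp hq => simp only [map_add, Matrix.add_mul, Matrix.mul_add, hp, hq]
  | monomial k r =>
    have hk : A ^ k * C = C * B ^ k := by
      induction k with
      | zero => simp
      | succ k ih =>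
        rw [pow_succ', Matrix.mul_assoc, ih, ← Matrix.mul_assoc, h, pow_succ', Matrix.mul_assoc]
    simp only [Polynomial.aeval_monomial, Algebra.algebraMap_eq_smul_one, smul_mul_assoc, one_mul,
      Matrix.smul_mul, Matrix.mul_smul, hk]

/-- The functional calculus respects intertwining relations. -/
theorem cfc_intertwine {A : Matrix n n ℂ} {B : Matrix m m ℂ} {C : Matrix n m ℂ}
    (hA : A.IsHermitian) (hB : B.IsHermitian) (h : A * C = C * B) (f : ℝ → ℝ) :
    cfc f A * C = C * cfc f B := by
  obtain ⟨p, h1, h2⟩ := exists_polynomial_cfc_eq hA hB f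
  rw [h1, h2, aeval_intertwine h]

theorem cfc_isHermitian (f : ℝ → ℝ) (A : Matrix n n ℂ) : (cfc f A).IsHermitian :=
  cfc_predicate f A

theorem cfc_mul_cfc (f g : ℝ → ℝ) (A : Matrix n n ℂ) :
    cfc f A * cfc g A = cfc (fun x => f x * g x) A :=
  (cfc_mul f g A (continuousOn_spectrum_matrix A f) (continuousOn_spectrum_matrix A g)).symm

/-- A real diagonal matrix, with complex entries. -/
noncomputable def rdiag (d : n → ℝ) : Matrix n n ℂ := diagonal fun i => (d i : ℂ)

theorem rdiag_isHermitian (d : n → ℝ) : (rdiag d).IsHermitian := by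
  rw [rdiag, Matrix.IsHermitian, diagonal_conjTranspose]
  congr 1; ext i; simp

theorem rdiag_mul (d e : n → ℝ) : rdiag d * rdiag e = rdiag fun i => d i * e i := by
  simp [rdiag]

theorem rdiag_one : rdiag (fun _ : n => (1 : ℝ)) = 1 := by
  simp [rdiag]

theorem rdiag_posSemidef {d : n → ℝ} (h : ∀ i, 0 ≤ d i) : (rdiag d).PosSemidef := by
  classical
  refine Matrix.PosSemidef.diagonal fun i => ?_
  simpa using h i

/-- Each basis column intertwines the diagonal matrix with the scalar `d i`, so the functional
calculus can be read off column by column. -/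
theorem cfc_rdiag (f : ℝ → ℝ) (d : n → ℝ) : cfc f (rdiag d) = rdiag fun i => f (d i) := by
  have key : ∀ i : n, cfc f (rdiag d) * (Matrix.of fun (j : n) (_ : Unit) => if j = i then (1 : ℂ) else 0)
      = (Matrix.of fun (j : n) (_ : Unit) => if j = i then (1 : ℂ) else 0) *
        cfc f (algebraMap ℝ (Matrix Unit Unit ℂ) (d i)) := by
    intro i
    refine cfc_intertwine (rdiag_isHermitian d) (isHermitian_iff_isSelfAdjoint.2
      (IsSelfAdjoint.algebraMap _ (.all _))) ?_ f
    ext j u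
    simp [rdiag, Matrix.mul_apply, Matrix.diagonal_apply, Algebra.algebraMap_eq_smul_one]
    split_ifs with h <;> simp [h]
  ext j i
  have := congrFun (congrFun (key i) j) ()
  rw [cfc_algebraMap] at this
  simp [Matrix.mul_apply, Algebra.algebraMap_eq_smul_one] at this
  rw [this, rdiag, Matrix.diagonal_apply]
  split_ifs with h
  · subst h; rfl
  · rfl

theorem cfc_unitary_conj (f : ℝ → ℝ) {U : Matrix n n ℂ} (hU : U ∈ unitaryGroup n ℂ) (d : n → ℝ) :
    cfc f (U * rdiag d * Uᴴ) = U * rdiag (fun i => f (d i)) * Uᴴ := by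
  have h1 : Uᴴ * U = 1 := mem_unitaryGroup_iff'.1 hU
  have h2 : U * Uᴴ = 1 := mem_unitaryGroup_iff.1 hU
  have := cfc_intertwine (A := U * rdiag d * Uᴴ) (B := rdiag d) (C := U)
    (isHermitian_mul_mul_conjTranspose _ (rdiag_isHermitian d)) (rdiag_isHermitian d)
    (by rw [Matrix.mul_assoc, h1, Matrix.mul_one]) f
  rw [cfc_rdiag] at this
  rw [← this, Matrix.mul_assoc _ U, h2, Matrix.mul_one]

theorem exists_unitary_diag {A : Matrix n n ℂ} (hA : A.IsHermitian) :
    ∃ U ∈ unitaryGroup n ℂ, A = U * rdiag hA.eigenvalues * Uᴴ := by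
  refine ⟨hA.eigenvectorUnitary, hA.eigenvectorUnitary.2, ?_⟩
  conv_lhs => rw [hA.spectral_theorem]
  rfl

theorem cfc_eq_of_unitary_diag (f : ℝ → ℝ) {A : Matrix n n ℂ} {U : Matrix n n ℂ}
    (hU : U ∈ unitaryGroup n ℂ) {d : n → ℝ} (h : A = U * rdiag d * Uᴴ) :
    cfc f A = U * rdiag (fun i => f (d i)) * Uᴴ := by
  rw [h, cfc_unitary_conj f hU]

theorem Matrix.PosSemidef.exists_unitary_diag {A : Matrix n n ℂ} (hA : A.PosSemidef) :
    ∃ U ∈ unitaryGroup n ℂ, ∃ d : n → ℝ, (∀ i, 0 ≤ d i) ∧ A = U * rdiag d * Uᴴ := by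
  obtain ⟨U, hU, h⟩ := _root_.exists_unitary_diag hA.1
  exact ⟨U, hU, _, hA.eigenvalues_nonneg, h⟩

theorem Matrix.PosSemidef.cfc_congr {A : Matrix n n ℂ} (hA : A.PosSemidef) {f g : ℝ → ℝ}
    (h : ∀ x, 0 ≤ x → f x = g x) : cfc f A = cfc g A := by
  obtain ⟨U, hU, d, hd, hA⟩ := hA.exists_unitary_diag
  rw [cfc_eq_of_unitary_diag f hU hA, cfc_eq_of_unitary_diag g hU hA]
  simp [h _ (hd _)]

theorem Matrix.PosSemidef.cfc_eq_self {A : Matrix n n ℂ} (hA : A.PosSemidef) {f : ℝ → ℝ}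
    (h : ∀ x, 0 ≤ x → f x = x) : cfc f A = A := by
  rw [hA.cfc_congr (g := id) h]
  exact cfc_id ℝ A hA.1.isSelfAdjoint

theorem Matrix.PosSemidef.cfc_posSemidef {A : Matrix n n ℂ} (hA : A.PosSemidef) {f : ℝ → ℝ}
    (h : ∀ x, 0 ≤ x → 0 ≤ f x) : (cfc f A).PosSemidef := by
  obtain ⟨U, hU, d, hd, hA⟩ := hA.exists_unitary_diag
  rw [cfc_eq_of_unitary_diag f hU hA]
  exact (rdiag_posSemidef fun i => h _ (hd i)).mul_mul_conjTranspose_same U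

/-- The square root. -/
noncomputable def sqr (Y : Matrix n n ℂ) : Matrix n n ℂ := cfc (fun x : ℝ => √x) Y

/-- The inverse square root on the support. -/
noncomputable def isqr (Y : Matrix n n ℂ) : Matrix n n ℂ := cfc (fun x : ℝ => (√x)⁻¹) Y

/-- The projection onto the support. -/
noncomputable def suppProj (Y : Matrix n n ℂ) : Matrix n n ℂ :=
  cfc (fun x : ℝ => if x = 0 then 0 else 1) Y

theorem sqr_isHermitian (Y : Matrix n n ℂ) : (sqr Y).IsHermitian := cfc_isHermitian _ _

theorem isqr_isHermitian (Y : Matrix n n ℂ) : (isqr Y).IsHermitian := cfc_isHermitian _ _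

theorem suppProj_isHermitian (Y : Matrix n n ℂ) : (suppProj Y).IsHermitian := cfc_isHermitian _ _

theorem sqr_mul_sqr {Y : Matrix n n ℂ} (hY : Y.PosSemidef) : sqr Y * sqr Y = Y := by
  rw [sqr, cfc_mul_cfc]
  exact hY.cfc_eq_self fun x hx => Real.mul_self_sqrt hx

theorem sqr_mul_isqr {Y : Matrix n n ℂ} (hY : Y.PosSemidef) : sqr Y * isqr Y = suppProj Y := by
  rw [sqr, isqr, cfc_mul_cfc]
  refine hY.cfc_congr fun x hx => ?_
  split_ifs with h
  · simp [h]
  · exact mul_inv_cancel₀ ((Real.sqrt_ne_zero hx).2 h)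

theorem isqr_mul_sqr {Y : Matrix n n ℂ} (hY : Y.PosSemidef) : isqr Y * sqr Y = suppProj Y := by
  rw [← sqr_mul_isqr hY, sqr, isqr, cfc_mul_cfc, cfc_mul_cfc]
  simp only [mul_comm]

theorem suppProj_mul_sqr {Y : Matrix n n ℂ} (hY : Y.PosSemidef) : suppProj Y * sqr Y = sqr Y := by
  rw [suppProj, sqr, cfc_mul_cfc]
  refine hY.cfc_congr fun x hx => ?_
  split_ifs with h <;> simp [h]

theorem sqr_mul_suppProj {Y : Matrix n n ℂ} (hY : Y.PosSemidef) : sqr Y * suppProj Y = sqr Y := by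
  simpa [Matrix.conjTranspose_mul, (suppProj_isHermitian Y).eq, (sqr_isHermitian Y).eq] using
    congrArg conjTranspose (suppProj_mul_sqr hY)

theorem suppProj_mul_isqr {Y : Matrix n n ℂ} (hY : Y.PosSemidef) : suppProj Y * isqr Y = isqr Y := by
  rw [suppProj, isqr, cfc_mul_cfc]
  refine hY.cfc_congr fun x hx => ?_
  split_ifs with h <;> simp [h]

theorem isqr_mul_suppProj {Y : Matrix n n ℂ} (hY : Y.PosSemidef) : isqr Y * suppProj Y = isqr Y := by
  simpa [Matrix.conjTranspose_mul, (suppProj_isHermitian Y).eq, (isqr_isHermitian Y).eq] using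
    congrArg conjTranspose (suppProj_mul_isqr hY)

theorem suppProj_mul_suppProj {Y : Matrix n n ℂ} :
    suppProj Y * suppProj Y = suppProj Y := by
  rw [suppProj, cfc_mul_cfc]
  congr 1; ext x; simp

theorem suppProj_mul_self {Y : Matrix n n ℂ} (hY : Y.PosSemidef) : suppProj Y * Y = Y := by
  nth_rw 2 [← sqr_mul_sqr hY]
  rw [← Matrix.mul_assoc, suppProj_mul_sqr hY, sqr_mul_sqr hY]

theorem isqr_mul_self_mul_isqr {Y : Matrix n n ℂ} (hY : Y.PosSemidef) :
    isqr Y * Y * isqr Y = suppProj Y := by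
  nth_rw 2 [← sqr_mul_sqr hY]
  rw [← Matrix.mul_assoc, isqr_mul_sqr hY, suppProj_mul_sqr hY, sqr_mul_isqr hY]

theorem isqr_mul_isqr {Y : Matrix n n ℂ} (hY : Y.PosSemidef) :
    isqr Y * isqr Y = cfc (fun x : ℝ => x⁻¹) Y := by
  rw [isqr, cfc_mul_cfc]
  refine hY.cfc_congr fun x hx => ?_
  rw [← mul_inv, Real.mul_self_sqrt hx]

/-- If `W Wᴴ` is annihilated by `1 - P`, then so is `W`. -/
theorem eq_zero_of_mul_conjTranspose {Q : Matrix m n ℂ} {l : Type*} [Fintype l]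
    {W : Matrix n l ℂ} (h : Q * (W * Wᴴ) = 0) : Q * W = 0 := by
  refine Matrix.self_mul_conjTranspose_eq_zero.1 ?_
  rw [conjTranspose_mul, Matrix.mul_assoc, ← Matrix.mul_assoc W, ← Matrix.mul_assoc Q, h,
    Matrix.zero_mul]

/-- W and W Wᴴ have the same range. -/
theorem suppProj_mul_of_mul_conjTranspose {l : Type*} [Fintype l]
    {W : Matrix n l ℂ} : suppProj (W * Wᴴ) * W = W := by
  have hY := posSemidef_self_mul_conjTranspose W
  have : (suppProj (W * Wᴴ) - 1) * W = 0 := by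
    apply eq_zero_of_mul_conjTranspose
    rw [Matrix.sub_mul, suppProj_mul_self hY, Matrix.one_mul, sub_self]
  rw [Matrix.sub_mul, Matrix.one_mul, sub_eq_zero] at this
  exact this

/-- C intertwines CᴴC with CCᴴ, so functions move from one to the other. This trades one power of
the argument for a congruence by C, both in the Jensen inequality and in exchanging the arguments of
a perspective. -/
theorem C_mul_cfc_mul_conjTranspose (C : Matrix n m ℂ) (f : ℝ → ℝ) :
    C * cfc f (Cᴴ * C) * Cᴴ = cfc (fun x => f x * x) (C * Cᴴ) := by
  have h := cfc_intertwine (A := C * Cᴴ) (B := Cᴴ * C) (C := C)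
    (isHermitian_mul_conjTranspose_self C) (isHermitian_conjTranspose_mul_self C)
    (by rw [Matrix.mul_assoc]) f
  rw [← h, Matrix.mul_assoc]
  nth_rw 2 [← cfc_id' ℝ (C * Cᴴ) (isHermitian_mul_conjTranspose_self C).isSelfAdjoint]
  rw [cfc_mul_cfc]

end FunctionalCalculus

/-! ### Supports -/

section Support

variable {n : Type*} [Fintype n] [DecidableEq n]

theorem suppLE_iff_exists_mul {X Y : Matrix n n ℂ} : SuppLE X Y ↔ ∃ Z, X = Y * Z := by
  constructor
  · intro h
    have : ∀ j, ∃ z : n → ℂ, Y *ᵥ z = X *ᵥ Pi.single j 1 := fun j =>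
      h ⟨Pi.single j 1, rfl⟩
    choose z hz using this
    refine ⟨Matrix.of fun i j => z j i, ?_⟩
    ext i j
    have := congrFun (hz j) i
    simp at this
    rw [← this]
    rfl
  · rintro ⟨Z, rfl⟩ _ ⟨v, rfl⟩
    exact ⟨Z *ᵥ v, by simp⟩

theorem SuppLE.suppProj_mul {X Y : Matrix n n ℂ} (hY : Y.PosSemidef) (h : SuppLE X Y) :
    suppProj Y * X = X := by
  obtain ⟨Z, rfl⟩ := suppLE_iff_exists_mul.1 h
  rw [← Matrix.mul_assoc, suppProj_mul_self hY]

theorem SuppLE.mul_suppProj {X Y : Matrix n n ℂ} (hX : X.IsHermitian) (hY : Y.PosSemidef)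
    (h : SuppLE X Y) : X * suppProj Y = X := by
  have := congrArg conjTranspose (h.suppProj_mul hY)
  rwa [conjTranspose_mul, (suppProj_isHermitian Y).eq, hX.eq] at this

theorem SuppLE.refl (X : Matrix n n ℂ) : SuppLE X X := le_refl (LinearMap.range X.mulVecLin)

theorem SuppLE.trans {X Y Z : Matrix n n ℂ} (h : SuppLE X Y) (h' : SuppLE Y Z) : SuppLE X Z :=
  le_trans (α := Submodule ℂ (n → ℂ)) h h'

theorem smul_posSemidef {X : Matrix n n ℂ} (hX : X.PosSemidef) {t : ℝ} (ht : 0 ≤ t) :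
    ((t : ℂ) • X).PosSemidef :=
  hX.smul (a := (t : ℂ)) (by exact_mod_cast ht)

theorem smul_one_eq_rdiag (t : ℝ) : ((t : ℂ) • (1 : Matrix n n ℂ)) = rdiag fun _ => t := by
  ext i j; simp [rdiag, Matrix.one_apply, Matrix.diagonal_apply]

/-- A Hermitian matrix is bounded by a multiple of the identity. -/
theorem Matrix.IsHermitian.exists_le_smul_one {T : Matrix n n ℂ} (hT : T.IsHermitian) :
    ∃ t : ℝ, 0 < t ∧ ((t : ℂ) • 1 - T).PosSemidef := by
  obtain ⟨U, hU, h⟩ := exists_unitary_diag hT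
  refine ⟨1 + ∑ i, |hT.eigenvalues i|, by positivity, ?_⟩
  have h2 : U * Uᴴ = 1 := mem_unitaryGroup_iff.1 hU
  set t : ℝ := 1 + ∑ i, |hT.eigenvalues i|
  have : (t : ℂ) • 1 - T = U * rdiag (fun i => t - hT.eigenvalues i) * Uᴴ := by
    have e : rdiag (fun i => t - hT.eigenvalues i) = (t : ℂ) • 1 - rdiag hT.eigenvalues := by
      rw [smul_one_eq_rdiag]; simp [rdiag, Matrix.diagonal_sub]
    rw [e, Matrix.mul_sub, Matrix.sub_mul, ← h]
    simp [h2]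
  rw [this]
  refine (rdiag_posSemidef fun i => ?_).mul_mul_conjTranspose_same U
  have := Finset.single_le_sum (f := fun i => |hT.eigenvalues i|) (fun i _ => abs_nonneg _)
    (Finset.mem_univ i)
  have h3 := le_abs_self (hT.eigenvalues i)
  simp only [t] at *
  linarith

/-- Domination by a multiple is the form of support inclusion that is visibly stable under
congruences and reindexing. -/
theorem suppLE_iff_exists_le {X Y : Matrix n n ℂ} (hX : X.PosSemidef) (hY : Y.PosSemidef) :
    SuppLE X Y ↔ ∃ t : ℝ, 0 < t ∧ ((t : ℂ) • Y - X).PosSemidef := by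
  constructor
  · intro h
    have hT : (isqr Y * X * isqr Y).IsHermitian := by
      have := isHermitian_mul_mul_conjTranspose (isqr Y) hX.1
      rwa [(isqr_isHermitian Y).eq] at this
    obtain ⟨t, ht, hp⟩ := hT.exists_le_smul_one
    refine ⟨t, ht, ?_⟩
    have := hp.mul_mul_conjTranspose_same (sqr Y)
    rw [(sqr_isHermitian Y).eq] at this
    convert this using 1
    have e : sqr Y * (isqr Y * X * isqr Y) * sqr Y = X := by
      calc sqr Y * (isqr Y * X * isqr Y) * sqr Y = (sqr Y * isqr Y) * X * (isqr Y * sqr Y) := by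
            simp only [Matrix.mul_assoc]
        _ = X := by rw [sqr_mul_isqr hY, isqr_mul_sqr hY, h.suppProj_mul hY, h.mul_suppProj hX.1 hY]
    rw [Matrix.mul_sub, Matrix.sub_mul, e]
    simp [sqr_mul_sqr hY]
  · rintro ⟨t, ht, hp⟩
    -- Q projects onto the kernel of Y. Compressing X ≤ tY by Q gives QXQ ≤ 0, hence QXQ = 0 and QX
    -- = 0.
    set Q := 1 - suppProj Y with hQ
    have hQh : Qᴴ = Q := by rw [hQ, conjTranspose_sub, (suppProj_isHermitian Y).eq]; simp
    have hQY : Q * Y = 0 := by rw [hQ, Matrix.sub_mul, suppProj_mul_self hY]; simp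
    have h1 : (-(Q * X * Qᴴ)).PosSemidef := by
      have := hp.mul_mul_conjTranspose_same Q
      rw [Matrix.mul_sub, Matrix.mul_smul, hQY] at this
      simpa using this
    have h2 := hX.mul_mul_conjTranspose_same Q
    have h3 : Q * X * Qᴴ = 0 := by
      rw [← h2.trace_eq_zero_iff]
      refine le_antisymm ?_ h2.trace_nonneg
      have := h1.trace_nonneg
      rw [trace_neg] at this
      exact neg_nonneg.1 this
    have h4 : Q * sqr X = 0 := by
      refine Matrix.self_mul_conjTranspose_eq_zero.1 ?_
      rw [conjTranspose_mul, (sqr_isHermitian X).eq, Matrix.mul_assoc, ← Matrix.mul_assoc (sqr X),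
        sqr_mul_sqr hX, ← Matrix.mul_assoc, h3]
    have h5 : Q * X = 0 := by rw [← sqr_mul_sqr hX, ← Matrix.mul_assoc, h4, Matrix.zero_mul]
    have h6 : X = suppProj Y * X := by
      rw [hQ, Matrix.sub_mul, Matrix.one_mul, sub_eq_zero] at h5; exact h5
    have h7 : suppProj Y = Y * cfc (fun x : ℝ => x⁻¹) Y := by
      nth_rw 2 [← cfc_id' ℝ Y hY.1.isSelfAdjoint]
      rw [cfc_mul_cfc, suppProj]
      congr 1; ext x; split_ifs with h <;> simp [h]
    refine suppLE_iff_exists_mul.2 ⟨cfc (fun x : ℝ => x⁻¹) Y * X, ?_⟩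
    rw [← Matrix.mul_assoc, ← h7, ← h6]

theorem SuppLE.conj {m : Type*} [Fintype m] [DecidableEq m] {X Y : Matrix n n ℂ}
    (hX : X.PosSemidef) (hY : Y.PosSemidef) (h : SuppLE X Y) (K : Matrix m n ℂ) :
    SuppLE (K * X * Kᴴ) (K * Y * Kᴴ) := by
  obtain ⟨t, ht, hp⟩ := (suppLE_iff_exists_le hX hY).1 h
  refine (suppLE_iff_exists_le (hX.mul_mul_conjTranspose_same K)
    (hY.mul_mul_conjTranspose_same K)).2 ⟨t, ht, ?_⟩
  have := hp.mul_mul_conjTranspose_same K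
  rwa [Matrix.mul_sub, Matrix.sub_mul, Matrix.mul_smul, Matrix.smul_mul] at this

end Support

/-! ### Operator inequalities -/

section LoewnerHeinz

open scoped MatrixOrder Matrix.Norms.L2Operator

variable {n : Type*} [Fintype n] [DecidableEq n]

/-- The Löwner–Heinz inequality. -/
theorem cfc_rpow_le_cfc_rpow {A B : Matrix n n ℂ} (hA : A.PosSemidef) (h : (B - A).PosSemidef)
    {p : ℝ} (hp : p ∈ Set.Icc (0 : ℝ) 1) :
    (cfc (fun x : ℝ => x ^ p) B - cfc (fun x : ℝ => x ^ p) A).PosSemidef := by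
  have h1 : A ≤ B := h
  have h0 : 0 ≤ A := nonneg_iff_posSemidef.2 hA
  have := CFC.rpow_le_rpow hp h1
  rw [CFC.rpow_eq_cfc_real h0, CFC.rpow_eq_cfc_real (h0.trans h1)] at this
  exact this

end LoewnerHeinz

/-! ### The operator Jensen inequality for powers and for x log x. -/

section Jensen

open scoped MatrixOrder

variable {n m : Type*} [Fintype n] [DecidableEq n] [Fintype m] [DecidableEq m]

theorem conj_le_conj {A B : Matrix n n ℂ} (h : A ≤ B) (K : Matrix m n ℂ) :
    K * A * Kᴴ ≤ K * B * Kᴴ := by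
  have := (le_iff.1 h).mul_mul_conjTranspose_same K
  rwa [Matrix.mul_sub, Matrix.sub_mul] at this

theorem trace_re_le {A B : Matrix n n ℂ} (h : A ≤ B) : A.trace.re ≤ B.trace.re := by
  have := (le_iff.1 h).trace_nonneg
  rw [trace_sub] at this
  have := (Complex.le_def.1 this).1
  simp at this
  linarith

/-- The functions `x ^ α` with `α ∈ [1, 2]` and `x log₂ x`. -/
def IsPowOrLog (f : ℝ → ℝ) : Prop :=
  (∃ α ∈ Set.Icc (1 : ℝ) 2, f = fun x => x ^ α) ∨ f = fun x => x * Real.logb 2 x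

theorem isPowOrLog_rpow {α : ℝ} (h : α ∈ Set.Icc (1 : ℝ) 2) : IsPowOrLog fun x => x ^ α :=
  Or.inl ⟨α, h, rfl⟩

theorem isPowOrLog_log : IsPowOrLog fun x => x * Real.logb 2 x := Or.inr rfl

/-- With C = V D^{1/2} one has (CCᴴ)^α = C (CᴴC)^{α-1} Cᴴ and CᴴC ≤ D. Löwner–Heinz with exponent α
- 1 replaces CᴴC by D, and the half powers of D in C restore D^α. -/
theorem rpow_jensen {V : Matrix n m ℂ} (hV : Vᴴ * V ≤ 1) {d : m → ℝ} (hd : ∀ i, 0 ≤ d i)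
    {α : ℝ} (hα : α ∈ Set.Icc (1 : ℝ) 2) :
    cfc (fun x : ℝ => x ^ α) (V * rdiag d * Vᴴ) ≤ V * rdiag (fun i => d i ^ α) * Vᴴ := by
  set S := rdiag fun i => √(d i) with hS
  have hSS : S * S = rdiag d := by
    rw [hS, rdiag_mul]; simp [Real.mul_self_sqrt (hd _)]
  have hSh : Sᴴ = S := rdiag_isHermitian _
  set C := V * S with hC
  have hCC : C * Cᴴ = V * rdiag d * Vᴴ := by
    rw [hC, conjTranspose_mul, hSh, ← hSS]; simp only [Matrix.mul_assoc]
  have hCC' : Cᴴ * C ≤ rdiag d := by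
    have := conj_le_conj hV S
    rw [Matrix.mul_one, hSh, hSS] at this
    rw [hC, conjTranspose_mul, hSh]
    simpa only [Matrix.mul_assoc] using this
  have h1 : cfc (fun x : ℝ => x ^ α) (C * Cᴴ) =
      C * cfc (fun x : ℝ => x ^ (α - 1)) (Cᴴ * C) * Cᴴ := by
    rw [C_mul_cfc_mul_conjTranspose]
    refine (posSemidef_self_mul_conjTranspose C).cfc_congr fun x hx => ?_
    rcases hx.eq_or_lt with rfl | hx
    · rw [mul_zero, Real.zero_rpow (by linarith [hα.1])]
    · rw [← Real.rpow_add_one hx.ne', sub_add_cancel]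
  have h2 := cfc_rpow_le_cfc_rpow (posSemidef_conjTranspose_mul_self C) hCC'
    (p := α - 1) ⟨by linarith [hα.1], by linarith [hα.2]⟩
  have h3 := conj_le_conj (le_iff.2 h2) C
  rw [← h1, cfc_rdiag, hCC] at h3
  refine h3.trans (le_of_eq ?_)
  rw [hC, conjTranspose_mul, hSh]
  have : S * rdiag (fun i => d i ^ (α - 1)) * S = rdiag fun i => d i ^ α := by
    rw [hS, rdiag_mul, rdiag_mul]
    congr 1; ext i
    rw [mul_right_comm, Real.mul_self_sqrt (hd i)]
    rcases (hd i).eq_or_lt with h | h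
    · rw [← h, zero_mul, Real.zero_rpow (by linarith [hα.1])]
    · rw [mul_comm, ← Real.rpow_add_one h.ne', sub_add_cancel]
  rw [← this]
  simp only [Matrix.mul_assoc]

theorem hasDerivAt_rpow_exponent {x : ℝ} (hx : 0 ≤ x) :
    HasDerivAt (fun a : ℝ => x ^ a) (x * Real.log x) 1 := by
  rcases hx.eq_or_lt with rfl | hx
  · have : (fun a : ℝ => (0 : ℝ) ^ a) =ᶠ[𝓝 1] fun _ => 0 := by
      filter_upwards [lt_mem_nhds (show (0 : ℝ) < 1 by norm_num)] with a ha
      exact Real.zero_rpow ha.ne'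
    rw [zero_mul]
    exact (hasDerivAt_const (1 : ℝ) (0 : ℝ)).congr_of_eventuallyEq this
  · have := (hasDerivAt_id (1 : ℝ)).const_rpow hx
    simpa [mul_comm] using this

theorem sum_mul_logb_eq_div {ι : Type*} [Fintype ι] (c x : ι → ℝ) :
    ∑ i, c i * (x i * Real.logb 2 (x i)) = (∑ i, c i * (x i * Real.log (x i))) / Real.log 2 := by
  rw [Finset.sum_div]
  refine Finset.sum_congr rfl fun i _ => ?_
  rw [Real.logb]; ring

/-- If a linear combination of powers `x ^ a` is nonnegative for `a ∈ [1, 2]` and vanishes at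
`a = 1`, then so is the corresponding combination of `x log₂ x`. -/
theorem sum_mul_log_le_of_sum_rpow_le {ι κ : Type*} [Fintype ι] [Fintype κ] {c x : ι → ℝ}
    {d y : κ → ℝ} (hx : ∀ i, 0 ≤ x i) (hy : ∀ i, 0 ≤ y i)
    (h1 : ∑ i, c i * x i = ∑ j, d j * y j)
    (h : ∀ a ∈ Set.Icc (1 : ℝ) 2, ∑ i, c i * x i ^ a ≤ ∑ j, d j * y j ^ a) :
    ∑ i, c i * (x i * Real.logb 2 (x i)) ≤ ∑ j, d j * (y j * Real.logb 2 (y j)) := by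
  -- The gap g vanishes at 1 and is nonnegative on (1, 2], so its right derivative at 1 is
  -- nonnegative; the derivative of x^a at a = 1 is x log x.
  set g : ℝ → ℝ := fun a => ∑ j, d j * y j ^ a - ∑ i, c i * x i ^ a with hg
  have hder : HasDerivAt g (∑ j, d j * (y j * Real.log (y j)) -
      ∑ i, c i * (x i * Real.log (x i))) 1 := by
    refine HasDerivAt.sub ?_ ?_
    · exact HasDerivAt.fun_sum fun j _ => (hasDerivAt_rpow_exponent (hy j)).const_mul _
    · exact HasDerivAt.fun_sum fun j _ => (hasDerivAt_rpow_exponent (hx j)).const_mul _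
  have hg1 : g 1 = 0 := by simp [hg, h1]
  have hpos : 0 ≤ ∑ j, d j * (y j * Real.log (y j)) - ∑ i, c i * (x i * Real.log (x i)) := by
    have ht := (hasDerivAt_iff_tendsto_slope.1 hder).mono_left
      (nhdsWithin_mono 1 (show Set.Ioi (1 : ℝ) ⊆ {1}ᶜ from fun a ha => ne_of_gt ha))
    refine ge_of_tendsto ht ?_
    filter_upwards [Ioc_mem_nhdsGT (show (1 : ℝ) < 2 by norm_num)] with a ha
    rw [slope_def_field, hg1, sub_zero]
    refine div_nonneg ?_ (by linarith [ha.1])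
    have := h a ⟨ha.1.le, ha.2⟩
    simp only [hg]; linarith
  have hl : 0 < Real.log 2 := Real.log_pos (by norm_num)
  rw [sum_mul_logb_eq_div, sum_mul_logb_eq_div]
  gcongr
  linarith

theorem quadForm_mul_rdiag (W : Matrix n m ℂ) (d : m → ℝ) (v : n → ℂ) :
    star v ⬝ᵥ ((W * rdiag d * Wᴴ) *ᵥ v) =
      ((∑ i, Complex.normSq ((Wᴴ *ᵥ v) i) * d i : ℝ) : ℂ) := by
  have : star v ⬝ᵥ ((W * rdiag d * Wᴴ) *ᵥ v) =
      star (Wᴴ *ᵥ v) ⬝ᵥ (rdiag d *ᵥ (Wᴴ *ᵥ v)) := by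
    rw [star_mulVec, conjTranspose_conjTranspose, ← dotProduct_mulVec, mulVec_mulVec, mulVec_mulVec]
  rw [this]
  simp only [dotProduct, rdiag, mulVec_diagonal, Pi.star_apply, RCLike.star_def]
  push_cast
  refine Finset.sum_congr rfl fun i _ => ?_
  rw [Complex.normSq_eq_conj_mul_self]; ring

theorem le_of_quadForm {A B : Matrix n n ℂ} (hA : A.IsHermitian) (hB : B.IsHermitian)
    (h : ∀ v : n → ℂ, star v ⬝ᵥ (A *ᵥ v) ≤ star v ⬝ᵥ (B *ᵥ v)) : A ≤ B := by
  refine le_iff.2 (PosSemidef.of_dotProduct_mulVec_nonneg (hB.sub hA) fun v => ?_)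
  rw [sub_mulVec, dotProduct_sub]
  exact sub_nonneg.2 (h v)

theorem quadForm_le_of_le {A B : Matrix n n ℂ} (h : A ≤ B) (v : n → ℂ) :
    star v ⬝ᵥ (A *ᵥ v) ≤ star v ⬝ᵥ (B *ᵥ v) := by
  have := (le_iff.1 h).dotProduct_mulVec_nonneg v
  rw [sub_mulVec, dotProduct_sub] at this
  exact sub_nonneg.1 this

/-- The operator Jensen inequality for contractions. -/
theorem IsPowOrLog.jensen {f : ℝ → ℝ} (hf : IsPowOrLog f) {V : Matrix n m ℂ} (hV : Vᴴ * V ≤ 1)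
    {d : m → ℝ} (hd : ∀ i, 0 ≤ d i) :
    cfc f (V * rdiag d * Vᴴ) ≤ V * rdiag (fun i => f (d i)) * Vᴴ := by
  rcases hf with ⟨α, hα, rfl⟩ | rfl
  · exact rpow_jensen hV hd hα
  -- Tested against v, both sides of the power inequality become weighted sums of eigenvalue powers.
  -- They agree at exponent 1, where both equal the quadratic form of V D Vᴴ, so differentiation
  -- there is allowed.
  obtain ⟨U, hU, e, he, h⟩ :=
    ((rdiag_posSemidef hd).mul_mul_conjTranspose_same V).exists_unitary_diag
  refine le_of_quadForm (cfc_isHermitian _ _)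
    (isHermitian_mul_mul_conjTranspose _ (rdiag_isHermitian _)) fun v => ?_
  rw [cfc_eq_of_unitary_diag _ hU h, quadForm_mul_rdiag, quadForm_mul_rdiag, Complex.real_le_real]
  refine sum_mul_log_le_of_sum_rpow_le he hd ?_ fun a ha => ?_
  · rw [← Complex.ofReal_inj, ← quadForm_mul_rdiag, ← quadForm_mul_rdiag, ← h]
  · have := quadForm_le_of_le (rpow_jensen hV hd ha) v
    rwa [cfc_eq_of_unitary_diag _ hU h, quadForm_mul_rdiag, quadForm_mul_rdiag,
      Complex.real_le_real] at this

end Jensen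

/-! ### Maximal operator perspectives -/

section Perspective

open scoped MatrixOrder

variable {n m : Type*} [Fintype n] [DecidableEq n] [Fintype m] [DecidableEq m]

/-- The operator `Y^{1/2} f(Y^{-1/2} X Y^{-1/2}) Y^{1/2}`, with inverses taken on supports. -/
noncomputable def perspective (f : ℝ → ℝ) (X Y : Matrix n n ℂ) : Matrix n n ℂ :=
  sqr Y * cfc f (isqr Y * X * isqr Y) * sqr Y

theorem perspective_isHermitian (f : ℝ → ℝ) (X Y : Matrix n n ℂ) :
    (perspective f X Y).IsHermitian := by
  have := isHermitian_mul_mul_conjTranspose (sqr Y)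
    (cfc_isHermitian f (isqr Y * X * isqr Y))
  rwa [(sqr_isHermitian Y).eq] at this

theorem isqr_conj_posSemidef {X : Matrix n n ℂ} (hX : X.PosSemidef) (Y : Matrix n n ℂ) :
    (isqr Y * X * isqr Y).PosSemidef := by
  have := hX.mul_mul_conjTranspose_same (isqr Y)
  rwa [(isqr_isHermitian Y).eq] at this

theorem sqr_isqr_conj {X Y : Matrix n n ℂ} (hX : X.PosSemidef) (hY : Y.PosSemidef)
    (h : SuppLE X Y) : sqr Y * (isqr Y * X * isqr Y) * sqr Y = X := by
  calc sqr Y * (isqr Y * X * isqr Y) * sqr Y = (sqr Y * isqr Y) * X * (isqr Y * sqr Y) := by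
        simp only [Matrix.mul_assoc]
    _ = X := by rw [sqr_mul_isqr hY, isqr_mul_sqr hY, h.suppProj_mul hY, h.mul_suppProj hX.1 hY]

/-- Simultaneous congruence to diagonal form. -/
theorem exists_congr_diag {X Y : Matrix n n ℂ} (hX : X.PosSemidef) (hY : Y.PosSemidef)
    (h : SuppLE X Y) :
    ∃ (W : Matrix n n ℂ) (d : n → ℝ), (∀ i, 0 ≤ d i) ∧ Y = W * Wᴴ ∧ X = W * rdiag d * Wᴴ ∧
      (∀ f, perspective f X Y = W * rdiag (fun i => f (d i)) * Wᴴ) ∧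
      ∀ t : ℝ, 0 < t → ((t : ℂ) • Y - X).PosSemidef → ∀ i, d i ≤ t := by
  obtain ⟨U, hU, d, hd, e⟩ := (isqr_conj_posSemidef hX Y).exists_unitary_diag
  have h1 : Uᴴ * U = 1 := mem_unitaryGroup_iff'.1 hU
  have h2 : U * Uᴴ = 1 := mem_unitaryGroup_iff.1 hU
  refine ⟨sqr Y * U, d, hd, ?_, ?_, ?_, ?_⟩
  · rw [conjTranspose_mul, (sqr_isHermitian Y).eq, Matrix.mul_assoc, ← Matrix.mul_assoc U, h2,
      Matrix.one_mul, sqr_mul_sqr hY]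
  · rw [conjTranspose_mul, (sqr_isHermitian Y).eq]
    conv_lhs => rw [← sqr_isqr_conj hX hY h, e]
    simp only [Matrix.mul_assoc]
  · intro f
    rw [conjTranspose_mul, (sqr_isHermitian Y).eq, perspective, cfc_eq_of_unitary_diag f hU e]
    simp only [Matrix.mul_assoc]
  · intro t ht hp i
    have h3 := hp.mul_mul_conjTranspose_same (Uᴴ * isqr Y)
    have h4 : (rdiag (fun _ : n => t) - rdiag d).PosSemidef := by
      -- Conjugating X ≤ tY by Y^{-1/2} only bounds by t times the support projection. The missing
      -- multiple of the kernel projection is added back by hand.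
      have h5 : ((t : ℂ) • (1 - suppProj Y)).PosSemidef := by
        refine smul_posSemidef ?_ ht.le
        have : 1 - suppProj Y = (1 - suppProj Y) * (1 - suppProj Y)ᴴ := by
          rw [conjTranspose_sub, (suppProj_isHermitian Y).eq, conjTranspose_one, Matrix.mul_sub,
            Matrix.sub_mul, Matrix.mul_one, Matrix.mul_one, Matrix.sub_mul, Matrix.one_mul,
            suppProj_mul_suppProj, sub_self, sub_zero]
        rw [this]
        exact posSemidef_self_mul_conjTranspose _
      have h6 := h5.mul_mul_conjTranspose_same Uᴴ
      have h7 := h3.add h6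
      convert h7 using 1
      rw [conjTranspose_mul, (isqr_isHermitian Y).eq, conjTranspose_conjTranspose, ← smul_one_eq_rdiag]
      have h8 : Uᴴ * isqr Y * ((t : ℂ) • Y - X) * (isqr Y * U) =
          Uᴴ * ((t : ℂ) • suppProj Y) * U - rdiag d := by
        rw [Matrix.mul_sub, Matrix.sub_mul]
        congr 1
        · rw [← isqr_mul_self_mul_isqr hY]
          simp only [Matrix.mul_assoc, Matrix.mul_smul, Matrix.smul_mul]
        · have : Uᴴ * isqr Y * X * (isqr Y * U) = Uᴴ * (isqr Y * X * isqr Y) * U := by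
            simp only [Matrix.mul_assoc]
          rw [this, e]
          calc Uᴴ * (U * rdiag d * Uᴴ) * U = (Uᴴ * U) * rdiag d * (Uᴴ * U) := by
                simp only [Matrix.mul_assoc]
            _ = rdiag d := by rw [h1]; simp
      rw [h8, smul_sub, Matrix.mul_sub, Matrix.sub_mul]
      have : Uᴴ * ((t : ℂ) • (1 : Matrix n n ℂ)) * U = (t : ℂ) • 1 := by
        simp [h1]
      rw [this]
      abel
    have := h4.diag_nonneg (i := i)
    simp [rdiag] at this
    exact_mod_cast this

/-- V = (WWᴴ)^{-1/2} W satisfies VVᴴ = `suppProj (W * Wᴴ)`, so V is a partial isometry and VᴴV is a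
projection. -/
theorem conjTranspose_isqr_mul_le_one (W : Matrix n m ℂ) :
    (isqr (W * Wᴴ) * W)ᴴ * (isqr (W * Wᴴ) * W) ≤ 1 := by
  have hY := posSemidef_self_mul_conjTranspose W
  set Y := W * Wᴴ with hYdef
  set V := isqr Y * W with hV
  have hVV : V * Vᴴ = suppProj Y := by
    rw [hV, conjTranspose_mul, (isqr_isHermitian Y).eq, ← isqr_mul_self_mul_isqr hY, hYdef]
    simp only [Matrix.mul_assoc]
  have hPV : suppProj Y * V = V := by
    rw [hV, ← Matrix.mul_assoc, suppProj_mul_isqr hY]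
  have hidem : (Vᴴ * V) * (Vᴴ * V) = Vᴴ * V := by
    calc (Vᴴ * V) * (Vᴴ * V) = Vᴴ * ((V * Vᴴ) * V) := by simp only [Matrix.mul_assoc]
      _ = _ := by rw [hVV, hPV]
  rw [le_iff]
  have : 1 - Vᴴ * V = (1 - Vᴴ * V) * (1 - Vᴴ * V)ᴴ := by
    rw [conjTranspose_sub, (isHermitian_conjTranspose_mul_self V).eq, conjTranspose_one,
      Matrix.mul_sub, Matrix.sub_mul, Matrix.mul_one, Matrix.mul_one, Matrix.sub_mul,
      Matrix.one_mul, hidem, sub_self, sub_zero]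
  rw [this]
  exact posSemidef_self_mul_conjTranspose _

theorem sqr_mul_isqr_mul (W : Matrix n m ℂ) : sqr (W * Wᴴ) * (isqr (W * Wᴴ) * W) = W := by
  rw [← Matrix.mul_assoc, sqr_mul_isqr (posSemidef_self_mul_conjTranspose W),
    suppProj_mul_of_mul_conjTranspose]

/-- The operator Jensen inequality for the contraction (WWᴴ)^{-1/2} W, conjugated by (WWᴴ)^{1/2}.
The factor W is arbitrary and possibly rectangular; equality is only available for the special
factor of `exists_congr_diag`. -/
theorem IsPowOrLog.perspective_le {f : ℝ → ℝ} (hf : IsPowOrLog f) (W : Matrix n m ℂ) {d : m → ℝ}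
    (hd : ∀ i, 0 ≤ d i) :
    perspective f (W * rdiag d * Wᴴ) (W * Wᴴ) ≤ W * rdiag (fun i => f (d i)) * Wᴴ := by
  have h := conj_le_conj (hf.jensen (conjTranspose_isqr_mul_le_one W) hd) (sqr (W * Wᴴ))
  have e : ∀ g : m → ℝ, (isqr (W * Wᴴ) * W) * rdiag g * (isqr (W * Wᴴ) * W)ᴴ =
      isqr (W * Wᴴ) * (W * rdiag g * Wᴴ) * isqr (W * Wᴴ) := by
    intro g
    rw [conjTranspose_mul, (isqr_isHermitian _).eq]
    simp only [Matrix.mul_assoc]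
  have e2 : sqr (W * Wᴴ) * ((isqr (W * Wᴴ) * W) * rdiag (fun i => f (d i)) *
      (isqr (W * Wᴴ) * W)ᴴ) * (sqr (W * Wᴴ))ᴴ = W * rdiag (fun i => f (d i)) * Wᴴ := by
    have := congrArg conjTranspose (sqr_mul_isqr_mul W)
    rw [conjTranspose_mul] at this
    calc _ = (sqr (W * Wᴴ) * (isqr (W * Wᴴ) * W)) * rdiag (fun i => f (d i)) *
        ((isqr (W * Wᴴ) * W)ᴴ * (sqr (W * Wᴴ))ᴴ) := by simp only [Matrix.mul_assoc]
      _ = _ := by rw [sqr_mul_isqr_mul, this]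
  rw [e2, e, (sqr_isHermitian _).eq] at h
  exact h

/-- The transformer inequality. -/
theorem IsPowOrLog.transformer {f : ℝ → ℝ} (hf : IsPowOrLog f) {X Y : Matrix n n ℂ}
    (hX : X.PosSemidef) (hY : Y.PosSemidef) (h : SuppLE X Y) (K : Matrix m n ℂ) :
    perspective f (K * X * Kᴴ) (K * Y * Kᴴ) ≤ K * perspective f X Y * Kᴴ := by
  obtain ⟨W, d, hd, h1, h2, h3, -⟩ := exists_congr_diag hX hY h
  have := hf.perspective_le (K * W) hd
  rw [h3 f]
  -- KW factorizes the transformed pair with the same diagonal D as before.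
  have e : ∀ Z : Matrix n n ℂ, (K * W) * Z * (K * W)ᴴ = K * (W * Z * Wᴴ) * Kᴴ := by
    intro Z; rw [conjTranspose_mul]; simp only [Matrix.mul_assoc]
  have e' : (K * W) * (K * W)ᴴ = K * (W * Wᴴ) * Kᴴ := by
    rw [conjTranspose_mul]; simp only [Matrix.mul_assoc]
  rwa [e, e, e', ← h1, ← h2] at this

/-- The transformer equality for congruences with a two-sided inverse. -/
theorem IsPowOrLog.transformer_eq {f : ℝ → ℝ} (hf : IsPowOrLog f) {X Y : Matrix n n ℂ}
    (hX : X.PosSemidef) (hY : Y.PosSemidef) (h : SuppLE X Y) {K : Matrix m n ℂ} {L : Matrix n m ℂ}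
    (hLK : L * K = 1) (hKL : K * L = 1) :
    perspective f (K * X * Kᴴ) (K * Y * Kᴴ) = K * perspective f X Y * Kᴴ := by
  refine le_antisymm (hf.transformer hX hY h K) ?_
  -- The reverse inequality is the transformer inequality for the inverse L, conjugated back by K.
  have h1 := hf.transformer (hX.mul_mul_conjTranspose_same K) (hY.mul_mul_conjTranspose_same K)
    (h.conj hX hY K) L
  have h2 := conj_le_conj h1 K
  have hLK' : Kᴴ * Lᴴ = 1 := by rw [← conjTranspose_mul, hLK, conjTranspose_one]
  have hKL' : Lᴴ * Kᴴ = 1 := by rw [← conjTranspose_mul, hKL, conjTranspose_one]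
  have e : ∀ Z : Matrix n n ℂ, L * (K * Z * Kᴴ) * Lᴴ = Z := by
    intro Z
    calc _ = (L * K) * Z * (Kᴴ * Lᴴ) := by simp only [Matrix.mul_assoc]
      _ = Z := by rw [hLK, hLK']; simp
  have e2 : ∀ Z : Matrix m m ℂ, K * (L * Z * Lᴴ) * Kᴴ = Z := by
    intro Z
    calc _ = (K * L) * Z * (Lᴴ * Kᴴ) := by simp only [Matrix.mul_assoc]
      _ = Z := by rw [hKL, hKL']; simp
  rwa [e, e, e2] at h2

theorem perspective_self {f : ℝ → ℝ} (h0 : f 0 = 0) (h1 : f 1 = 1) {X : Matrix n n ℂ}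
    (hX : X.PosSemidef) : perspective f X X = X := by
  have h2 : cfc f (suppProj X) = suppProj X := by
    obtain ⟨U, hU, d, hd, e⟩ := hX.exists_unitary_diag
    have e2 := cfc_eq_of_unitary_diag (fun x : ℝ => if x = 0 then 0 else 1) hU e
    rw [suppProj, cfc_eq_of_unitary_diag f hU e2, e2]
    congr 3
    ext i; split_ifs <;> assumption
  rw [perspective, isqr_mul_self_mul_isqr hX, h2, sqr_mul_suppProj hX, sqr_mul_sqr hX]

theorem perspective_posSemidef {f : ℝ → ℝ} (h : ∀ x, 0 ≤ x → 0 ≤ f x) {X : Matrix n n ℂ}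
    (hX : X.PosSemidef) (Y : Matrix n n ℂ) : (perspective f X Y).PosSemidef := by
  have := ((isqr_conj_posSemidef hX Y).cfc_posSemidef h).mul_mul_conjTranspose_same (sqr Y)
  rwa [(sqr_isHermitian Y).eq] at this

end Perspective

/-! ### Kronecker products -/

section Kronecker

variable {n m : Type*} [Fintype n] [DecidableEq n] [Fintype m] [DecidableEq m]

theorem rdiag_kronecker (d : n → ℝ) (e : m → ℝ) :
    rdiag d ⊗ₖ rdiag e = rdiag fun p : n × m => d p.1 * e p.2 := by
  rw [rdiag, rdiag, diagonal_kronecker_diagonal, rdiag]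
  push_cast
  rfl

theorem cfc_kronecker {A : Matrix n n ℂ} {B : Matrix m m ℂ} (hA : A.PosSemidef)
    (hB : B.PosSemidef) {f : ℝ → ℝ} (hf : ∀ x y, 0 ≤ x → 0 ≤ y → f (x * y) = f x * f y) :
    cfc f (A ⊗ₖ B) = cfc f A ⊗ₖ cfc f B := by
  obtain ⟨U, hU, d, hd, h⟩ := hA.exists_unitary_diag
  obtain ⟨V, hV, e, he, h'⟩ := hB.exists_unitary_diag
  have key : ∀ (d : n → ℝ) (e : m → ℝ), (U * rdiag d * Uᴴ) ⊗ₖ (V * rdiag e * Vᴴ) =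
      (U ⊗ₖ V) * (rdiag fun p : n × m => d p.1 * e p.2) * (U ⊗ₖ V)ᴴ := by
    intro d e
    rw [mul_kronecker_mul, mul_kronecker_mul, rdiag_kronecker, conjTranspose_kronecker]
  have h2 : A ⊗ₖ B = (U ⊗ₖ V) * (rdiag fun p : n × m => d p.1 * e p.2) * (U ⊗ₖ V)ᴴ := by
    rw [← key, ← h, ← h']
  rw [cfc_eq_of_unitary_diag f (kronecker_mem_unitary hU hV) h2, cfc_eq_of_unitary_diag f hU h,
    cfc_eq_of_unitary_diag f hV h', key]
  simp only [hf _ _ (hd _) (he _)]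

/-- The square root, its inverse and x^α are multiplicative on nonnegative reals, so each of them
passes through the Kronecker product of positive semidefinite matrices. -/
theorem perspective_kronecker {X₁ Y₁ : Matrix n n ℂ} {X₂ Y₂ : Matrix m m ℂ}
    (hX₁ : X₁.PosSemidef) (hY₁ : Y₁.PosSemidef) (hX₂ : X₂.PosSemidef) (hY₂ : Y₂.PosSemidef)
    (α : ℝ) :
    perspective (fun x => x ^ α) (X₁ ⊗ₖ X₂) (Y₁ ⊗ₖ Y₂) =
      perspective (fun x => x ^ α) X₁ Y₁ ⊗ₖ perspective (fun x => x ^ α) X₂ Y₂ := by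
  have h1 : sqr (Y₁ ⊗ₖ Y₂) = sqr Y₁ ⊗ₖ sqr Y₂ :=
    cfc_kronecker hY₁ hY₂ fun x y hx _ => Real.sqrt_mul hx y
  have h2 : isqr (Y₁ ⊗ₖ Y₂) = isqr Y₁ ⊗ₖ isqr Y₂ :=
    cfc_kronecker hY₁ hY₂ fun x y hx _ => by rw [Real.sqrt_mul hx y, mul_inv]
  rw [perspective, h1, h2, ← mul_kronecker_mul, ← mul_kronecker_mul,
    cfc_kronecker (isqr_conj_posSemidef hX₁ Y₁) (isqr_conj_posSemidef hX₂ Y₂)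
      fun x y hx hy => Real.mul_rpow hx hy, ← mul_kronecker_mul, ← mul_kronecker_mul]
  rfl

end Kronecker

/-! ### The geometric mean and the Belavkin–Staszewski operator as perspectives -/

section Continuity

open scoped Matrix.Norms.L2Operator

variable {n : Type*} [Fintype n] [DecidableEq n]

theorem continuousOn_cfc_selfAdjoint {f : ℝ → ℝ} (hf : Continuous f) :
    ContinuousOn (fun A : Matrix n n ℂ => cfc f A) {A | IsSelfAdjoint A} :=
  ContinuousOn.cfc_of_mem_nhdsSet (s := Set.univ) f (by simp) continuousOn_id (fun _ h => h)
    hf.continuousOn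

theorem tendsto_cfc_of_tendsto {f : ℝ → ℝ} (hf : Continuous f) {ι : Type*} {l : Filter ι}
    {T : ι → Matrix n n ℂ} {T₀ : Matrix n n ℂ} (hT : ∀ᶠ i in l, (T i).IsHermitian)
    (hT₀ : T₀.IsHermitian) (h : Tendsto T l (𝓝 T₀)) :
    Tendsto (fun i => cfc f (T i)) l (𝓝 (cfc f T₀)) :=
  ((continuousOn_cfc_selfAdjoint hf) T₀ hT₀).tendsto.comp
    (tendsto_nhdsWithin_iff.2 ⟨h, hT⟩)

end Continuity

/-! ### Exchanging the arguments of a perspective and removing the regularization. -/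

section Identification

variable {n : Type*} [Fintype n] [DecidableEq n]

theorem suppProj_mul_sqr_of_suppLE {X Y : Matrix n n ℂ} (hX : X.PosSemidef) (hY : Y.PosSemidef)
    (h : SuppLE X Y) : suppProj Y * sqr X = sqr X := by
  have : (suppProj Y - 1) * sqr X = 0 := by
    apply eq_zero_of_mul_conjTranspose
    rw [(sqr_isHermitian X).eq, sqr_mul_sqr hX, Matrix.sub_mul, h.suppProj_mul hY, Matrix.one_mul,
      sub_self]
  rwa [Matrix.sub_mul, Matrix.one_mul, sub_eq_zero] at this

/-- For C = Y^{-1/2} X^{1/2} the left side involves g(CᴴC) and the right side a function of CCᴴ.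
Support inclusion gives X^{1/2} = Y^{1/2} C, and `C_mul_cfc_mul_conjTranspose` moves g across. -/
theorem sqr_mul_cfc_mul_sqr {X Y : Matrix n n ℂ} (hX : X.PosSemidef) (hY : Y.PosSemidef)
    (h : SuppLE X Y) (g : ℝ → ℝ) :
    sqr X * cfc g (sqr X * cfc (fun x : ℝ => x⁻¹) Y * sqr X) * sqr X =
      perspective (fun x => g x * x) X Y := by
  set C := isqr Y * sqr X with hC
  have h1 : sqr X = sqr Y * C := by
    rw [hC, ← Matrix.mul_assoc, sqr_mul_isqr hY, suppProj_mul_sqr_of_suppLE hX hY h]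
  have h1' : sqr X = Cᴴ * sqr Y := by
    have := congrArg conjTranspose h1
    rwa [conjTranspose_mul, (sqr_isHermitian X).eq, (sqr_isHermitian Y).eq] at this
  have h2 : Cᴴ * C = sqr X * cfc (fun x : ℝ => x⁻¹) Y * sqr X := by
    rw [hC, conjTranspose_mul, (sqr_isHermitian X).eq, (isqr_isHermitian Y).eq, ← isqr_mul_isqr hY]
    simp only [Matrix.mul_assoc]
  have h3 : C * Cᴴ = isqr Y * X * isqr Y := by
    rw [hC, conjTranspose_mul, (sqr_isHermitian X).eq, (isqr_isHermitian Y).eq]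
    nth_rw 3 [← sqr_mul_sqr hX]
    simp only [Matrix.mul_assoc]
  rw [perspective, ← h2, ← h3, ← C_mul_cfc_mul_conjTranspose]
  calc sqr X * cfc g (Cᴴ * C) * sqr X = (sqr Y * C) * cfc g (Cᴴ * C) * (Cᴴ * sqr Y) := by
        rw [← h1, ← h1']
    _ = _ := by simp only [Matrix.mul_assoc]

theorem bsOp_eq_perspective {X Y : Matrix n n ℂ} (hX : X.PosSemidef) (hY : Y.PosSemidef)
    (h : SuppLE X Y) : bsOp X Y = perspective (fun x => x * Real.logb 2 x) X Y := by
  have := sqr_mul_cfc_mul_sqr hX hY h (Real.logb 2)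
  simp only [mul_comm (Real.logb 2 _)] at this
  exact this

theorem geoMeanPos_eq_perspective (β : ℝ) (X Y : Matrix n n ℂ) :
    geoMeanPos β X Y = perspective (fun x => x ^ β) Y X := rfl

theorem suppProj_eq_one {X : Matrix n n ℂ} (hX : X.PosDef) : suppProj X = 1 := by
  have h := suppProj_mul_self hX.posSemidef
  exact (hX.isUnit.mul_eq_right).1 h

theorem suppLE_of_posDef {X Y : Matrix n n ℂ} (hY : Y.PosDef) : SuppLE X Y := by
  refine suppLE_iff_exists_mul.2 ⟨Y⁻¹ * X, ?_⟩
  rw [← Matrix.mul_assoc, Matrix.mul_nonsing_inv _ ((isUnit_iff_isUnit_det _).1 hY.isUnit),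
    Matrix.one_mul]

theorem cfc_of_mul_eq_one {S R : Matrix n n ℂ} (hR : R.PosSemidef) (h : S * R = 1) (g : ℝ → ℝ) :
    cfc g S = cfc (fun x => g x⁻¹) R := by
  obtain ⟨U, hU, r, hr, e⟩ := hR.exists_unitary_diag
  have h1 : Uᴴ * U = 1 := mem_unitaryGroup_iff'.1 hU
  have h2 : U * Uᴴ = 1 := mem_unitaryGroup_iff.1 hU
  have h3 : (Uᴴ * S * U) * rdiag r = 1 := by
    calc (Uᴴ * S * U) * rdiag r = Uᴴ * (S * (U * rdiag r * Uᴴ)) * U := by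
          simp only [Matrix.mul_assoc, h1, Matrix.mul_one]
      _ = 1 := by rw [← e, h, Matrix.mul_one, h1]
  have h4 : ∀ i, r i ≠ 0 := by
    intro i hi
    have := congrFun (congrFun h3 i) i
    rw [rdiag, mul_diagonal, hi] at this
    simp at this
  have h5 : S = U * rdiag (fun i => (r i)⁻¹) * Uᴴ := by
    have h6 : R * (U * rdiag (fun i => (r i)⁻¹) * Uᴴ) = 1 := by
      rw [e]
      calc _ = U * (rdiag r * (Uᴴ * U) * rdiag fun i => (r i)⁻¹) * Uᴴ := by
            simp only [Matrix.mul_assoc]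
        _ = 1 := by
            rw [h1, Matrix.mul_one, rdiag_mul]
            simp only [mul_inv_cancel₀ (h4 _), rdiag_one, Matrix.mul_one, h2]
    calc S = S * (R * (U * rdiag (fun i => (r i)⁻¹) * Uᴴ)) := by rw [h6, Matrix.mul_one]
      _ = _ := by rw [← Matrix.mul_assoc, h, Matrix.one_mul]
  rw [cfc_eq_of_unitary_diag _ hU e, cfc_eq_of_unitary_diag _ hU h5]

/-- X^{-1/2} Y X^{-1/2} is the inverse of X^{1/2} Y^{-1} X^{1/2}, so the negative power of the
former is a positive power of the latter, to which `sqr_mul_cfc_mul_sqr` applies. After the exchange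
the exponent is positive and continuous at 0, which makes the limit tractable. -/
theorem perspective_rpow_swap {X Y : Matrix n n ℂ} (hX : X.PosDef) (hY : Y.PosDef) {α : ℝ}
    (hα : α ≠ 0) :
    perspective (fun x => x ^ (1 - α)) Y X = perspective (fun x => x ^ α) X Y := by
  have h := sqr_mul_cfc_mul_sqr hX.posSemidef hY.posSemidef (suppLE_of_posDef hY)
    fun x => (x⁻¹) ^ (1 - α)
  have e : perspective (fun x => x⁻¹ ^ (1 - α) * x) X Y = perspective (fun x => x ^ α) X Y := by
    rw [perspective, perspective,
      (isqr_conj_posSemidef hX.posSemidef Y).cfc_congr (g := fun x => x ^ α)]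
    intro x hx
    rcases hx.eq_or_lt with rfl | hx
    · rw [mul_zero, Real.zero_rpow hα]
    · rw [Real.inv_rpow hx.le, ← Real.rpow_neg hx.le, ← Real.rpow_add_one hx.ne']
      ring_nf
  rw [← e, ← h, perspective]
  rw [cfc_of_mul_eq_one (S := isqr X * Y * isqr X)
    (R := sqr X * cfc (fun x : ℝ => x⁻¹) Y * sqr X)]
  · rw [← isqr_mul_isqr hY.posSemidef]
    have := posSemidef_self_mul_conjTranspose (sqr X * isqr Y)
    rw [conjTranspose_mul, (sqr_isHermitian X).eq, (isqr_isHermitian Y).eq] at this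
    simpa only [Matrix.mul_assoc] using this
  · have h1 : Y * cfc (fun x : ℝ => x⁻¹) Y = 1 := by
      rw [← isqr_mul_isqr hY.posSemidef]
      nth_rw 1 [← sqr_mul_sqr hY.posSemidef]
      calc sqr Y * sqr Y * (isqr Y * isqr Y) = sqr Y * (sqr Y * isqr Y) * isqr Y := by
            simp only [Matrix.mul_assoc]
        _ = 1 := by
            rw [sqr_mul_isqr hY.posSemidef, suppProj_eq_one hY, Matrix.mul_one,
              sqr_mul_isqr hY.posSemidef, suppProj_eq_one hY]
    calc isqr X * Y * isqr X * (sqr X * cfc (fun x : ℝ => x⁻¹) Y * sqr X)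
        = isqr X * (Y * (isqr X * sqr X) * cfc (fun x : ℝ => x⁻¹) Y) * sqr X := by
          simp only [Matrix.mul_assoc]
      _ = 1 := by
          rw [isqr_mul_sqr hX.posSemidef, suppProj_eq_one hX, Matrix.mul_one, h1, Matrix.mul_one,
            isqr_mul_sqr hX.posSemidef, suppProj_eq_one hX]

theorem posDef_add_smul_one {X : Matrix n n ℂ} (hX : X.PosSemidef) {ε : ℝ} (hε : 0 < ε) :
    (X + (ε : ℂ) • 1).PosDef := by
  have h : ((ε : ℂ) • (1 : Matrix n n ℂ)).PosDef :=
    Matrix.PosDef.one.smul (a := (ε : ℂ)) (by exact_mod_cast hε)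
  rw [add_comm]
  exact h.add_posSemidef hX

theorem cfc_add_smul_one {Y : Matrix n n ℂ} (hY : Y.IsHermitian) (f : ℝ → ℝ) (ε : ℝ) :
    cfc f (Y + (ε : ℂ) • 1) = cfc (fun x => f (x + ε)) Y := by
  obtain ⟨U, hU, e⟩ := exists_unitary_diag hY
  have h2 : U * Uᴴ = 1 := mem_unitaryGroup_iff.1 hU
  have : Y + (ε : ℂ) • 1 = U * rdiag (fun i => hY.eigenvalues i + ε) * Uᴴ := by
    have e' : rdiag (fun i => hY.eigenvalues i + ε) = rdiag hY.eigenvalues + (ε : ℂ) • 1 := by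
      rw [smul_one_eq_rdiag]; simp [rdiag, Matrix.diagonal_add]
    rw [e', Matrix.mul_add, Matrix.add_mul, ← e]
    simp [h2]
  rw [cfc_eq_of_unitary_diag _ hU this, cfc_eq_of_unitary_diag _ hU e]

theorem tendsto_cfc_of_pointwise {Y : Matrix n n ℂ} (hY : Y.PosSemidef) {ι : Type*} {l : Filter ι}
    {F : ι → ℝ → ℝ} {f : ℝ → ℝ} (h : ∀ x, 0 ≤ x → Tendsto (fun i => F i x) l (𝓝 (f x))) :
    Tendsto (fun i => cfc (F i) Y) l (𝓝 (cfc f Y)) := by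
  obtain ⟨U, hU, d, hd, e⟩ := hY.exists_unitary_diag
  simp only [cfc_eq_of_unitary_diag _ hU e]
  have h1 : Tendsto (fun i => rdiag fun j => F i (d j)) l (𝓝 (rdiag fun j => f (d j))) := by
    refine tendsto_pi_nhds.2 fun j => tendsto_pi_nhds.2 fun k => ?_
    simp only [rdiag, diagonal_apply]
    split_ifs
    · exact (Complex.continuous_ofReal.tendsto _).comp (h _ (hd j))
    · exact tendsto_const_nhds
  exact (tendsto_const_nhds.mul h1).mul tendsto_const_nhds

/-- The limit that defines the geometric mean of positive semidefinite matrices. -/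
theorem tendsto_geoMeanPos {X Y : Matrix n n ℂ} (hX : X.PosSemidef) (hY : Y.PosSemidef)
    (h : SuppLE X Y) {α : ℝ} (hα : 0 < α) :
    Tendsto (fun ε : ℝ => geoMeanPos (1 - α) (X + (ε : ℂ) • 1) (Y + (ε : ℂ) • 1)) (𝓝[>] 0)
      (𝓝 (perspective (fun x => x ^ α) X Y)) := by
  set T := isqr Y * X * isqr Y with hT
  have hTp : T.PosSemidef := isqr_conj_posSemidef hX Y
  -- H ε is (Y+ε)^{-1/2} Y^{1/2}, which tends to the support projection of Y, and Q ε is ε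
  -- (Y+ε)^{-1}, which tends to the kernel projection. Their combination `Tε` is (Y+ε)^{-1/2} (X+ε)
  -- (Y+ε)^{-1/2}, and it stays bounded because X ≪ Y.
  set H : ℝ → Matrix n n ℂ := fun ε => cfc (fun x => (√(x + ε))⁻¹ * √x) Y with hH
  set Q : ℝ → Matrix n n ℂ := fun ε => cfc (fun x => ε * ((√(x + ε))⁻¹ * (√(x + ε))⁻¹)) Y with hQ
  set Tε : ℝ → Matrix n n ℂ := fun ε => H ε * T * H ε + Q ε with hTε
  have h0 : Tendsto (fun ε : ℝ => ε) (𝓝[>] 0) (𝓝 0) := nhdsWithin_le_nhds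
  have hsqrt : ∀ x : ℝ, Tendsto (fun ε : ℝ => √(x + ε)) (𝓝[>] 0) (𝓝 (√x)) := by
    intro x
    have := (h0.const_add x).sqrt
    rwa [add_zero] at this
  have hHl : Tendsto H (𝓝[>] 0) (𝓝 (suppProj Y)) := by
    refine tendsto_cfc_of_pointwise hY fun x hx => ?_
    rcases hx.eq_or_lt with rfl | hx
    · simp
    · rw [if_neg hx.ne']
      have := ((hsqrt x).inv₀ (Real.sqrt_pos.2 hx).ne').mul_const (√x)
      rwa [inv_mul_cancel₀ (Real.sqrt_pos.2 hx).ne'] at this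
  set Q₀ := cfc (fun x : ℝ => if x = 0 then 1 else 0) Y with hQ₀
  have hQl : Tendsto Q (𝓝[>] 0) (𝓝 Q₀) := by
    refine tendsto_cfc_of_pointwise hY fun x hx => ?_
    rcases hx.eq_or_lt with rfl | hx
    · rw [if_pos rfl]
      refine tendsto_const_nhds.congr' ?_
      filter_upwards [self_mem_nhdsWithin] with ε hε
      rw [Set.mem_Ioi] at hε
      rw [zero_add, ← mul_inv, Real.mul_self_sqrt hε.le, mul_inv_cancel₀ hε.ne']
    · rw [if_neg hx.ne']
      have h1 := (hsqrt x).inv₀ (Real.sqrt_pos.2 hx).ne'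
      simpa using h0.mul (h1.mul h1)
  have hPT : suppProj Y * T = T := by
    rw [hT, Matrix.mul_assoc, ← Matrix.mul_assoc, suppProj_mul_isqr hY]
  have hTP : T * suppProj Y = T := by
    rw [hT, Matrix.mul_assoc, isqr_mul_suppProj hY]
  have hTl : Tendsto Tε (𝓝[>] 0) (𝓝 (T + Q₀)) := by
    have := ((hHl.mul (tendsto_const_nhds (x := T))).mul hHl).add hQl
    rwa [hPT, hTP] at this
  have hHh : ∀ ε, (H ε).IsHermitian := fun ε => cfc_isHermitian _ _
  have hTεh : ∀ ε, (Tε ε).IsHermitian := by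
    intro ε
    have := isHermitian_mul_mul_conjTranspose (H ε) hTp.1
    rw [(hHh ε).eq] at this
    exact this.add (cfc_isHermitian _ _)
  have hcfc := tendsto_cfc_of_tendsto (f := fun x : ℝ => x ^ α)
    (Real.continuous_rpow_const hα.le) (Eventually.of_forall hTεh)
    (hTp.1.add (cfc_isHermitian _ _)) hTl
  have hsq : Tendsto (fun ε : ℝ => sqr (Y + (ε : ℂ) • 1)) (𝓝[>] 0) (𝓝 (sqr Y)) := by
    simp only [sqr, cfc_add_smul_one hY.1]
    exact tendsto_cfc_of_pointwise hY fun x _ => hsqrt x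
  have hlim := (hsq.mul hcfc).mul hsq
  have hQP : Q₀ * suppProj Y = 0 := by
    rw [hQ₀, suppProj, cfc_mul_cfc]
    have : (fun x : ℝ => (if x = 0 then (1 : ℝ) else 0) * if x = 0 then 0 else 1) = fun _ => 0 := by
      ext x; split_ifs <;> simp
    rw [this, cfc_const_zero]
  -- The regularization leaves the kernel projection `Q₀` in the limit. It is orthogonal to the
  -- support of Y, so the outer square roots of Y remove it.
  have hfin : sqr Y * cfc (fun x : ℝ => x ^ α) (T + Q₀) * sqr Y =
      perspective (fun x => x ^ α) X Y := by
    have := cfc_intertwine (A := T + Q₀) (B := T) (C := suppProj Y)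
      (hTp.1.add (cfc_isHermitian _ _)) hTp.1 (by rw [Matrix.add_mul, hQP, hTP, hPT, add_zero])
      fun x => x ^ α
    calc _ = sqr Y * (cfc (fun x : ℝ => x ^ α) (T + Q₀) * suppProj Y) * sqr Y := by
          rw [Matrix.mul_assoc, Matrix.mul_assoc, Matrix.mul_assoc, suppProj_mul_sqr hY]
      _ = _ := by rw [this, ← Matrix.mul_assoc, sqr_mul_suppProj hY]; rfl
  rw [hfin] at hlim
  refine hlim.congr' ?_
  filter_upwards [self_mem_nhdsWithin] with ε hε
  rw [Set.mem_Ioi] at hε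
  rw [geoMeanPos_eq_perspective, perspective_rpow_swap (posDef_add_smul_one hX hε)
    (posDef_add_smul_one hY hε) hα.ne', perspective]
  congr 3
  have e1 : isqr (Y + (ε : ℂ) • 1) = cfc (fun x => (√(x + ε))⁻¹) Y := by
    rw [isqr, cfc_add_smul_one hY.1]
  have e2 : isqr (Y + (ε : ℂ) • 1) * sqr Y = H ε := by
    rw [e1, sqr, cfc_mul_cfc]
  have e3 : sqr Y * isqr (Y + (ε : ℂ) • 1) = H ε := by
    rw [e1, sqr, cfc_mul_cfc]; simp only [hH, mul_comm]
  have e4 : isqr (Y + (ε : ℂ) • 1) * ((ε : ℂ) • 1) * isqr (Y + (ε : ℂ) • 1) = Q ε := by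
    rw [Matrix.mul_smul, Matrix.smul_mul, Matrix.mul_one, e1, cfc_mul_cfc]
    simp only [hQ]
    rw [cfc_const_mul _ _ _ (continuousOn_spectrum_matrix _ _)]
    ext i j
    simp
  rw [Matrix.mul_add, Matrix.add_mul, e4]
  simp only [hTε]
  congr 1
  calc H ε * T * H ε = isqr (Y + (ε : ℂ) • 1) * sqr Y * T * (sqr Y * isqr (Y + (ε : ℂ) • 1)) := by
        rw [e2, e3]
    _ = isqr (Y + (ε : ℂ) • 1) * (sqr Y * T * sqr Y) * isqr (Y + (ε : ℂ) • 1) := by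
        simp only [Matrix.mul_assoc]
    _ = _ := by rw [hT, sqr_isqr_conj hX hY h]

theorem geoMean_eq_perspective {X Y : Matrix n n ℂ} (hX : X.PosSemidef) (hY : Y.PosSemidef)
    (h : SuppLE X Y) {α : ℝ} (hα : 0 < α) :
    geoMean (1 - α) X Y = perspective (fun x => x ^ α) X Y :=
  (tendsto_geoMeanPos hX hY h hα).limUnder_eq

end Identification

/-! ### Traces of perspectives -/

section Trace

variable {n m : Type*} [Fintype n] [DecidableEq n] [Fintype m] [DecidableEq m]

/-- The squared norm of a column. -/
noncomputable def colSq (W : Matrix n m ℂ) (i : m) : ℝ := ∑ k, Complex.normSq (W k i)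

theorem colSq_nonneg (W : Matrix n m ℂ) (i : m) : 0 ≤ colSq W i :=
  Finset.sum_nonneg fun _ _ => Complex.normSq_nonneg _

theorem trace_mul_rdiag (W : Matrix n m ℂ) (g : m → ℝ) :
    (W * rdiag g * Wᴴ).trace = ((∑ i, colSq W i * g i : ℝ) : ℂ) := by
  simp only [Matrix.trace, diag_apply, mul_apply (M := W * rdiag g)]
  simp only [rdiag, mul_diagonal, conjTranspose_apply, colSq]
  push_cast
  rw [Finset.sum_comm]
  refine Finset.sum_congr rfl fun i _ => ?_
  rw [Finset.sum_mul]
  refine Finset.sum_congr rfl fun k _ => ?_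
  rw [Complex.normSq_eq_conj_mul_self]
  simp only [RCLike.star_def]
  ring

theorem trace_mul_conjTranspose (W : Matrix n m ℂ) :
    (W * Wᴴ).trace = ((∑ i, colSq W i : ℝ) : ℂ) := by
  have := trace_mul_rdiag W fun _ => 1
  simpa [rdiag_one] using this

/-- Bernoulli's inequality, summed. -/
theorem one_le_sum_mul_rpow {q d : m → ℝ} (hq : ∀ i, 0 ≤ q i) (hd : ∀ i, 0 ≤ d i)
    (h1 : ∑ i, q i * d i = 1) (h2 : ∑ i, q i ≤ 1) {α : ℝ} (hα : 1 ≤ α) :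
    1 ≤ ∑ i, q i * d i ^ α := by
  have h : ∀ i, q i * (1 + α * (d i - 1)) ≤ q i * d i ^ α := fun i => by
    refine mul_le_mul_of_nonneg_left ?_ (hq i)
    have := one_add_mul_self_le_rpow_one_add (s := d i - 1) (by linarith [hd i]) hα
    simpa using this
  have h3 := Finset.sum_le_sum fun i (_ : i ∈ Finset.univ) => h i
  have h4 : ∑ i, q i * (1 + α * (d i - 1)) = ∑ i, q i + α * (∑ i, q i * d i - ∑ i, q i) := by
    rw [mul_sub, Finset.mul_sum, Finset.mul_sum, ← Finset.sum_sub_distrib, ← Finset.sum_add_distrib]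
    exact Finset.sum_congr rfl fun i _ => by ring
  rw [h4, h1] at h3
  nlinarith

/-- The bound log x ≤ x - 1 at x = 1/d gives d log d ≥ d - 1, and the weighted sum of the right side
is 1 - ∑ q ≥ 0. -/
theorem sum_mul_log_nonneg {q d : m → ℝ} (hq : ∀ i, 0 ≤ q i) (hd : ∀ i, 0 ≤ d i)
    (h1 : ∑ i, q i * d i = 1) (h2 : ∑ i, q i ≤ 1) :
    0 ≤ ∑ i, q i * (d i * Real.logb 2 (d i)) := by
  rw [sum_mul_logb_eq_div]
  refine div_nonneg ?_ (Real.log_nonneg (by norm_num))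
  have h : ∀ i, q i * d i - q i ≤ q i * (d i * Real.log (d i)) := fun i => by
    rw [← mul_sub_one]
    refine mul_le_mul_of_nonneg_left ?_ (hq i)
    rcases (hd i).eq_or_lt with h | h
    · rw [← h]; simp
    · have h3 := Real.log_le_sub_one_of_pos (inv_pos.2 h)
      rw [Real.log_inv] at h3
      have h4 := mul_le_mul_of_nonneg_left h3 h.le
      rw [mul_sub, mul_inv_cancel₀ h.ne'] at h4
      linarith
  have h3 := Finset.sum_le_sum fun i (_ : i ∈ Finset.univ) => h i
  rw [Finset.sum_sub_distrib, h1] at h3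
  linarith

/-- Concavity of log for the probability weights q_i d_i, applied to the numbers d_i^{α-1} with mean
S; the proof uses the tangent to log at S. -/
theorem sum_mul_logb_le_logb_sum {q d : m → ℝ} (hq : ∀ i, 0 ≤ q i) (hd : ∀ i, 0 ≤ d i)
    (h1 : ∑ i, q i * d i = 1) {α : ℝ} (hα : 1 < α) (hS : 0 < ∑ i, q i * d i ^ α) :
    ∑ i, q i * (d i * Real.logb 2 (d i)) ≤ 1 / (α - 1) * Real.logb 2 (∑ i, q i * d i ^ α) := by
  set S := ∑ i, q i * d i ^ α with hSdef
  have h0 : 0 < α - 1 := by linarith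
  have hl : 0 < Real.log 2 := Real.log_pos (by norm_num)
  have h : ∀ i, q i * (d i * Real.log (d i)) * (α - 1) - q i * d i * Real.log S ≤
      q i * d i ^ α / S - q i * d i := fun i => by
    rcases (hd i).eq_or_lt with h | h
    · rw [← h, Real.zero_rpow (by linarith)]; simp
    · have h3 := Real.log_le_sub_one_of_pos (div_pos (Real.rpow_pos_of_pos h (α - 1)) hS)
      rw [Real.log_div (Real.rpow_pos_of_pos h _).ne' hS.ne', Real.log_rpow h] at h3
      have h4 := mul_le_mul_of_nonneg_left h3 (mul_nonneg (hq i) h.le)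
      have h5 : d i ^ α = d i * d i ^ (α - 1) := by
        rw [mul_comm, ← Real.rpow_add_one h.ne', sub_add_cancel]
      rw [h5]
      calc _ = q i * d i * ((α - 1) * Real.log (d i) - Real.log S) := by ring
        _ ≤ _ := h4
        _ = _ := by ring
  have h3 := Finset.sum_le_sum fun i (_ : i ∈ Finset.univ) => h i
  rw [Finset.sum_sub_distrib, Finset.sum_sub_distrib, ← Finset.sum_mul, ← Finset.sum_mul, h1,
    ← Finset.sum_div, ← hSdef, div_self hS.ne'] at h3
  rw [sum_mul_logb_eq_div, Real.logb, one_div_mul_eq_div, div_div, div_le_div_iff₀ hl (by positivity)]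
  nlinarith

end Trace

/-! ### Trace functionals of a pair of states as classical sums. -/

section StatePair

variable {n : Type*} [Fintype n] [DecidableEq n]

/-- A pair of a state and a sub-normalized state is classical up to a congruence. -/
theorem exists_classical {ρ σ : Matrix n n ℂ} (hρ : IsState ρ) (hσ : IsSubState σ)
    (h : SuppLE ρ σ) :
    ∃ (W : Matrix n n ℂ) (d : n → ℝ), (∀ i, 0 ≤ d i) ∧ σ = W * Wᴴ ∧ ρ = W * rdiag d * Wᴴ ∧
      (∀ f, (perspective f ρ σ).trace.re = ∑ i, colSq W i * f (d i)) ∧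
      (∑ i, colSq W i * d i = 1) ∧ (∑ i, colSq W i ≤ 1) ∧
      ∀ t : ℝ, 0 < t → ((t : ℂ) • σ - ρ).PosSemidef → ∀ i, d i ≤ t := by
  obtain ⟨W, d, hd, h1, h2, h3, h4⟩ := exists_congr_diag hρ.1 hσ.1 h
  refine ⟨W, d, hd, h1, h2, fun f => ?_, ?_, ?_, h4⟩
  · rw [h3, trace_mul_rdiag, Complex.ofReal_re]
  · have := hρ.2
    rw [h2, trace_mul_rdiag] at this
    exact_mod_cast this
  · have := hσ.2
    rwa [h1, trace_mul_conjTranspose, Complex.ofReal_re] at this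

/-- Besides giving nonnegativity of the divergence, this keeps the arguments of the logarithms below
at least 1, away from the default values of `Real.logb`. -/
theorem one_le_trace_perspective {ρ σ : Matrix n n ℂ} (hρ : IsState ρ) (hσ : IsSubState σ)
    (h : SuppLE ρ σ) {α : ℝ} (hα : 1 ≤ α) :
    1 ≤ (perspective (fun x => x ^ α) ρ σ).trace.re := by
  obtain ⟨W, d, hd, -, -, h3, h4, h5, -⟩ := exists_classical hρ hσ h
  rw [h3]
  exact one_le_sum_mul_rpow (colSq_nonneg W) hd h4 h5 hα

theorem trace_perspective_log_nonneg {ρ σ : Matrix n n ℂ} (hρ : IsState ρ) (hσ : IsSubState σ)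
    (h : SuppLE ρ σ) :
    0 ≤ (perspective (fun x => x * Real.logb 2 x) ρ σ).trace.re := by
  obtain ⟨W, d, hd, -, -, h3, h4, h5, -⟩ := exists_classical hρ hσ h
  rw [h3]
  exact sum_mul_log_nonneg (colSq_nonneg W) hd h4 h5

theorem trace_perspective_log_le {ρ σ : Matrix n n ℂ} (hρ : IsState ρ) (hσ : IsSubState σ)
    (h : SuppLE ρ σ) {α : ℝ} (hα : 1 < α) :
    (perspective (fun x => x * Real.logb 2 x) ρ σ).trace.re ≤
      1 / (α - 1) * Real.logb 2 (perspective (fun x => x ^ α) ρ σ).trace.re := by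
  have h0 := one_le_trace_perspective hρ hσ h hα.le
  obtain ⟨W, d, hd, -, -, h3, h4, h5, -⟩ := exists_classical hρ hσ h
  rw [h3] at h0 ⊢
  rw [h3]
  exact sum_mul_logb_le_logb_sum (colSq_nonneg W) hd h4 hα (by linarith)

/-- Since ρ ≤ tσ bounds every d_i by t, each d_i^α is at most d_i t^{α-1}, and the weights q_i d_i
sum to 1. -/
theorem logb_trace_perspective_le {ρ σ : Matrix n n ℂ} (hρ : IsState ρ) (hσ : IsSubState σ)
    (h : SuppLE ρ σ) {α : ℝ} (hα : 1 < α) {t : ℝ} (ht : 0 < t)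
    (hle : ((t : ℂ) • σ - ρ).PosSemidef) :
    1 / (α - 1) * Real.logb 2 (perspective (fun x => x ^ α) ρ σ).trace.re ≤ Real.logb 2 t := by
  have h0 := one_le_trace_perspective hρ hσ h hα.le
  obtain ⟨W, d, hd, -, -, h3, h4, h5, h6⟩ := exists_classical hρ hσ h
  have hα' : 0 < α - 1 := by linarith
  rw [h3] at h0 ⊢
  have h7 : ∑ i, colSq W i * d i ^ α ≤ t ^ (α - 1) := by
    have : ∀ i, colSq W i * d i ^ α ≤ colSq W i * d i * t ^ (α - 1) := fun i => by
      rw [mul_assoc]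
      refine mul_le_mul_of_nonneg_left ?_ (colSq_nonneg W i)
      rcases (hd i).eq_or_lt with h | h
      · rw [← h, Real.zero_rpow (by linarith)]; simp
      · have h5 : d i ^ α = d i * d i ^ (α - 1) := by
          rw [mul_comm, ← Real.rpow_add_one h.ne', sub_add_cancel]
        rw [h5]
        exact mul_le_mul_of_nonneg_left (Real.rpow_le_rpow h.le (h6 t ht hle i) hα'.le) h.le
    calc _ ≤ ∑ i, colSq W i * d i * t ^ (α - 1) := Finset.sum_le_sum fun i _ => this i
      _ = _ := by rw [← Finset.sum_mul, h4, one_mul]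
  have h8 := Real.logb_le_logb_of_le (b := 2) (by norm_num) (by linarith) h7
  rw [Real.logb_rpow_eq_mul_logb_of_pos ht] at h8
  rw [one_div_mul_eq_div, div_le_iff₀ hα']
  linarith

end StatePair

/-! ### The Umegaki relative entropy -/

section Umegaki

/-- The integral of x / (1 + τx) over 0 ≤ τ ≤ 1/ε is log(ε + x) - log ε, and the log ε terms cancel
because the total weights agree. Integration is carried out as monotonicity of the antiderivative.
-/
theorem sum_mul_log_add_le {ι κ : Type*} [Fintype ι] [Fintype κ] {c x : ι → ℝ} {d y : κ → ℝ}
    (hx : ∀ i, 0 ≤ x i) (hy : ∀ i, 0 ≤ y i) (hcd : ∑ i, c i = ∑ j, d j)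
    (h : ∀ τ : ℝ, 0 < τ → ∑ i, c i * (x i / (1 + τ * x i)) ≤ ∑ j, d j * (y j / (1 + τ * y j)))
    {ε : ℝ} (hε : 0 < ε) :
    ∑ i, c i * Real.log (ε + x i) ≤ ∑ j, d j * Real.log (ε + y j) := by
  have hd1 : ∀ z : ℝ, 0 ≤ z → ∀ τ : ℝ, 0 ≤ τ →
      HasDerivAt (fun τ : ℝ => Real.log (1 + τ * z)) (z / (1 + τ * z)) τ := by
    intro z hz τ hτ
    have h1 : HasDerivAt (fun τ : ℝ => 1 + τ * z) z τ := by
      simpa using ((hasDerivAt_id τ).mul_const z).const_add 1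
    exact h1.log (by positivity)
  set g : ℝ → ℝ := fun τ => ∑ j, d j * Real.log (1 + τ * y j) - ∑ i, c i * Real.log (1 + τ * x i)
    with hg
  have hder : ∀ τ : ℝ, 0 ≤ τ → HasDerivAt g (∑ j, d j * (y j / (1 + τ * y j)) -
      ∑ i, c i * (x i / (1 + τ * x i))) τ := fun τ hτ =>
    (HasDerivAt.fun_sum fun j _ => (hd1 _ (hy j) τ hτ).const_mul _).sub
      (HasDerivAt.fun_sum fun j _ => (hd1 _ (hx j) τ hτ).const_mul _)
  have hmono : MonotoneOn g (Set.Ici 0) := by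
    refine monotoneOn_of_deriv_nonneg (convex_Ici 0)
      (fun τ hτ => (hder τ hτ).continuousAt.continuousWithinAt) ?_ ?_
    · intro τ hτ
      rw [interior_Ici] at hτ
      exact (hder τ (le_of_lt hτ)).differentiableAt.differentiableWithinAt
    · intro τ hτ
      rw [interior_Ici] at hτ
      rw [(hder τ (le_of_lt hτ)).deriv]
      exact sub_nonneg.2 (h τ hτ)
  have h0 : g 0 = 0 := by simp [hg]
  have h1 := hmono (Set.mem_Ici.2 le_rfl) (Set.mem_Ici.2 (inv_nonneg.2 hε.le)) (inv_nonneg.2 hε.le)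
  rw [h0] at h1
  have h2 : ∀ z : ℝ, 0 ≤ z → Real.log (1 + ε⁻¹ * z) = Real.log (ε + z) - Real.log ε := by
    intro z hz
    rw [← Real.log_div (by positivity) hε.ne']
    congr 1; field_simp
  simp only [hg, h2 _ (hx _), h2 _ (hy _), mul_sub, Finset.sum_sub_distrib, ← Finset.sum_mul,
    hcd] at h1
  linarith

/-- Comparison of logarithmic sums through the resolvent functions `x / (1 + τ x)`. -/
theorem sum_mul_log_le_of_resolvent {ι κ : Type*} [Fintype ι] [Fintype κ] {c x : ι → ℝ}
    {d y : κ → ℝ} (hx : ∀ i, 0 ≤ x i) (hy : ∀ i, 0 ≤ y i) (hcx : ∀ i, c i ≠ 0 → x i ≠ 0)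
    (hdy : ∀ j, d j ≠ 0 → y j ≠ 0) (hcd : ∑ i, c i = ∑ j, d j)
    (h : ∀ τ : ℝ, 0 < τ → ∑ i, c i * (x i / (1 + τ * x i)) ≤ ∑ j, d j * (y j / (1 + τ * y j))) :
    ∑ i, c i * Real.log (x i) ≤ ∑ j, d j * Real.log (y j) := by
  have h0 : Tendsto (fun ε : ℝ => ε) (𝓝[>] 0) (𝓝 0) := nhdsWithin_le_nhds
  -- Letting ε tend to 0 is harmless where log is continuous; terms with argument 0 must carry
  -- weight 0.
  have hl : ∀ a b : ℝ, (a ≠ 0 → b ≠ 0) →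
      Tendsto (fun ε : ℝ => a * Real.log (ε + b)) (𝓝[>] 0) (𝓝 (a * Real.log b)) := by
    intro a b hab
    rcases eq_or_ne a 0 with rfl | ha
    · simp
    · have h1 := h0.add_const b
      rw [zero_add] at h1
      exact (h1.log (hab ha)).const_mul a
  refine le_of_tendsto_of_tendsto (tendsto_finsetSum _ fun i _ => hl _ _ (hcx i))
    (tendsto_finsetSum _ fun i _ => hl _ _ (hdy i)) ?_
  filter_upwards [self_mem_nhdsWithin] with ε hε
  exact sum_mul_log_add_le hx hy hcd h hε

variable {n : Type*} [Fintype n] [DecidableEq n]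

theorem norm_sum_star_mul_sq_le (a b : n → ℂ) :
    ‖∑ k, star (a k) * b k‖ ^ 2 ≤
      (∑ k, Complex.normSq (a k)) * ∑ k, Complex.normSq (b k) := by
  have h1 : ‖∑ k, star (a k) * b k‖ ≤ ∑ k, ‖a k‖ * ‖b k‖ := by
    refine (norm_sum_le _ _).trans (le_of_eq ?_)
    simp
  calc _ ≤ (∑ k, ‖a k‖ * ‖b k‖) ^ 2 := by gcongr
    _ ≤ _ := Finset.sum_mul_sq_le_sq_mul_sq _ _ _
    _ = _ := by simp only [Complex.normSq_eq_norm_sq]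

/-- Both u and v are at least c²/q, which leaves a concave quadratic in c whose maximum is q d² / (1
+ τd), by completing the square. -/
theorem resolvent_term_le {q d c u v τ : ℝ} (hq : 0 ≤ q) (hd : 0 ≤ d) (hτ : 0 < τ) (hu : 0 ≤ u)
    (hv : 0 ≤ v) (hcu : c ^ 2 ≤ q * u) (hcv : c ^ 2 ≤ q * v) :
    2 * (d * c) - u - τ * (v * d) ≤ q * d * (d / (1 + τ * d)) := by
  have hp : 0 < 1 + τ * d := by positivity
  rcases hq.eq_or_lt with rfl | hq
  · have : c = 0 := by nlinarith
    subst this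
    have : 0 ≤ τ * (v * d) := by positivity
    simp; linarith
  · have hr : q * d * (d / (1 + τ * d)) = q * d ^ 2 / (1 + τ * d) := by ring
    rw [hr, le_div_iff₀ hp]
    have h1 : c ^ 2 / q ≤ u := by rw [div_le_iff₀ hq]; linarith
    have h2 : c ^ 2 / q ≤ v := by rw [div_le_iff₀ hq]; linarith
    have h3 : 2 * (d * c) - u - τ * (v * d) ≤ 2 * (d * c) - (1 + τ * d) * (c ^ 2 / q) := by
      have := mul_le_mul_of_nonneg_left h2 (mul_nonneg hτ.le hd)
      linarith
    refine (mul_le_mul_of_nonneg_right h3 hp.le).trans ?_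
    have h4 : 0 ≤ (q * d - (1 + τ * d) * c) ^ 2 / q := by positivity
    have h5 : (q * d - (1 + τ * d) * c) ^ 2 / q = q * d ^ 2 -
        (2 * (d * c) - (1 + τ * d) * (c ^ 2 / q)) * (1 + τ * d) := by
      field_simp; ring
    linarith

/-- Column by column in W, Cauchy–Schwarz bounds the diagonal entry of WᴴZᴴW by the norms of the
columns of ZW and of ZᴴW. Every trial operator Z thus gives a lower bound on the Belavkin–Staszewski
resolvent sum. -/
theorem resolvent_variational (W Z : Matrix n n ℂ) {d : n → ℝ} (hd : ∀ i, 0 ≤ d i) {τ : ℝ}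
    (hτ : 0 < τ) :
    2 * (Zᴴ * (W * rdiag d * Wᴴ)).trace.re - (Z * (W * Wᴴ) * Zᴴ).trace.re -
      τ * (Zᴴ * (W * rdiag d * Wᴴ) * Z).trace.re ≤
    ∑ i, colSq W i * d i * (d i / (1 + τ * d i)) := by
  have h1 : Z * (W * Wᴴ) * Zᴴ = (Z * W) * (Z * W)ᴴ := by
    rw [conjTranspose_mul]; simp only [Matrix.mul_assoc]
  have h2 : Zᴴ * (W * rdiag d * Wᴴ) * Z = (Zᴴ * W) * rdiag d * (Zᴴ * W)ᴴ := by
    rw [conjTranspose_mul, conjTranspose_conjTranspose]; simp only [Matrix.mul_assoc]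
  have h3 : (Zᴴ * (W * rdiag d * Wᴴ)).trace = ∑ i, (Wᴴ * (Zᴴ * W)) i i * (d i : ℂ) := by
    have : Zᴴ * (W * rdiag d * Wᴴ) = ((Zᴴ * W) * rdiag d) * Wᴴ := by simp only [Matrix.mul_assoc]
    rw [this, trace_mul_comm, ← Matrix.mul_assoc]
    simp [Matrix.trace, rdiag]
  rw [h1, h2, h3, trace_mul_conjTranspose, trace_mul_rdiag, Complex.ofReal_re, Complex.ofReal_re,
    Complex.re_sum, Finset.mul_sum, Finset.mul_sum, ← Finset.sum_sub_distrib,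
    ← Finset.sum_sub_distrib]
  refine Finset.sum_le_sum fun i _ => ?_
  rw [Complex.re_mul_ofReal, mul_comm _ (d i)]
  have hc : ∀ z : ℂ, z.re ^ 2 ≤ ‖z‖ ^ 2 := fun z => by
    rw [← sq_abs]; gcongr; exact Complex.abs_re_le_norm z
  refine resolvent_term_le (colSq_nonneg W i) (hd i) hτ (colSq_nonneg _ i) (colSq_nonneg _ i) ?_ ?_
  · refine (hc _).trans ?_
    have : (Wᴴ * (Zᴴ * W)) i i = ∑ k, star ((Z * W) k i) * W k i := by
      rw [← Matrix.mul_assoc, ← conjTranspose_mul, Matrix.mul_apply]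
      rfl
    rw [this, mul_comm]
    exact norm_sum_star_mul_sq_le (fun k => (Z * W) k i) fun k => W k i
  · refine (hc _).trans ?_
    exact norm_sum_star_mul_sq_le (fun k => W k i) fun k => (Zᴴ * W) k i

theorem trace_mul_rdiag_mul_rdiag (M : Matrix n n ℂ) (r s : n → ℝ) :
    (rdiag r * M * rdiag s * Mᴴ).trace =
      ((∑ p : n × n, Complex.normSq (M p.1 p.2) * r p.1 * s p.2 : ℝ) : ℂ) := by
  rw [Fintype.sum_prod_type]
  simp only [Matrix.trace, diag_apply, mul_apply (M := rdiag r * M * rdiag s)]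
  simp only [rdiag, mul_diagonal, diagonal_mul, conjTranspose_apply]
  push_cast
  refine Finset.sum_congr rfl fun a _ => Finset.sum_congr rfl fun b _ => ?_
  rw [Complex.normSq_eq_conj_mul_self]
  simp only [RCLike.star_def]
  ring

/-- In the eigenbases of ρ and σ the variational functional decouples into entries and is stationary
at z_{ab} = r_a / (s_b + τ r_a) M_{ab}. There its quadratic part is half of its linear part, so its
value is exactly the left side. Where the denominator vanishes, division by zero sets z_{ab} = 0. -/
theorem umegaki_resolvent_le {W U V : Matrix n n ℂ} {d r s : n → ℝ} (hd : ∀ i, 0 ≤ d i)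
    (hU : U ∈ unitaryGroup n ℂ) (hV : V ∈ unitaryGroup n ℂ) (hρ : W * rdiag d * Wᴴ = U * rdiag r * Uᴴ)
    (hσ : W * Wᴴ = V * rdiag s * Vᴴ) {τ : ℝ} (hτ : 0 < τ) :
    ∑ p : n × n, Complex.normSq ((Uᴴ * V) p.1 p.2) * r p.1 * (r p.1 / (s p.2 + τ * r p.1)) ≤
    ∑ i, colSq W i * d i * (d i / (1 + τ * d i)) := by
  have hU1 : Uᴴ * U = 1 := mem_unitaryGroup_iff'.1 hU
  have hV1 : Vᴴ * V = 1 := mem_unitaryGroup_iff'.1 hV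
  set M := Uᴴ * V with hM
  set z : Matrix n n ℂ := Matrix.of fun a b => ((r a / (s b + τ * r a) : ℝ) : ℂ) * M a b with hz
  have key := resolvent_variational W (U * z * Vᴴ) hd hτ
  rw [hρ, hσ] at key
  have hZ : (U * z * Vᴴ)ᴴ = V * zᴴ * Uᴴ := by
    simp only [conjTranspose_mul, conjTranspose_conjTranspose, Matrix.mul_assoc]
  have e1 : ((U * z * Vᴴ)ᴴ * (U * rdiag r * Uᴴ)).trace = (zᴴ * (rdiag r * M)).trace := by
    rw [hZ]
    have : V * zᴴ * Uᴴ * (U * rdiag r * Uᴴ) = V * (zᴴ * ((Uᴴ * U) * rdiag r) * Uᴴ) := by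
      simp only [Matrix.mul_assoc]
    rw [this, trace_mul_comm, hU1, Matrix.one_mul, hM]
    simp only [Matrix.mul_assoc]
  have e2 : (U * z * Vᴴ * (V * rdiag s * Vᴴ) * (U * z * Vᴴ)ᴴ).trace =
      (z * rdiag s * zᴴ).trace := by
    rw [hZ]
    have : U * z * Vᴴ * (V * rdiag s * Vᴴ) * (V * zᴴ * Uᴴ) =
        U * (z * (Vᴴ * V) * rdiag s * (Vᴴ * V) * zᴴ * Uᴴ) := by
      simp only [Matrix.mul_assoc]
    rw [this, trace_mul_comm, hV1, Matrix.mul_one, Matrix.mul_one, Matrix.mul_assoc, hU1,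
      Matrix.mul_one]
  have e3 : ((U * z * Vᴴ)ᴴ * (U * rdiag r * Uᴴ) * (U * z * Vᴴ)).trace =
      (zᴴ * rdiag r * z).trace := by
    rw [hZ]
    have : V * zᴴ * Uᴴ * (U * rdiag r * Uᴴ) * (U * z * Vᴴ) =
        V * (zᴴ * (Uᴴ * U) * rdiag r * (Uᴴ * U) * z * Vᴴ) := by
      simp only [Matrix.mul_assoc]
    rw [this, trace_mul_comm, hU1, Matrix.mul_one, Matrix.mul_one, Matrix.mul_assoc, hV1,
      Matrix.mul_one]
  have f1 : (zᴴ * (rdiag r * M)).trace.re =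
      ∑ p : n × n, Complex.normSq (M p.1 p.2) * r p.1 * (r p.1 / (s p.2 + τ * r p.1)) := by
    have : (zᴴ * (rdiag r * M)).trace = ((∑ p : n × n, Complex.normSq (M p.1 p.2) * r p.1 *
        (r p.1 / (s p.2 + τ * r p.1)) : ℝ) : ℂ) := by
      rw [Fintype.sum_prod_type_right]
      simp only [Matrix.trace, diag_apply, mul_apply (M := zᴴ)]
      simp only [rdiag, diagonal_mul, conjTranspose_apply, hz, of_apply]
      push_cast
      refine Finset.sum_congr rfl fun a _ => Finset.sum_congr rfl fun b _ => ?_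
      rw [Complex.normSq_eq_conj_mul_self]
      simp only [RCLike.star_def, map_mul, Complex.conj_ofReal, map_div₀, map_add]
      ring
    rw [this, Complex.ofReal_re]
  have f2 : (z * rdiag s * zᴴ).trace.re + τ * (zᴴ * rdiag r * z).trace.re =
      ∑ p : n × n, Complex.normSq (M p.1 p.2) * r p.1 * (r p.1 / (s p.2 + τ * r p.1)) := by
    have g1 : (z * rdiag s * zᴴ).trace.re = ∑ p : n × n, Complex.normSq (z p.1 p.2) * s p.2 := by
      rw [trace_mul_rdiag, Complex.ofReal_re, Fintype.sum_prod_type_right]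
      simp only [colSq, Finset.sum_mul]
    have g2 : (zᴴ * rdiag r * z).trace.re = ∑ p : n × n, Complex.normSq (z p.1 p.2) * r p.1 := by
      have := trace_mul_rdiag zᴴ r
      rw [conjTranspose_conjTranspose] at this
      rw [this, Complex.ofReal_re, Fintype.sum_prod_type]
      simp only [colSq, Finset.sum_mul, conjTranspose_apply, RCLike.star_def, Complex.normSq_conj]
    rw [g1, g2, Finset.mul_sum, ← Finset.sum_add_distrib]
    refine Finset.sum_congr rfl fun p _ => ?_
    simp only [hz, of_apply, Complex.normSq_mul, Complex.normSq_ofReal]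
    rcases eq_or_ne (s p.2 + τ * r p.1) 0 with h | h
    · simp [h]
    · field_simp
  rw [e1, e2, e3, f1] at key
  linarith

/-- With M the overlap matrix of the eigenbases, the Umegaki entropy is the classical expression
with weights |M_{ab}|² r_a and likelihood ratios r_a / s_b, the Nussbaum–Szkoła pair. Resolvent
comparison with the weights q_i d_i and ratios d_i then transfers to the logarithm. -/
theorem umegaki_le_trace_perspective_log {ρ σ : Matrix n n ℂ} (hρ : IsState ρ)
    (hσ : IsSubState σ) (h : SuppLE ρ σ) :
    (ρ * (cfc (Real.logb 2) ρ - cfc (Real.logb 2) σ)).trace.re ≤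
      (perspective (fun x => x * Real.logb 2 x) ρ σ).trace.re := by
  obtain ⟨W, d, hd, h1, h2, h3, h4, -, -⟩ := exists_classical hρ hσ h
  obtain ⟨U, hU, r, hr, hUr⟩ := hρ.1.exists_unitary_diag
  obtain ⟨V, hV, s, hs, hVs⟩ := hσ.1.exists_unitary_diag
  have hU1 : Uᴴ * U = 1 := mem_unitaryGroup_iff'.1 hU
  have hV1 : Vᴴ * V = 1 := mem_unitaryGroup_iff'.1 hV
  have hV2 : V * Vᴴ = 1 := mem_unitaryGroup_iff.1 hV
  set M := Uᴴ * V with hM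
  have hMM : M * Mᴴ = 1 := by
    rw [hM, conjTranspose_mul, conjTranspose_conjTranspose]
    calc Uᴴ * V * (Vᴴ * U) = Uᴴ * (V * Vᴴ) * U := by simp only [Matrix.mul_assoc]
      _ = 1 := by rw [hV2, Matrix.mul_one, hU1]
  -- Support inclusion kills the overlaps for which the ratio r_a / s_b would be infinite.
  have hsupp : ∀ a b, r a ≠ 0 → s b = 0 → M a b = 0 := by
    intro a b ha hb
    have e1 : rdiag r * M * rdiag (fun b => if s b = 0 then 0 else 1) = rdiag r * M := by
      have e2 := h.mul_suppProj hρ.1.1 hσ.1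
      rw [suppProj, cfc_eq_of_unitary_diag _ hV hVs, hUr] at e2
      have e3 := congrArg (fun T => Uᴴ * T * V) e2
      calc _ = Uᴴ * (U * rdiag r * Uᴴ * (V * (rdiag fun i => if s i = 0 then 0 else 1) * Vᴴ)) * V := by
            rw [hM]
            calc _ = (Uᴴ * U) * rdiag r * (Uᴴ * V) * (rdiag fun i => if s i = 0 then 0 else 1) *
                (Vᴴ * V) := by rw [hU1, hV1, Matrix.one_mul, Matrix.mul_one]
              _ = _ := by simp only [Matrix.mul_assoc]
        _ = _ := e3
        _ = (Uᴴ * U) * rdiag r * (Uᴴ * V) := by simp only [Matrix.mul_assoc]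
        _ = _ := by rw [hU1, Matrix.one_mul]
    have e2 := congrFun (congrFun e1 a) b
    simp only [rdiag, mul_diagonal, diagonal_mul, hb, if_true, Complex.ofReal_zero, mul_zero] at e2
    exact (mul_eq_zero.1 e2.symm).resolve_left (by exact_mod_cast ha)
  have hD : (ρ * (cfc (Real.logb 2) ρ - cfc (Real.logb 2) σ)).trace.re =
      (∑ p : n × n, Complex.normSq (M p.1 p.2) * r p.1 * Real.log (r p.1 / s p.2)) /
        Real.log 2 := by
    have g1 : (ρ * cfc (Real.logb 2) ρ).trace =
        ((∑ p : n × n, Complex.normSq (M p.1 p.2) * (r p.1 * Real.logb 2 (r p.1)) * 1 : ℝ) : ℂ) := by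
      refine Eq.trans ?_ (trace_mul_rdiag_mul_rdiag M (fun a => r a * Real.logb 2 (r a)) fun _ => 1)
      rw [rdiag_one, Matrix.mul_one, Matrix.mul_assoc, hMM, Matrix.mul_one, cfc_eq_of_unitary_diag _ hU hUr, hUr]
      have : U * rdiag r * Uᴴ * (U * (rdiag fun i => Real.logb 2 (r i)) * Uᴴ) =
          U * (rdiag r * (Uᴴ * U) * (rdiag fun i => Real.logb 2 (r i)) * Uᴴ) := by
        simp only [Matrix.mul_assoc]
      rw [this, trace_mul_comm, hU1, Matrix.mul_one, Matrix.mul_assoc, hU1, Matrix.mul_one, rdiag_mul]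
    have g2 : (ρ * cfc (Real.logb 2) σ).trace =
        ((∑ p : n × n, Complex.normSq (M p.1 p.2) * r p.1 * Real.logb 2 (s p.2) : ℝ) : ℂ) := by
      refine Eq.trans ?_ (trace_mul_rdiag_mul_rdiag M r fun b => Real.logb 2 (s b))
      rw [cfc_eq_of_unitary_diag _ hV hVs, hUr]
      have : U * rdiag r * Uᴴ * (V * (rdiag fun i => Real.logb 2 (s i)) * Vᴴ) =
          U * (rdiag r * (Uᴴ * V) * (rdiag fun i => Real.logb 2 (s i)) * Vᴴ) := by
        simp only [Matrix.mul_assoc]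
      rw [this, trace_mul_comm, hM, conjTranspose_mul, conjTranspose_conjTranspose]
      simp only [Matrix.mul_assoc]
    rw [Matrix.mul_sub, trace_sub, g1, g2, Complex.sub_re, Complex.ofReal_re, Complex.ofReal_re,
      ← Finset.sum_sub_distrib, Finset.sum_div]
    refine Finset.sum_congr rfl fun p _ => ?_
    rcases eq_or_ne (r p.1) 0 with h0 | h0
    · simp [h0]
    rcases eq_or_ne (s p.2) 0 with h5 | h5
    · simp [hsupp _ _ h0 h5]
    rw [Real.log_div h0 h5, Real.logb, Real.logb]
    ring
  have hB : (perspective (fun x => x * Real.logb 2 x) ρ σ).trace.re =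
      (∑ i, colSq W i * d i * Real.log (d i)) / Real.log 2 := by
    rw [h3, sum_mul_logb_eq_div]
    simp only [mul_assoc]
  rw [hD, hB]
  refine div_le_div_of_nonneg_right ?_ (Real.log_nonneg (by norm_num))
  refine sum_mul_log_le_of_resolvent (fun p => div_nonneg (hr _) (hs _)) hd ?_ ?_ ?_ ?_
  · intro p hp
    have h0 : r p.1 ≠ 0 := right_ne_zero_of_mul hp
    refine div_ne_zero h0 fun h5 => hp ?_
    simp [hsupp _ _ h0 h5]
  · intro i hi
    exact right_ne_zero_of_mul hi
  · rw [h4]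
    have := hρ.1.1
    have e : ρ.trace = ((∑ p : n × n, Complex.normSq (M p.1 p.2) * r p.1 * 1 : ℝ) : ℂ) := by
      refine Eq.trans ?_ (trace_mul_rdiag_mul_rdiag M r fun _ => 1)
      rw [rdiag_one, Matrix.mul_one, Matrix.mul_assoc, hMM, Matrix.mul_one, hUr, trace_mul_comm, ← Matrix.mul_assoc, hU1, Matrix.one_mul]
    rw [hρ.2] at e
    simp only [mul_one] at e
    exact_mod_cast e.symm
  · intro τ hτ
    refine le_trans (le_of_eq ?_) (umegaki_resolvent_le hd hU hV (h2.symm.trans hUr)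
      (h1.symm.trans hVs) hτ)
    refine Finset.sum_congr rfl fun p _ => ?_
    rcases eq_or_ne (r p.1) 0 with h0 | h0
    · simp [h0]
    rcases eq_or_ne (s p.2) 0 with h5 | h5
    · rw [← hM, hsupp _ _ h0 h5]; simp
    rw [← hM]
    congr 1
    have : 0 < s p.2 := lt_of_le_of_ne (hs _) (Ne.symm h5)
    have h6 := hr p.1
    have h7 : s p.2 + τ * r p.1 ≠ 0 := by positivity
    field_simp

end Umegaki

/-! ### The comparison chain for divergences of states. -/

section Comparison

variable {n : Type*} [Fintype n] [DecidableEq n]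

theorem geoRenyi_of_suppLE {ρ σ : Matrix n n ℂ} (hρ : ρ.PosSemidef) (hσ : σ.PosSemidef)
    (h : SuppLE ρ σ) {α : ℝ} (hα : 0 < α) :
    geoRenyi α ρ σ =
      ((1 / (α - 1) * Real.logb 2 (perspective (fun x => x ^ α) ρ σ).trace.re : ℝ) : EReal) := by
  rw [geoRenyi, if_pos h, geoMean_eq_perspective hρ hσ h hα]

theorem geoRenyi_of_not_suppLE {ρ σ : Matrix n n ℂ} (h : ¬ SuppLE ρ σ) (α : ℝ) :
    geoRenyi α ρ σ = ⊤ := if_neg h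

theorem bsDiv_of_suppLE {ρ σ : Matrix n n ℂ} (hρ : ρ.PosSemidef) (hσ : σ.PosSemidef)
    (h : SuppLE ρ σ) :
    bsDiv ρ σ = ((perspective (fun x => x * Real.logb 2 x) ρ σ).trace.re : EReal) := by
  have e : (ρ * bsLog ρ σ).trace = (bsOp ρ σ).trace := by
    have : bsOp ρ σ = sqr ρ * bsLog ρ σ * sqr ρ := rfl
    rw [this, trace_mul_comm (sqr ρ * _), ← Matrix.mul_assoc, sqr_mul_sqr hρ]
  rw [bsDiv, if_pos h, ← bsOp_eq_perspective hρ hσ h, e]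

theorem umegaki_le_geoRenyi {ρ σ : Matrix n n ℂ} (hρ : IsState ρ) (hσ : IsSubState σ)
    (h : SuppLE ρ σ) {α : ℝ} (hα : 1 < α) : umegaki ρ σ ≤ geoRenyi α ρ σ := by
  rw [umegaki, if_pos h, geoRenyi_of_suppLE hρ.1 hσ.1 h (by linarith), EReal.coe_le_coe_iff]
  exact (umegaki_le_trace_perspective_log hρ hσ h).trans (trace_perspective_log_le hρ hσ h hα)

theorem geoRenyi_le_dMax {ρ σ : Matrix n n ℂ} (hρ : IsState ρ) (hσ : IsSubState σ)
    (h : SuppLE ρ σ) {α : ℝ} (hα : 1 < α) : geoRenyi α ρ σ ≤ dMax ρ σ := by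
  refine le_sInf ?_
  rintro _ ⟨t, ht, hle, rfl⟩
  rw [geoRenyi_of_suppLE hρ.1 hσ.1 h (by linarith), EReal.coe_le_coe_iff]
  exact logb_trace_perspective_le hρ hσ h hα ht hle

end Comparison

/-! ### Choi matrices and the link product -/

section Choi

variable {R A B C : Type*} [Fintype R] [DecidableEq R] [Fintype A] [DecidableEq A]
  [Fintype B] [DecidableEq B] [Fintype C] [DecidableEq C]

theorem choi_apply (N : Matrix A A ℂ →ₗ[ℂ] Matrix B B ℂ) (p q : A × B) :
    choi N p q = N (Matrix.single p.1 q.1 1) p.2 q.2 := by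
  have : (Matrix.of fun a a' => ketBra (fun p : A × A => if p.1 = p.2 then (1 : ℂ) else 0)
      (p.1, a) (q.1, a')) = Matrix.single p.1 q.1 1 := by
    ext a a'
    simp only [ketBra, vecMulVec_apply, of_apply, Pi.star_apply, Matrix.single_apply]
    split_ifs <;> simp_all
  change N (Matrix.of fun a a' => _) p.2 q.2 = _
  rw [this]

theorem idTensor_apply (N : Matrix A A ℂ →ₗ[ℂ] Matrix B B ℂ) (X : Matrix (R × A) (R × A) ℂ)
    (p q : R × B) :
    idTensor R N X p q = ∑ a, ∑ a', X (p.1, a) (q.1, a') * choi N (a, p.2) (a', q.2) := by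
  change N (Matrix.of fun a a' => X (p.1, a) (q.1, a')) p.2 q.2 = _
  rw [matrix_eq_sum_single (Matrix.of fun a a' => X (p.1, a) (q.1, a'))]
  simp only [map_sum, Matrix.sum_apply, choi_apply, of_apply]
  refine Finset.sum_congr rfl fun a _ => Finset.sum_congr rfl fun a' _ => ?_
  have : Matrix.single a a' (X (p.1, a) (q.1, a')) =
      X (p.1, a) (q.1, a') • Matrix.single a a' (1 : ℂ) := by
    rw [smul_single, smul_eq_mul, mul_one]
  rw [this, map_smul, Matrix.smul_apply, smul_eq_mul]

/-- The contraction of the two copies of `A`. -/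
noncomputable def contraction (R A B : Type*) [DecidableEq R] [DecidableEq A] [DecidableEq B] :
    Matrix (R × B) ((R × A) × (A × B)) ℂ :=
  Matrix.of fun p q => (if p.1 = q.1.1 then 1 else 0) * (if p.2 = q.2.2 then 1 else 0) *
    (if q.1.2 = q.2.1 then 1 else 0)

/-- The link product of operators on `RA` and `AB`. -/
noncomputable def link (X : Matrix (R × A) (R × A) ℂ) (J : Matrix (A × B) (A × B) ℂ) :
    Matrix (R × B) (R × B) ℂ :=
  contraction R A B * (X ⊗ₖ J) * (contraction R A B)ᴴ

theorem contraction_mul_apply {S : Type*} (Z : Matrix ((R × A) × (A × B)) S ℂ) (p : R × B) (s : S) :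
    (contraction R A B * Z) p s = ∑ a, Z ((p.1, a), (a, p.2)) s := by
  simp only [mul_apply, contraction, of_apply, Fintype.sum_prod_type, ite_mul, one_mul, zero_mul,
    mul_ite, mul_one, mul_zero]
  rw [Finset.sum_comm]
  simp

theorem link_apply (X : Matrix (R × A) (R × A) ℂ) (J : Matrix (A × B) (A × B) ℂ) (p q : R × B) :
    link X J p q = ∑ a, ∑ a', X (p.1, a) (q.1, a') * J (a, p.2) (a', q.2) := by
  have h : link X J = contraction R A B * (contraction R A B * (X ⊗ₖ J)ᴴ)ᴴ := by
    rw [link, conjTranspose_mul, conjTranspose_conjTranspose, Matrix.mul_assoc]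
  rw [h, contraction_mul_apply]
  refine Finset.sum_congr rfl fun a _ => ?_
  rw [conjTranspose_apply, contraction_mul_apply, star_sum]
  refine Finset.sum_congr rfl fun a' _ => ?_
  rw [conjTranspose_apply, star_star, kroneckerMap_apply]

theorem idTensor_eq_link (N : Matrix A A ℂ →ₗ[ℂ] Matrix B B ℂ) (X : Matrix (R × A) (R × A) ℂ) :
    idTensor R N X = link X (choi N) := by
  ext p q
  rw [idTensor_apply, link_apply]

theorem link_posSemidef {X : Matrix (R × A) (R × A) ℂ} {J : Matrix (A × B) (A × B) ℂ}
    (hX : X.PosSemidef) (hJ : J.PosSemidef) : (link X J).PosSemidef :=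
  (hX.kronecker hJ).mul_mul_conjTranspose_same _

/-- Complete positivity is tested only with ancillas `Fin k`, so the system A is relabelled by `Fin
(Fintype.card A)`. -/
theorem IsCP.choi_posSemidef {N : Matrix A A ℂ →ₗ[ℂ] Matrix B B ℂ} (hN : IsCP N) :
    (choi N).PosSemidef := by
  let e : Fin (Fintype.card A) ≃ A := (Fintype.equivFin A).symm
  let e1 : Fin (Fintype.card A) × A ≃ A × A := e.prodCongr (Equiv.refl A)
  let e2 : Fin (Fintype.card A) × B ≃ A × B := e.prodCongr (Equiv.refl B)
  have h1 := (posSemidef_vecMulVec_self_star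
    (fun p : A × A => if p.1 = p.2 then (1 : ℂ) else 0)).submatrix e1
  have h2 := hN _ _ h1
  rw [← posSemidef_submatrix_equiv e2]
  exact h2

theorem isCP_of_choi_posSemidef {N : Matrix A A ℂ →ₗ[ℂ] Matrix B B ℂ} (h : (choi N).PosSemidef) :
    IsCP N := by
  intro k X hX
  rw [idTensor_eq_link]
  exact link_posSemidef hX h

theorem IsCP.idTensor_posSemidef {N : Matrix A A ℂ →ₗ[ℂ] Matrix B B ℂ} (hN : IsCP N)
    {X : Matrix (R × A) (R × A) ℂ} (hX : X.PosSemidef) : (idTensor R N X).PosSemidef := by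
  rw [idTensor_eq_link]
  exact link_posSemidef hX hN.choi_posSemidef

theorem trace_idTensor (N : Matrix A A ℂ →ₗ[ℂ] Matrix B B ℂ) (X : Matrix (R × A) (R × A) ℂ) :
    (idTensor R N X).trace = ∑ r, (N (X.submatrix (Prod.mk r) (Prod.mk r))).trace := by
  simp only [Matrix.trace, diag_apply, Fintype.sum_prod_type]
  rfl

theorem trace_eq_sum_blocks (X : Matrix (R × A) (R × A) ℂ) :
    X.trace = ∑ r, (X.submatrix (Prod.mk r) (Prod.mk r)).trace := by
  simp only [Matrix.trace, diag_apply, Fintype.sum_prod_type]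
  rfl

theorem IsChannel.trace_idTensor {N : Matrix A A ℂ →ₗ[ℂ] Matrix B B ℂ} (hN : IsChannel N)
    (X : Matrix (R × A) (R × A) ℂ) : (idTensor R N X).trace = X.trace := by
  rw [_root_.trace_idTensor, trace_eq_sum_blocks X]
  simp only [hN.2]

theorem IsSubchannel.trace_idTensor_le {M : Matrix A A ℂ →ₗ[ℂ] Matrix B B ℂ}
    (hM : IsSubchannel M) {X : Matrix (R × A) (R × A) ℂ} (hX : X.PosSemidef) :
    (idTensor R M X).trace.re ≤ X.trace.re := by
  rw [_root_.trace_idTensor, trace_eq_sum_blocks X, Complex.re_sum, Complex.re_sum]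
  exact Finset.sum_le_sum fun r _ => hM.2 _ (hX.submatrix _)

theorem IsChannel.isState {N : Matrix A A ℂ →ₗ[ℂ] Matrix B B ℂ} (hN : IsChannel N)
    {ρ : Matrix (R × A) (R × A) ℂ} (hρ : IsState ρ) : IsState (idTensor R N ρ) :=
  ⟨hN.1.idTensor_posSemidef hρ.1, (hN.trace_idTensor ρ).trans hρ.2⟩

theorem IsSubchannel.isSubState {M : Matrix A A ℂ →ₗ[ℂ] Matrix B B ℂ} (hM : IsSubchannel M)
    {σ : Matrix (R × A) (R × A) ℂ} (hσ : IsSubState σ) : IsSubState (idTensor R M σ) :=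
  ⟨hM.1.idTensor_posSemidef hσ.1, (hM.trace_idTensor_le hσ.1).trans hσ.2⟩

theorem IsState.isSubState {n : Type*} [Fintype n] {ρ : Matrix n n ℂ} (hρ : IsState ρ) :
    IsSubState ρ := ⟨hρ.1, by rw [hρ.2]; simp⟩

/-! ### Pure bipartite inputs -/

/-- A bipartite vector as a matrix. -/
def vecMat (φ : A × A → ℂ) : Matrix A A ℂ := Matrix.of fun a a' => φ (a, a')

theorem kronecker_one_mul_apply {S : Type*} (K : Matrix C A ℂ) (Z : Matrix (A × B) S ℂ)
    (p : C × B) (s : S) :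
    ((K ⊗ₖ (1 : Matrix B B ℂ)) * Z) p s = ∑ a, K p.1 a * Z (a, p.2) s := by
  simp only [mul_apply, kroneckerMap_apply, Fintype.sum_prod_type, Matrix.one_apply]
  simp

theorem kronecker_one_conj_apply (K : Matrix C A ℂ) (Z : Matrix (A × B) (A × B) ℂ) (p q : C × B) :
    ((K ⊗ₖ (1 : Matrix B B ℂ)) * Z * (K ⊗ₖ (1 : Matrix B B ℂ))ᴴ) p q =
      ∑ a, ∑ a', K p.1 a * Z (a, p.2) (a', q.2) * star (K q.1 a') := by
  have h : (K ⊗ₖ (1 : Matrix B B ℂ)) * Z * (K ⊗ₖ (1 : Matrix B B ℂ))ᴴ =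
      (K ⊗ₖ (1 : Matrix B B ℂ)) * ((K ⊗ₖ (1 : Matrix B B ℂ)) * Zᴴ)ᴴ := by
    rw [conjTranspose_mul, conjTranspose_conjTranspose, Matrix.mul_assoc]
  rw [h, kronecker_one_mul_apply]
  refine Finset.sum_congr rfl fun a _ => ?_
  rw [conjTranspose_apply, kronecker_one_mul_apply, star_sum, Finset.mul_sum]
  refine Finset.sum_congr rfl fun a' _ => ?_
  rw [star_mul', conjTranspose_apply, star_star]
  ring

/-- This makes a pure input a congruence on the first factor of the Choi matrix, the shape to which
the transformer inequality applies. -/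
theorem idTensor_ketBra (N : Matrix A A ℂ →ₗ[ℂ] Matrix B B ℂ) (φ : A × A → ℂ) :
    idTensor A N (ketBra φ) =
      (vecMat φ ⊗ₖ (1 : Matrix B B ℂ)) * choi N * (vecMat φ ⊗ₖ (1 : Matrix B B ℂ))ᴴ := by
  ext p q
  rw [idTensor_apply, kronecker_one_conj_apply]
  refine Finset.sum_congr rfl fun a _ => Finset.sum_congr rfl fun a' _ => ?_
  simp only [ketBra, vecMulVec_apply, vecMat, of_apply, Pi.star_apply]
  ring

theorem trRight_kronecker_one_conj (K : Matrix C A ℂ) (Z : Matrix (A × B) (A × B) ℂ) :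
    trRight ((K ⊗ₖ (1 : Matrix B B ℂ)) * Z * (K ⊗ₖ (1 : Matrix B B ℂ))ᴴ) = K * trRight Z * Kᴴ := by
  ext c c'
  simp only [trRight, of_apply, kronecker_one_conj_apply]
  have h : (K * (Matrix.of fun a a' => ∑ b, Z (a, b) (a', b)) * Kᴴ) c c' =
      ∑ a', ∑ a, K c a * (∑ b, Z (a, b) (a', b)) * star (K c' a') := by
    rw [mul_apply]
    refine Finset.sum_congr rfl fun a' _ => ?_
    rw [mul_apply, Finset.sum_mul]
    rfl
  refine Eq.trans ?_ h.symm
  simp only [Finset.mul_sum, Finset.sum_mul]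
  rw [Finset.sum_comm, Finset.sum_comm]
  rw [Finset.sum_comm]
  conv_rhs => rw [Finset.sum_comm]
  refine Finset.sum_congr rfl fun a _ => ?_
  rw [Finset.sum_comm]

theorem trace_trRight (Z : Matrix (A × B) (A × B) ℂ) : (trRight Z).trace = Z.trace := by
  simp only [Matrix.trace, diag_apply, Fintype.sum_prod_type]
  rfl

theorem trace_kronecker_one_conj (K : Matrix C A ℂ) (Z : Matrix (A × B) (A × B) ℂ) :
    ((K ⊗ₖ (1 : Matrix B B ℂ)) * Z * (K ⊗ₖ (1 : Matrix B B ℂ))ᴴ).trace =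
      (K * trRight Z * Kᴴ).trace := by
  rw [← trace_trRight, trRight_kronecker_one_conj]

theorem trRight_posSemidef {Z : Matrix (A × B) (A × B) ℂ} (hZ : Z.PosSemidef) :
    (trRight Z).PosSemidef := by
  have : trRight Z = ∑ b, Z.submatrix (fun a => (a, b)) fun a => (a, b) := by
    ext a a'
    simp [trRight, Matrix.sum_apply]
  rw [this]
  exact posSemidef_sum _ fun b _ => hZ.submatrix _

theorem trRight_isHermitian {Z : Matrix (A × B) (A × B) ℂ} (hZ : Z.IsHermitian) :
    (trRight Z).IsHermitian := by
  ext a a'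
  simp only [trRight, conjTranspose_apply, of_apply, star_sum]
  refine Finset.sum_congr rfl fun b _ => ?_
  exact hZ.apply _ _

theorem trRight_sub (X Y : Matrix (A × B) (A × B) ℂ) :
    trRight (X - Y) = trRight X - trRight Y := by
  ext a a'
  simp [trRight]

theorem ketBra_posSemidef {n : Type*} [Fintype n] (φ : n → ℂ) : (ketBra φ).PosSemidef :=
  posSemidef_vecMulVec_self_star φ

theorem trace_ketBra (φ : A × A → ℂ) : (ketBra φ).trace = (vecMat φ * (vecMat φ)ᴴ).trace := by
  rw [Matrix.trace, Fintype.sum_prod_type, Matrix.trace]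
  refine Finset.sum_congr rfl fun a _ => ?_
  rw [diag_apply, mul_apply]
  rfl

/-- Every unit vector purifies its own marginal, so the double supremum over states and
purifications runs over all unit vectors. -/
theorem channelDiv_le_iff {D : Matrix (A × B) (A × B) ℂ → Matrix (A × B) (A × B) ℂ → EReal}
    {N M : Matrix A A ℂ →ₗ[ℂ] Matrix B B ℂ} {x : EReal} :
    channelDiv D N M ≤ x ↔ ∀ φ : A × A → ℂ, IsState (ketBra φ) →
      D (idTensor A N (ketBra φ)) (idTensor A M (ketBra φ)) ≤ x := by
  simp only [channelDiv, iSup_le_iff]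
  constructor
  · intro h φ hφ
    exact h _ ⟨trRight_posSemidef hφ.1, by rw [trace_trRight, hφ.2]⟩ φ rfl
  · rintro h ρ hρ φ rfl
    exact h φ ⟨ketBra_posSemidef φ, by rw [← trace_trRight, hρ.2]⟩

theorem le_channelDiv {D : Matrix (A × B) (A × B) ℂ → Matrix (A × B) (A × B) ℂ → EReal}
    {N M : Matrix A A ℂ →ₗ[ℂ] Matrix B B ℂ} {φ : A × A → ℂ} (hφ : IsState (ketBra φ)) :
    D (idTensor A N (ketBra φ)) (idTensor A M (ketBra φ)) ≤ channelDiv D N M :=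
  channelDiv_le_iff.1 le_rfl φ hφ

/-! ### Operator norm of positive semidefinite matrices -/

open scoped Matrix.Norms.L2Operator MatrixOrder in
theorem opNorm_le_iff {S : Matrix A A ℂ} (hS : S.PosSemidef) {t : ℝ} (ht : 0 ≤ t) :
    opNorm S ≤ t ↔ ((t : ℂ) • 1 - S).PosSemidef := by
  have h := CStarAlgebra.norm_le_iff_le_algebraMap S ht (nonneg_iff_posSemidef.2 hS)
  rw [cstar_norm_def] at h
  rw [opNorm, h, le_iff]
  have : algebraMap ℝ (Matrix A A ℂ) t = (t : ℂ) • 1 := by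
    ext i j
    simp [Algebra.algebraMap_eq_smul_one]
  rw [this]

theorem opNorm_nonneg (S : Matrix A A ℂ) : 0 ≤ opNorm S := norm_nonneg _

theorem opNorm_smul_one_sub_posSemidef {S : Matrix A A ℂ} (hS : S.PosSemidef) :
    ((opNorm S : ℂ) • 1 - S).PosSemidef :=
  (opNorm_le_iff hS (opNorm_nonneg S)).1 le_rfl

/-- An upper bound on all expectation values in faithful states bounds the operator. -/
theorem smul_one_sub_posSemidef_of_trace_le {S : Matrix A A ℂ} (hS : S.IsHermitian) {t : ℝ}
    (h : ∀ K : Matrix A A ℂ, IsUnit K → (K * Kᴴ).trace = 1 → (K * S * Kᴴ).trace.re ≤ t) :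
    ((t : ℂ) • 1 - S).PosSemidef := by
  set D := (t : ℂ) • 1 - S with hD
  have hDh : D.IsHermitian := by
    refine IsHermitian.sub ?_ hS
    rw [smul_one_eq_rdiag]
    exact rdiag_isHermitian _
  have htr : ∀ K : Matrix A A ℂ, (K * D * Kᴴ).trace.re =
      t * (K * Kᴴ).trace.re - (K * S * Kᴴ).trace.re := by
    intro K
    rw [hD, Matrix.mul_sub, Matrix.sub_mul, trace_sub, Complex.sub_re, Matrix.mul_smul,
      Matrix.mul_one, Matrix.smul_mul, trace_smul, smul_eq_mul, Complex.re_ofReal_mul]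
  -- Rescaling K to unit trace of KKᴴ removes the normalization from the hypothesis.
  have h1 : ∀ K : Matrix A A ℂ, IsUnit K → K ≠ 0 → 0 ≤ (K * D * Kᴴ).trace.re := by
    intro K hK hK0
    set c := (K * Kᴴ).trace.re with hc
    have hp := posSemidef_self_mul_conjTranspose K
    have hcc : (K * Kᴴ).trace = (c : ℂ) := by
      have := Complex.le_def.1 hp.trace_nonneg
      exact Complex.ext rfl (by simpa using this.2.symm)
    have hc0 : 0 < c := by
      have h2 : 0 ≤ c := (Complex.le_def.1 hp.trace_nonneg).1
      refine lt_of_le_of_ne h2 fun h3 => hK0 ?_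
      rw [← h3, Complex.ofReal_zero] at hcc
      exact self_mul_conjTranspose_eq_zero.1 (hp.trace_eq_zero_iff.1 hcc)
    set a : ℂ := (((√c)⁻¹ : ℝ) : ℂ) with ha
    have ha0 : a ≠ 0 := by
      rw [ha]; exact_mod_cast (inv_pos.2 (Real.sqrt_pos.2 hc0)).ne'
    have haa : a * star a = ((c⁻¹ : ℝ) : ℂ) := by
      rw [ha, RCLike.star_def, Complex.conj_ofReal, ← Complex.ofReal_mul, ← mul_inv,
        Real.mul_self_sqrt hc0.le]
    have e : ∀ Z : Matrix A A ℂ, (a • K) * Z * (a • K)ᴴ = ((c⁻¹ : ℝ) : ℂ) • (K * Z * Kᴴ) := by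
      intro Z
      rw [conjTranspose_smul, Matrix.smul_mul, Matrix.smul_mul, Matrix.mul_smul, smul_smul, haa]
    have h4 := h (a • K) (hK.smul (Units.mk0 a ha0))
      (by
        have := e 1
        rw [Matrix.mul_one, Matrix.mul_one] at this
        rw [this, trace_smul, hcc, smul_eq_mul, ← Complex.ofReal_mul, inv_mul_cancel₀ hc0.ne',
          Complex.ofReal_one])
    rw [e, trace_smul, smul_eq_mul, Complex.re_ofReal_mul, inv_mul_le_iff₀ hc0] at h4
    rw [htr, ← hc]
    linarith
  refine PosSemidef.of_dotProduct_mulVec_nonneg hDh fun v => ?_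
  have hreal : star v ⬝ᵥ (D *ᵥ v) = ((star v ⬝ᵥ (D *ᵥ v)).re : ℂ) :=
    Complex.ext rfl (by simpa using hDh.im_star_dotProduct_mulVec_self v)
  rw [hreal]
  rcases eq_or_ne v 0 with rfl | hv
  · simp
  have hvv : star v ⬝ᵥ v = (((star v ⬝ᵥ v).re : ℝ) : ℂ) ∧ 0 < (star v ⬝ᵥ v).re := by
    have h2 : 0 < star v ⬝ᵥ v := dotProduct_star_self_pos_iff.2 hv
    have h3 := Complex.lt_def.1 h2
    exact ⟨Complex.ext rfl (by simpa using h3.2.symm), h3.1⟩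
  -- The rank-one operator |v⟩⟨v| is a limit of the invertible operators |v⟩⟨v| + ε, and at ε = 0
  -- the trace is ‖v‖² times the quadratic form of D at v.
  set g : ℝ → ℝ := fun ε => ((vecMulVec v (star v) + (ε : ℂ) • 1) * D *
    (vecMulVec v (star v) + (ε : ℂ) • 1)ᴴ).trace.re with hg
  have hgc : Continuous g := by
    refine Complex.continuous_re.comp (Continuous.matrix_trace ?_)
    have : Continuous fun ε : ℝ => vecMulVec v (star v) + (ε : ℂ) • (1 : Matrix A A ℂ) :=
      continuous_const.add (Complex.continuous_ofReal.smul continuous_const)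
    exact (this.matrix_mul continuous_const).matrix_mul this.matrix_conjTranspose
  have hne : Nonempty A := by
    obtain ⟨a, -⟩ := Function.ne_iff.1 hv
    exact ⟨a⟩
  have hg0 : 0 ≤ g 0 := by
    refine ge_of_tendsto (hgc.continuousWithinAt (s := Set.Ioi 0) (x := 0)).tendsto ?_
    filter_upwards [self_mem_nhdsWithin] with ε hε
    have hu := (posDef_add_smul_one (posSemidef_vecMulVec_self_star v) hε).isUnit
    exact h1 _ hu hu.ne_zero
  have hval : g 0 = (star v ⬝ᵥ v).re * (star v ⬝ᵥ (D *ᵥ v)).re := by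
    have e1 : (vecMulVec v (star v))ᴴ = vecMulVec v (star v) :=
      (posSemidef_vecMulVec_self_star v).1
    simp only [hg, Complex.ofReal_zero, zero_smul, add_zero, e1]
    rw [vecMulVec_mul, vecMulVec_mul_vecMulVec, trace_vecMulVec, dotProduct_smul,
      dotProduct_comm v, ← dotProduct_mulVec, smul_eq_mul, hvv.1, Complex.re_mul_ofReal,
      Complex.ofReal_re, mul_comm]
  rw [hval] at hg0
  exact_mod_cast nonneg_of_mul_nonneg_right hg0 hvv.2

theorem trace_conj_le {S : Matrix A A ℂ} {t : ℝ} (h : ((t : ℂ) • 1 - S).PosSemidef)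
    (K : Matrix A A ℂ) (hK : (K * Kᴴ).trace = 1) : (K * S * Kᴴ).trace.re ≤ t := by
  have := (Complex.le_def.1 (h.mul_mul_conjTranspose_same K).trace_nonneg).1
  rw [Matrix.mul_sub, Matrix.sub_mul, trace_sub, Complex.sub_re, Matrix.mul_smul,
      Matrix.mul_one, Matrix.smul_mul, trace_smul, hK, smul_eq_mul, mul_one,
      Complex.ofReal_re] at this
  simpa using this

end Choi

/-! ### Closed forms of the channel divergences -/

section ClosedForm

open scoped MatrixOrder

variable {A B : Type*} [Fintype A] [DecidableEq A] [Fintype B] [DecidableEq B]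

theorem kronecker_one_inverse {K L : Matrix A A ℂ} (h : K * L = 1) :
    (K ⊗ₖ (1 : Matrix B B ℂ)) * (L ⊗ₖ (1 : Matrix B B ℂ)) = 1 := by
  rw [← mul_kronecker_mul, h, Matrix.one_mul, one_kronecker_one]

/-- The transformer inequality for K ⊗ 1 under the trace. Since K ⊗ 1 acts only on the input factor,
B can be traced out first. -/
theorem trace_perspective_pure_le {f : ℝ → ℝ} (hf : IsPowOrLog f)
    {J₁ J₂ : Matrix (A × B) (A × B) ℂ} (h₁ : J₁.PosSemidef) (h₂ : J₂.PosSemidef)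
    (h : SuppLE J₁ J₂) (K : Matrix A A ℂ) :
    (perspective f ((K ⊗ₖ (1 : Matrix B B ℂ)) * J₁ * (K ⊗ₖ (1 : Matrix B B ℂ))ᴴ)
      ((K ⊗ₖ (1 : Matrix B B ℂ)) * J₂ * (K ⊗ₖ (1 : Matrix B B ℂ))ᴴ)).trace.re ≤
      (K * trRight (perspective f J₁ J₂) * Kᴴ).trace.re := by
  rw [← trace_kronecker_one_conj]
  exact trace_re_le (hf.transformer h₁ h₂ h _)

/-- Invertible K correspond to inputs of full Schmidt rank, for which nothing is lost. -/
theorem trace_perspective_pure_eq {f : ℝ → ℝ} (hf : IsPowOrLog f)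
    {J₁ J₂ : Matrix (A × B) (A × B) ℂ} (h₁ : J₁.PosSemidef) (h₂ : J₂.PosSemidef)
    (h : SuppLE J₁ J₂) {K : Matrix A A ℂ} (hK : IsUnit K) :
    (perspective f ((K ⊗ₖ (1 : Matrix B B ℂ)) * J₁ * (K ⊗ₖ (1 : Matrix B B ℂ))ᴴ)
      ((K ⊗ₖ (1 : Matrix B B ℂ)) * J₂ * (K ⊗ₖ (1 : Matrix B B ℂ))ᴴ)).trace.re =
      (K * trRight (perspective f J₁ J₂) * Kᴴ).trace.re := by
  have hd := (isUnit_iff_isUnit_det K).1 hK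
  rw [← trace_kronecker_one_conj, hf.transformer_eq h₁ h₂ h
    (kronecker_one_inverse (nonsing_inv_mul K hd)) (kronecker_one_inverse (mul_nonsing_inv K hd))]

theorem suppLE_pure {J₁ J₂ : Matrix (A × B) (A × B) ℂ} (h₁ : J₁.PosSemidef) (h₂ : J₂.PosSemidef)
    (h : SuppLE J₁ J₂) (K : Matrix A A ℂ) :
    SuppLE ((K ⊗ₖ (1 : Matrix B B ℂ)) * J₁ * (K ⊗ₖ (1 : Matrix B B ℂ))ᴴ)
      ((K ⊗ₖ (1 : Matrix B B ℂ)) * J₂ * (K ⊗ₖ (1 : Matrix B B ℂ))ᴴ) :=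
  h.conj h₁ h₂ _

/-- A bipartite vector from a matrix. -/
def matVec (K : Matrix A A ℂ) : A × A → ℂ := fun p => K p.1 p.2

theorem vecMat_matVec (K : Matrix A A ℂ) : vecMat (matVec K) = K := rfl

theorem isState_ketBra_matVec {K : Matrix A A ℂ} (hK : (K * Kᴴ).trace = 1) :
    IsState (ketBra (matVec K)) :=
  ⟨ketBra_posSemidef _, by rw [trace_ketBra, vecMat_matVec, hK]⟩

variable {N M : Matrix A A ℂ →ₗ[ℂ] Matrix B B ℂ}

theorem trace_perspective_le_opNorm (hN : IsChannel N) (hM : IsSubchannel M)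
    (h : SuppLE (choi N) (choi M)) {α : ℝ} (hα : α ∈ Set.Ioc (1 : ℝ) 2) {φ : A × A → ℂ}
    (hφ : IsState (ketBra φ)) :
    (perspective (fun x => x ^ α) (idTensor A N (ketBra φ)) (idTensor A M (ketBra φ))).trace.re ≤
      opNorm (trRight (perspective (fun x => x ^ α) (choi N) (choi M))) := by
  have hf := isPowOrLog_rpow (Set.Ioc_subset_Icc_self hα)
  have hp := trRight_posSemidef (perspective_posSemidef (f := fun x : ℝ => x ^ α)
    (fun x hx => Real.rpow_nonneg hx α) hN.1.choi_posSemidef (choi M))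
  rw [idTensor_ketBra, idTensor_ketBra]
  refine (trace_perspective_pure_le hf hN.1.choi_posSemidef hM.1.choi_posSemidef h _).trans ?_
  exact trace_conj_le (opNorm_smul_one_sub_posSemidef hp) _ (by rw [← trace_ketBra, hφ.2])

theorem suppLE_idTensor_ketBra (hN : IsCP N) (hM : IsCP M)
    (h : SuppLE (choi N) (choi M)) (φ : A × A → ℂ) :
    SuppLE (idTensor A N (ketBra φ)) (idTensor A M (ketBra φ)) := by
  rw [idTensor_ketBra, idTensor_ketBra]
  exact suppLE_pure hN.choi_posSemidef hM.choi_posSemidef h _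

theorem exists_isState_ketBra (A : Type*) [Fintype A] [DecidableEq A] [Nonempty A] :
    ∃ a : ℝ, 0 < a ∧ IsState (ketBra (matVec ((a : ℂ) • (1 : Matrix A A ℂ)))) := by
  have hc : (0 : ℝ) < Fintype.card A := by exact_mod_cast Fintype.card_pos
  refine ⟨(√(Fintype.card A))⁻¹, inv_pos.2 (Real.sqrt_pos.2 hc), isState_ketBra_matVec ?_⟩
  rw [conjTranspose_smul, conjTranspose_one, Matrix.smul_mul, Matrix.mul_smul, Matrix.one_mul,
    smul_smul, trace_smul, trace_one, RCLike.star_def, Complex.conj_ofReal, smul_eq_mul,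
    ← Complex.ofReal_mul, ← mul_inv, Real.mul_self_sqrt hc.le]
  have : (Fintype.card A : ℂ) ≠ 0 := by exact_mod_cast hc.ne'
  push_cast
  rw [inv_mul_cancel₀ this]

theorem one_le_opNorm [Nonempty A] (hN : IsChannel N) (hM : IsSubchannel M)
    (h : SuppLE (choi N) (choi M)) {α : ℝ} (hα : α ∈ Set.Ioc (1 : ℝ) 2) :
    1 ≤ opNorm (trRight (perspective (fun x => x ^ α) (choi N) (choi M))) := by
  obtain ⟨a, -, hφ⟩ := exists_isState_ketBra A
  exact (one_le_trace_perspective (hN.isState hφ) (hM.isSubState hφ.isSubState)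
    (suppLE_idTensor_ketBra hN.1 hM.1 h _) hα.1.le).trans
    (trace_perspective_le_opNorm hN hM h hα hφ)

theorem geoRenyi_nonneg {n : Type*} [Fintype n] [DecidableEq n] {ρ σ : Matrix n n ℂ}
    (hρ : IsState ρ) (hσ : IsSubState σ) {α : ℝ} (hα : 1 < α) : 0 ≤ geoRenyi α ρ σ := by
  by_cases h : SuppLE ρ σ
  · rw [geoRenyi_of_suppLE hρ.1 hσ.1 h (by linarith)]
    refine EReal.coe_nonneg.2 (mul_nonneg (one_div_nonneg.2 (by linarith)) ?_)
    exact Real.logb_nonneg (by norm_num) (one_le_trace_perspective hρ hσ h hα.le)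
  · rw [geoRenyi_of_not_suppLE h]; exact le_top

theorem bsDiv_nonneg {n : Type*} [Fintype n] [DecidableEq n] {ρ σ : Matrix n n ℂ}
    (hρ : IsState ρ) (hσ : IsSubState σ) : 0 ≤ bsDiv ρ σ := by
  by_cases h : SuppLE ρ σ
  · rw [bsDiv_of_suppLE hρ.1 hσ.1 h]
    exact EReal.coe_nonneg.2 (trace_perspective_log_nonneg hρ hσ h)
  · rw [bsDiv, if_neg h]; exact le_top

theorem geoRenyiChannel_nonneg [Nonempty A] (hN : IsChannel N) (hM : IsSubchannel M) {α : ℝ}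
    (hα : 1 < α) : 0 ≤ geoRenyiChannel α N M := by
  obtain ⟨a, -, hφ⟩ := exists_isState_ketBra A
  exact (geoRenyi_nonneg (hN.isState hφ) (hM.isSubState hφ.isSubState) hα).trans (le_channelDiv hφ)

theorem geoRenyiChannel_eq [Nonempty A] (hN : IsChannel N) (hM : IsSubchannel M)
    (h : SuppLE (choi N) (choi M)) {α : ℝ} (hα : α ∈ Set.Ioc (1 : ℝ) 2) :
    geoRenyiChannel α N M = ((1 / (α - 1) * Real.logb 2
      (opNorm (trRight (perspective (fun x => x ^ α) (choi N) (choi M)))) : ℝ) : EReal) := by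
  have hα0 : 0 < α - 1 := by linarith [hα.1]
  have hst : ∀ {φ : A × A → ℂ}, IsState (ketBra φ) →
      geoRenyi α (idTensor A N (ketBra φ)) (idTensor A M (ketBra φ)) =
      ((1 / (α - 1) * Real.logb 2 (perspective (fun x => x ^ α) (idTensor A N (ketBra φ))
        (idTensor A M (ketBra φ))).trace.re : ℝ) : EReal) := fun {φ} hφ =>
    geoRenyi_of_suppLE (hN.isState hφ).1 (hM.isSubState hφ.isSubState).1
      (suppLE_idTensor_ketBra hN.1 hM.1 h φ) (by linarith [hα.1])
  have hone : ∀ {φ : A × A → ℂ}, IsState (ketBra φ) →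
      1 ≤ (perspective (fun x => x ^ α) (idTensor A N (ketBra φ))
        (idTensor A M (ketBra φ))).trace.re := fun {φ} hφ =>
    one_le_trace_perspective (hN.isState hφ) (hM.isSubState hφ.isSubState)
      (suppLE_idTensor_ketBra hN.1 hM.1 h φ) hα.1.le
  refine le_antisymm (channelDiv_le_iff.2 fun φ hφ => ?_) ?_
  · rw [hst hφ, EReal.coe_le_coe_iff]
    refine mul_le_mul_of_nonneg_left ?_ (one_div_nonneg.2 hα0.le)
    exact Real.logb_le_logb_of_le (by norm_num) (by linarith [hone hφ])
      (trace_perspective_le_opNorm hN hM h hα hφ)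
  · have h0 := geoRenyiChannel_nonneg hN hM hα.1
    -- Only a finite value x needs work: then x bounds the divergence at every invertible K, and
    -- exponentiation turns this into an operator bound on the partial trace.
    induction hx : geoRenyiChannel α N M using EReal.rec with
    | bot => rw [hx] at h0; simp at h0
    | top => exact le_top
    | coe x =>
      rw [EReal.coe_le_coe_iff]
      have hp := trRight_posSemidef (perspective_posSemidef (f := fun x : ℝ => x ^ α)
        (fun x hx => Real.rpow_nonneg hx α) hN.1.choi_posSemidef (choi M))
      have hle : opNorm (trRight (perspective (fun x => x ^ α) (choi N) (choi M))) ≤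
          2 ^ ((α - 1) * x) := by
        rw [opNorm_le_iff hp (by positivity)]
        refine smul_one_sub_posSemidef_of_trace_le hp.1 fun K hK htr => ?_
        have hφ := isState_ketBra_matVec htr
        have h1 := le_channelDiv (D := geoRenyi α) (N := N) (M := M) hφ
        rw [hst hφ] at h1
        have h2 := h1.trans (le_of_eq hx)
        rw [EReal.coe_le_coe_iff, one_div_mul_eq_div, div_le_iff₀ hα0,
          Real.logb_le_iff_le_rpow (by norm_num) (by linarith [hone hφ])] at h2
        rw [idTensor_ketBra, idTensor_ketBra, vecMat_matVec, trace_perspective_pure_eq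
          (isPowOrLog_rpow (Set.Ioc_subset_Icc_self hα)) hN.1.choi_posSemidef
          hM.1.choi_posSemidef h hK] at h2
        rwa [mul_comm (α - 1)]
      have h1 := one_le_opNorm hN hM h hα
      have := Real.logb_le_logb_of_le (b := 2) (by norm_num) (by linarith) hle
      rw [Real.logb_rpow (by norm_num) (by norm_num)] at this
      rwa [one_div_mul_eq_div, div_le_iff₀ hα0, mul_comm x]

theorem bsChannel_eq [Nonempty A] (hN : IsChannel N) (hM : IsSubchannel M)
    (h : SuppLE (choi N) (choi M)) :
    bsChannel N M =
      (opNorm (trRight (perspective (fun x => x * Real.logb 2 x) (choi N) (choi M))) : EReal) := by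
  set S := trRight (perspective (fun x => x * Real.logb 2 x) (choi N) (choi M)) with hS
  have hSh : S.IsHermitian := trRight_isHermitian (perspective_isHermitian _ _ _)
  have hst : ∀ {φ : A × A → ℂ}, IsState (ketBra φ) →
      bsDiv (idTensor A N (ketBra φ)) (idTensor A M (ketBra φ)) =
      ((perspective (fun x => x * Real.logb 2 x) (idTensor A N (ketBra φ))
        (idTensor A M (ketBra φ))).trace.re : EReal) := fun {φ} hφ =>
    bsDiv_of_suppLE (hN.isState hφ).1 (hM.isSubState hφ.isSubState).1
      (suppLE_idTensor_ketBra hN.1 hM.1 h φ)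
  have heq : ∀ {K : Matrix A A ℂ}, IsUnit K → (perspective (fun x => x * Real.logb 2 x)
      (idTensor A N (ketBra (matVec K))) (idTensor A M (ketBra (matVec K)))).trace.re =
      (K * S * Kᴴ).trace.re := fun {K} hK => by
    rw [idTensor_ketBra, idTensor_ketBra, vecMat_matVec, trace_perspective_pure_eq
      isPowOrLog_log hN.1.choi_posSemidef hM.1.choi_posSemidef h hK]
  -- Unlike for powers, positivity is not automatic, as x log x takes negative values. It follows
  -- from nonnegativity of the state divergence on all inputs of full Schmidt rank.
  have hSp : S.PosSemidef := by
    have := smul_one_sub_posSemidef_of_trace_le (S := -S) (t := 0) hSh.neg fun K hK htr => by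
      have hφ := isState_ketBra_matVec htr
      have h1 := trace_perspective_log_nonneg (hN.isState hφ) (hM.isSubState hφ.isSubState)
        (suppLE_idTensor_ketBra hN.1 hM.1 h _)
      rw [heq hK] at h1
      rw [Matrix.mul_neg, Matrix.neg_mul, trace_neg, Complex.neg_re]
      linarith
    simpa using this
  refine le_antisymm (channelDiv_le_iff.2 fun φ hφ => ?_) ?_
  · rw [hst hφ, EReal.coe_le_coe_iff, idTensor_ketBra, idTensor_ketBra]
    refine (trace_perspective_pure_le isPowOrLog_log hN.1.choi_posSemidef hM.1.choi_posSemidef h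
      _).trans ?_
    exact trace_conj_le (opNorm_smul_one_sub_posSemidef hSp) _ (by rw [← trace_ketBra, hφ.2])
  · have h0 : 0 ≤ bsChannel N M := by
      obtain ⟨a, -, hφ⟩ := exists_isState_ketBra A
      exact (bsDiv_nonneg (hN.isState hφ) (hM.isSubState hφ.isSubState)).trans (le_channelDiv hφ)
    induction hx : bsChannel N M using EReal.rec with
    | bot => rw [hx] at h0; simp at h0
    | top => exact le_top
    | coe x =>
      rw [hx] at h0
      rw [EReal.coe_le_coe_iff, opNorm_le_iff hSp (EReal.coe_nonneg.1 h0)]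
      refine smul_one_sub_posSemidef_of_trace_le hSh fun K hK htr => ?_
      have hφ := isState_ketBra_matVec htr
      have h1 := le_channelDiv (D := bsDiv) (N := N) (M := M) hφ
      rw [hst hφ, heq hK] at h1
      exact EReal.coe_le_coe_iff.1 (h1.trans (le_of_eq hx))

theorem suppLE_of_smul {n : Type*} [Fintype n] [DecidableEq n] {X Y : Matrix n n ℂ} {c : ℂ}
    (hc : c ≠ 0) (h : SuppLE (c • X) (c • Y)) : SuppLE X Y := by
  obtain ⟨Z, hZ⟩ := suppLE_iff_exists_mul.1 h
  refine suppLE_iff_exists_mul.2 ⟨Z, smul_right_injective _ hc ?_⟩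
  simpa using hZ

/-- On the maximally entangled input the outputs are a common multiple of the Choi matrices. -/
theorem channelDiv_eq_top [Nonempty A] (h : ¬ SuppLE (choi N) (choi M))
    {D : Matrix (A × B) (A × B) ℂ → Matrix (A × B) (A × B) ℂ → EReal}
    (hD : ∀ X Y, ¬ SuppLE X Y → D X Y = ⊤) : channelDiv D N M = ⊤ := by
  obtain ⟨a, ha, hφ⟩ := exists_isState_ketBra A
  rw [← top_le_iff]
  refine le_trans (le_of_eq ?_) (le_channelDiv hφ)
  refine (hD _ _ fun hs => h ?_).symm
  have e : ∀ L : Matrix A A ℂ →ₗ[ℂ] Matrix B B ℂ,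
      idTensor A L (ketBra (matVec ((a : ℂ) • (1 : Matrix A A ℂ)))) = ((a : ℂ) * a) • choi L := by
    intro L
    rw [idTensor_ketBra, vecMat_matVec, smul_kronecker, one_kronecker_one, conjTranspose_smul,
      conjTranspose_one, Matrix.smul_mul, Matrix.one_mul, Matrix.mul_smul, Matrix.mul_one,
      smul_smul, RCLike.star_def, Complex.conj_ofReal]
  rw [e, e] at hs
  have ha' : (a : ℂ) ≠ 0 := by exact_mod_cast ha.ne'
  exact suppLE_of_smul (mul_ne_zero ha' ha') hs

theorem geoRenyiChannel_eq_top [Nonempty A] (h : ¬ SuppLE (choi N) (choi M)) (α : ℝ) :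
    geoRenyiChannel α N M = ⊤ :=
  channelDiv_eq_top h fun _ _ hs => geoRenyi_of_not_suppLE hs α

theorem bsChannel_eq_top [Nonempty A] (h : ¬ SuppLE (choi N) (choi M)) : bsChannel N M = ⊤ :=
  channelDiv_eq_top h fun _ _ hs => if_neg hs

end ClosedForm

/-! ### Chain rule, amortization and sub-additivity -/

section ChainRule

open scoped MatrixOrder

variable {R A B : Type*} [Fintype R] [DecidableEq R] [Fintype A] [DecidableEq A]
  [Fintype B] [DecidableEq B]

theorem trace_link (G : Matrix (R × A) (R × A) ℂ) (H : Matrix (A × B) (A × B) ℂ) :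
    (link G H).trace = ∑ a, ∑ a', (∑ r, G (r, a) (r, a')) * trRight H a a' := by
  have : (link G H).trace =
      ∑ r, ∑ b, ∑ a, ∑ a', G (r, a) (r, a') * H (a, b) (a', b) := by
    simp only [Matrix.trace, diag_apply, Fintype.sum_prod_type, link_apply]
  rw [this]
  simp only [trRight, of_apply, Finset.sum_mul_sum]
  have e1 : ∀ r, ∑ b, ∑ a, ∑ a', G (r, a) (r, a') * H (a, b) (a', b) =
      ∑ a, ∑ a', ∑ b, G (r, a) (r, a') * H (a, b) (a', b) := by
    intro r
    rw [Finset.sum_comm]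
    exact Finset.sum_congr rfl fun a _ => Finset.sum_comm
  simp only [e1]
  rw [Finset.sum_comm]
  exact Finset.sum_congr rfl fun a _ => Finset.sum_comm

/-- The trace of the link product is the sum of all entries of a Hadamard product of the reduced G
with the partial trace of H. By the Schur product theorem, replacing the latter by its norm times
the identity can only increase the real part. -/
theorem trace_link_le {G : Matrix (R × A) (R × A) ℂ} {H : Matrix (A × B) (A × B) ℂ}
    (hG : G.PosSemidef) (hH : H.PosSemidef) :
    (link G H).trace.re ≤ opNorm (trRight H) * G.trace.re := by
  set g : Matrix A A ℂ := Matrix.of fun a a' => ∑ r, G (r, a) (r, a') with hg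
  have hgp : g.PosSemidef := by
    have : g = ∑ r, G.submatrix (Prod.mk r) (Prod.mk r) := by
      ext a a'
      simp [hg, Matrix.sum_apply]
    rw [this]
    exact posSemidef_sum _ fun r _ => hG.submatrix _
  have h1 := (hgp.hadamard (opNorm_smul_one_sub_posSemidef (trRight_posSemidef hH))
    ).dotProduct_mulVec_nonneg fun _ => 1
  have h2 : star (fun _ : A => (1 : ℂ)) ⬝ᵥ
      ((g ⊙ ((opNorm (trRight H) : ℂ) • 1 - trRight H)) *ᵥ fun _ => 1) =
      (opNorm (trRight H) : ℂ) * G.trace - (link G H).trace := by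
    rw [trace_link]
    have e : G.trace = ∑ a, g a a := by
      simp only [Matrix.trace, diag_apply, Fintype.sum_prod_type, hg, of_apply]
      exact Finset.sum_comm
    rw [e, Finset.mul_sum, ← Finset.sum_sub_distrib]
    simp only [dotProduct, mulVec, Pi.star_apply, star_one, one_mul, mul_one, hadamard_apply,
      Matrix.sub_apply, Matrix.smul_apply, smul_eq_mul, mul_sub, Finset.sum_sub_distrib, hg, of_apply]
    simp [Matrix.one_apply, mul_comm]
  rw [h2] at h1
  have := (Complex.le_def.1 h1).1
  simp only [Complex.zero_re, Complex.sub_re, Complex.re_ofReal_mul] at this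
  linarith

theorem kronecker_suppLE {n m : Type*} [Fintype n] [DecidableEq n] [Fintype m] [DecidableEq m]
    {X₁ Y₁ : Matrix n n ℂ} {X₂ Y₂ : Matrix m m ℂ} (h₁ : SuppLE X₁ Y₁) (h₂ : SuppLE X₂ Y₂) :
    SuppLE (X₁ ⊗ₖ X₂) (Y₁ ⊗ₖ Y₂) := by
  obtain ⟨Z₁, rfl⟩ := suppLE_iff_exists_mul.1 h₁
  obtain ⟨Z₂, rfl⟩ := suppLE_iff_exists_mul.1 h₂
  exact suppLE_iff_exists_mul.2 ⟨Z₁ ⊗ₖ Z₂, mul_kronecker_mul _ _ _ _⟩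

theorem link_suppLE {ρ σ : Matrix (R × A) (R × A) ℂ} {J₁ J₂ : Matrix (A × B) (A × B) ℂ}
    (hρ : ρ.PosSemidef) (hσ : σ.PosSemidef) (h₁ : J₁.PosSemidef) (h₂ : J₂.PosSemidef)
    (h : SuppLE ρ σ) (h' : SuppLE J₁ J₂) : SuppLE (link ρ J₁) (link σ J₂) :=
  (kronecker_suppLE h h').conj (hρ.kronecker h₁) (hσ.kronecker h₂) _

/-- The heart of the chain rule: the link product is a congruence of ρ ⊗ J by a fixed contraction
matrix, so the transformer inequality and multiplicativity give the link product of the two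
perspectives as an upper bound. -/
theorem trace_perspective_link_le {ρ σ : Matrix (R × A) (R × A) ℂ}
    {J₁ J₂ : Matrix (A × B) (A × B) ℂ}
    (hρ : ρ.PosSemidef) (hσ : σ.PosSemidef) (h₁ : J₁.PosSemidef) (h₂ : J₂.PosSemidef)
    (h : SuppLE ρ σ) (h' : SuppLE J₁ J₂) {α : ℝ} (hα : α ∈ Set.Icc (1 : ℝ) 2) :
    (perspective (fun x => x ^ α) (link ρ J₁) (link σ J₂)).trace.re ≤
      opNorm (trRight (perspective (fun x => x ^ α) J₁ J₂)) *
        (perspective (fun x => x ^ α) ρ σ).trace.re := by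
  have h1 := trace_re_le ((isPowOrLog_rpow hα).transformer (hρ.kronecker h₁) (hσ.kronecker h₂)
    (kronecker_suppLE h h') (contraction R A B))
  rw [perspective_kronecker hρ hσ h₁ h₂] at h1
  exact h1.trans (trace_link_le
    (perspective_posSemidef (fun x hx => Real.rpow_nonneg hx α) hρ σ)
    (perspective_posSemidef (fun x hx => Real.rpow_nonneg hx α) h₁ J₂))

theorem nonempty_right_of_isState {ρ : Matrix (R × A) (R × A) ℂ} (hρ : IsState ρ) :
    Nonempty A := by
  by_contra h
  rw [not_nonempty_iff] at h
  have := hρ.2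
  simp [Matrix.trace] at this

/-- The chain rule. -/
theorem geoRenyi_idTensor_le {α : ℝ} (hα : α ∈ Set.Ioc (1 : ℝ) 2)
    {ρ σ : Matrix (R × A) (R × A) ℂ} {N M : Matrix A A ℂ →ₗ[ℂ] Matrix B B ℂ}
    (hρ : IsState ρ) (hσ : IsSubState σ) (hN : IsChannel N) (hM : IsSubchannel M) :
    geoRenyi α (idTensor R N ρ) (idTensor R M σ) ≤
      geoRenyi α ρ σ + geoRenyiChannel α N M := by
  have hne : Nonempty A := nonempty_right_of_isState hρ
  have hα0 : 0 < α - 1 := by linarith [hα.1]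
  by_cases h : SuppLE ρ σ
  · by_cases h' : SuppLE (choi N) (choi M)
    · have hl : SuppLE (idTensor R N ρ) (idTensor R M σ) := by
        rw [idTensor_eq_link, idTensor_eq_link]
        exact link_suppLE hρ.1 hσ.1 hN.1.choi_posSemidef hM.1.choi_posSemidef h h'
      have h1 := one_le_trace_perspective (hN.isState hρ) (hM.isSubState hσ) hl hα.1.le
      rw [geoRenyiChannel_eq hN hM h' hα, geoRenyi_of_suppLE hρ.1 hσ.1 h (by linarith [hα.1]),
        geoRenyi_of_suppLE (hN.isState hρ).1 (hM.isSubState hσ).1 hl (by linarith [hα.1]),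
        ← EReal.coe_add, EReal.coe_le_coe_iff, ← mul_add]
      refine mul_le_mul_of_nonneg_left ?_ (one_div_nonneg.2 hα0.le)
      have h2 := one_le_trace_perspective hρ hσ h hα.1.le
      have h3 := one_le_opNorm hN hM h' hα
      rw [← Real.logb_mul (by linarith) (by linarith)]
      refine Real.logb_le_logb_of_le (by norm_num) (by linarith) ?_
      rw [mul_comm, idTensor_eq_link, idTensor_eq_link]
      exact trace_perspective_link_le hρ.1 hσ.1 hN.1.choi_posSemidef hM.1.choi_posSemidef h h'
        (Set.Ioc_subset_Icc_self hα)
    · rw [geoRenyiChannel_eq_top h', EReal.add_top_of_ne_bot]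
      · exact le_top
      · exact ne_of_gt (lt_of_lt_of_le EReal.bot_lt_zero (geoRenyi_nonneg hρ hσ hα.1))
  · rw [geoRenyi_of_not_suppLE h, EReal.top_add_of_ne_bot]
    · exact le_top
    · exact ne_of_gt (lt_of_lt_of_le EReal.bot_lt_zero (geoRenyiChannel_nonneg hN hM hα.1))

/-- The chain rule for the second pair of maps, applied to the outputs of the first. The output of
M₁ may be only sub-normalized, as the chain rule permits. -/
theorem geoRenyiChannel_comp_le {C : Type*} [Fintype C] [DecidableEq C] {α : ℝ}
    (hα : α ∈ Set.Ioc (1 : ℝ) 2) {N₁ M₁ : Matrix A A ℂ →ₗ[ℂ] Matrix B B ℂ}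
    {N₂ M₂ : Matrix B B ℂ →ₗ[ℂ] Matrix C C ℂ} (hN₁ : IsChannel N₁) (hM₁ : IsSubchannel M₁)
    (hN₂ : IsChannel N₂) (hM₂ : IsSubchannel M₂) :
    geoRenyiChannel α (N₂ ∘ₗ N₁) (M₂ ∘ₗ M₁) ≤
      geoRenyiChannel α N₁ M₁ + geoRenyiChannel α N₂ M₂ := by
  refine channelDiv_le_iff.2 fun φ hφ => ?_
  have h := geoRenyi_idTensor_le hα (hN₁.isState hφ) (hM₁.isSubState hφ.isSubState) hN₂ hM₂
  exact h.trans (add_le_add_left (le_channelDiv (D := geoRenyi α) hφ) _)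

/-- A reindexing is a congruence by an invertible permutation matrix. -/
theorem perspective_submatrix {n m : Type*} [Fintype n] [DecidableEq n] [Fintype m]
    [DecidableEq m] {f : ℝ → ℝ} (hf : IsPowOrLog f) {X Y : Matrix n n ℂ}
    (hX : X.PosSemidef) (hY : Y.PosSemidef) (h : SuppLE X Y) (e : m ≃ n) :
    perspective f (X.submatrix e e) (Y.submatrix e e) = (perspective f X Y).submatrix e e := by
  set K : Matrix m n ℂ := (1 : Matrix n n ℂ).submatrix e id with hK
  have h1 : ∀ Z : Matrix n n ℂ, K * Z * Kᴴ = Z.submatrix e e := by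
    intro Z
    ext i j
    simp [hK, Matrix.mul_apply, Matrix.one_apply]
  have h2 : Kᴴ * K = 1 := by
    ext i j
    simp only [hK, mul_apply, conjTranspose_apply, submatrix_apply, id, Matrix.one_apply]
    rw [Equiv.sum_comp e fun k => star (if k = i then (1 : ℂ) else 0) * if k = j then 1 else 0]
    simp [eq_comm]
  have h3 : K * Kᴴ = 1 := by
    have := h1 1
    rwa [Matrix.mul_one, submatrix_one_equiv] at this
  have := hf.transformer_eq hX hY h h2 h3
  rwa [h1, h1, h1] at this

theorem suppLE_submatrix_iff {n m : Type*} [Fintype n] [DecidableEq n] [Fintype m]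
    [DecidableEq m] {X Y : Matrix n n ℂ} (hX : X.PosSemidef) (hY : Y.PosSemidef) (e : m ≃ n) :
    SuppLE (X.submatrix e e) (Y.submatrix e e) ↔ SuppLE X Y := by
  rw [suppLE_iff_exists_le hX hY, suppLE_iff_exists_le (hX.submatrix e) (hY.submatrix e)]
  refine exists_congr fun t => and_congr_right fun _ => ?_
  rw [← posSemidef_submatrix_equiv (M := (t : ℂ) • Y - X) e]
  rfl

theorem trace_submatrix {n m : Type*} [Fintype n] [Fintype m] (X : Matrix n n ℂ) (e : m ≃ n) :
    (X.submatrix e e).trace = X.trace :=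
  e.sum_comp fun i => X i i

theorem geoRenyi_submatrix {n m : Type*} [Fintype n] [DecidableEq n] [Fintype m]
    [DecidableEq m] {X Y : Matrix n n ℂ} (hX : X.PosSemidef) (hY : Y.PosSemidef) (e : m ≃ n)
    {α : ℝ} (hα : α ∈ Set.Icc (1 : ℝ) 2) :
    geoRenyi α (X.submatrix e e) (Y.submatrix e e) = geoRenyi α X Y := by
  by_cases h : SuppLE X Y
  · rw [geoRenyi_of_suppLE (hX.submatrix e) (hY.submatrix e) ((suppLE_submatrix_iff hX hY e).2 h)
      (by linarith [hα.1]), geoRenyi_of_suppLE hX hY h (by linarith [hα.1]),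
      perspective_submatrix (isPowOrLog_rpow hα) hX hY h, trace_submatrix]
  · rw [geoRenyi_of_not_suppLE h, geoRenyi_of_not_suppLE
      (fun h' => h ((suppLE_submatrix_iff hX hY e).1 h'))]

theorem geoRenyi_self {n : Type*} [Fintype n] [DecidableEq n] {ρ : Matrix n n ℂ} (hρ : IsState ρ)
    {α : ℝ} (hα : 0 < α) : geoRenyi α ρ ρ = 0 := by
  rw [geoRenyi_of_suppLE hρ.1 hρ.1 (SuppLE.refl ρ) hα,
    perspective_self (f := fun x : ℝ => x ^ α) (Real.zero_rpow hα.ne') (Real.one_rpow α) hρ.1,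
    hρ.2, Complex.one_re, Real.logb_one, mul_zero, EReal.coe_zero]

/-- Amortization does not increase the geometric Rényi channel divergence. -/
theorem amortizedGeoRenyi_eq {α : ℝ} (hα : α ∈ Set.Ioc (1 : ℝ) 2)
    {N M : Matrix A A ℂ →ₗ[ℂ] Matrix B B ℂ} (hN : IsChannel N) (hM : IsSubchannel M) :
    amortizedGeoRenyi α N M = geoRenyiChannel α N M := by
  refine le_antisymm ?_ (channelDiv_le_iff.2 fun φ hφ => ?_)
  · refine iSup_le fun k => iSup_le fun ρ => iSup_le fun σ => iSup_le fun hρ => iSup_le fun hσ =>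
      iSup_le fun hs => ?_
    have h := geoRenyi_idTensor_le hα hρ hσ.isSubState hN hM
    rw [geoRenyi_of_suppLE hρ.1 hσ.1 hs (by linarith [hα.1])] at h ⊢
    exact EReal.sub_le_of_le_add' h
  -- For the reverse bound both inputs are the same pure state, so the subtracted term is 0; the
  -- reference system is relabelled as `Fin (Fintype.card A)`.
  · let e : Fin (Fintype.card A) ≃ A := (Fintype.equivFin A).symm
    let e1 : Fin (Fintype.card A) × A ≃ A × A := e.prodCongr (Equiv.refl A)
    let e2 : Fin (Fintype.card A) × B ≃ A × B := e.prodCongr (Equiv.refl B)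
    have hst : IsState ((ketBra φ).submatrix e1 e1) :=
      ⟨hφ.1.submatrix e1, (trace_submatrix _ e1).trans hφ.2⟩
    have h1 : geoRenyi α (idTensor _ N ((ketBra φ).submatrix e1 e1))
        (idTensor _ M ((ketBra φ).submatrix e1 e1)) =
        geoRenyi α (idTensor A N (ketBra φ)) (idTensor A M (ketBra φ)) :=
      geoRenyi_submatrix (hN.isState hφ).1 (hM.isSubState hφ.isSubState).1 e2
        (Set.Ioc_subset_Icc_self hα)
    rw [← h1]
    refine le_trans (le_of_eq ?_) (le_iSup_of_le (Fintype.card A) (le_iSup_of_le _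
      (le_iSup_of_le _ (le_iSup_of_le hst (le_iSup_of_le hst (le_iSup_of_le (SuppLE.refl _)
        le_rfl))))))
    rw [geoRenyi_self hst (by linarith [hα.1]), sub_zero]

end ChainRule

/-! ### Additivity -/

section Additivity

variable {n m : Type*} [Fintype n] [DecidableEq n] [Fintype m] [DecidableEq m]

/-- The partial evaluation of the second tensor factor in the vector `w`. -/
noncomputable def evalRight (n : Type*) [DecidableEq n] (w : m → ℂ) : Matrix n (n × m) ℂ :=
  Matrix.of fun i p => if i = p.1 then star (w p.2) else 0

theorem evalRight_mul_apply {S : Type*} (w : m → ℂ) (Z : Matrix (n × m) S ℂ) (i : n) (s : S) :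
    (evalRight n w * Z) i s = ∑ k, star (w k) * Z (i, k) s := by
  simp only [mul_apply, evalRight, of_apply, Fintype.sum_prod_type, ite_mul, zero_mul]
  rw [Finset.sum_comm]
  simp

theorem evalRight_conj_kronecker (w : m → ℂ) (S : Matrix n n ℂ) (T : Matrix m m ℂ) :
    evalRight n w * (S ⊗ₖ T) * (evalRight n w)ᴴ = (star w ⬝ᵥ (T *ᵥ w)) • S := by
  have h : evalRight n w * (S ⊗ₖ T) * (evalRight n w)ᴴ =
      evalRight n w * (evalRight n w * (S ⊗ₖ T)ᴴ)ᴴ := by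
    rw [conjTranspose_mul, conjTranspose_conjTranspose, Matrix.mul_assoc]
  rw [h]
  ext i j
  rw [evalRight_mul_apply]
  simp only [conjTranspose_apply, evalRight_mul_apply, star_sum, star_mul', star_star,
    kroneckerMap_apply, Matrix.smul_apply, smul_eq_mul, dotProduct, mulVec, Pi.star_apply,
    Finset.sum_mul, Finset.mul_sum]
  refine Finset.sum_congr rfl fun k _ => Finset.sum_congr rfl fun l _ => ?_
  ring

theorem evalRight_conj_one (w : m → ℂ) :
    evalRight n w * (evalRight n w)ᴴ = (star w ⬝ᵥ w) • (1 : Matrix n n ℂ) := by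
  have := evalRight_conj_kronecker w (1 : Matrix n n ℂ) (1 : Matrix m m ℂ)
  rwa [one_kronecker_one, Matrix.mul_one, one_mulVec] at this

theorem exists_quadForm_ne_zero {X : Matrix n n ℂ} (hX : X.PosSemidef) (h : X ≠ 0) :
    ∃ w : n → ℂ, star w ⬝ᵥ (X *ᵥ w) ≠ 0 := by
  by_contra! h'
  refine h (Matrix.ext_of_mulVec_single fun i => ?_)
  rw [(hX.dotProduct_mulVec_zero_iff _).1 (h' _), zero_mulVec]

/-- Evaluating the second factor at a vector w with nonzero expectation of X₂ isolates the first
factor up to scalars. -/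
theorem suppLE_left_of_kronecker {X₁ Y₁ : Matrix n n ℂ} {X₂ Y₂ : Matrix m m ℂ}
    (hX₁ : X₁.PosSemidef) (hY₁ : Y₁.PosSemidef) (hX₂ : X₂.PosSemidef) (hY₂ : Y₂.PosSemidef)
    (h : SuppLE (X₁ ⊗ₖ X₂) (Y₁ ⊗ₖ Y₂)) (h0 : X₂ ≠ 0) : SuppLE X₁ Y₁ := by
  obtain ⟨w, hw⟩ := exists_quadForm_ne_zero hX₂ h0
  have h1 := h.conj (hX₁.kronecker hX₂) (hY₁.kronecker hY₂) (evalRight n w)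
  rw [evalRight_conj_kronecker, evalRight_conj_kronecker] at h1
  obtain ⟨Z, hZ⟩ := suppLE_iff_exists_mul.1 h1
  refine suppLE_iff_exists_mul.2 ⟨(star w ⬝ᵥ (X₂ *ᵥ w))⁻¹ • (star w ⬝ᵥ (Y₂ *ᵥ w)) • Z, ?_⟩
  rw [Matrix.mul_smul, Matrix.mul_smul, ← Matrix.smul_mul, ← hZ, smul_smul, inv_mul_cancel₀ hw,
    one_smul]

theorem kronecker_submatrix_prodComm (S : Matrix n n ℂ) (T : Matrix m m ℂ) :
    (S ⊗ₖ T).submatrix (Equiv.prodComm m n) (Equiv.prodComm m n) = T ⊗ₖ S := by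
  ext p q
  simp [mul_comm]

theorem suppLE_right_of_kronecker {X₁ Y₁ : Matrix n n ℂ} {X₂ Y₂ : Matrix m m ℂ}
    (hX₁ : X₁.PosSemidef) (hY₁ : Y₁.PosSemidef) (hX₂ : X₂.PosSemidef) (hY₂ : Y₂.PosSemidef)
    (h : SuppLE (X₁ ⊗ₖ X₂) (Y₁ ⊗ₖ Y₂)) (h0 : X₁ ≠ 0) : SuppLE X₂ Y₂ := by
  have h2 := (suppLE_submatrix_iff (hX₁.kronecker hX₂) (hY₁.kronecker hY₂)
    (Equiv.prodComm m n)).2 h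
  rw [kronecker_submatrix_prodComm, kronecker_submatrix_prodComm] at h2
  exact suppLE_left_of_kronecker hX₂ hY₂ hX₁ hY₁ h2 h0

theorem opNorm_kronecker {S : Matrix n n ℂ} {T : Matrix m m ℂ} (hS : S.PosSemidef)
    (hT : T.PosSemidef) : opNorm (S ⊗ₖ T) = opNorm S * opNorm T := by
  have hST := hS.kronecker hT
  refine le_antisymm ?_ ?_
  · rw [opNorm_le_iff hST (mul_nonneg (opNorm_nonneg S) (opNorm_nonneg T))]
    have h1 := (opNorm_smul_one_sub_posSemidef hS).kronecker
      (smul_posSemidef (n := m) PosSemidef.one (opNorm_nonneg T))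
    have h2 := hS.kronecker (opNorm_smul_one_sub_posSemidef hT)
    -- With s and t the norms, st·1 - S ⊗ T = (s·1 - S) ⊗ t·1 + S ⊗ (t·1 - T), a sum of positive
    -- terms.
    have e : ((opNorm S * opNorm T : ℝ) : ℂ) • (1 : Matrix (n × m) (n × m) ℂ) - S ⊗ₖ T =
        ((opNorm S : ℂ) • (1 : Matrix n n ℂ) - S) ⊗ₖ ((opNorm T : ℂ) • (1 : Matrix m m ℂ)) +
          S ⊗ₖ ((opNorm T : ℂ) • (1 : Matrix m m ℂ) - T) := by
      ext ⟨i, j⟩ ⟨k, l⟩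
      simp only [← one_kronecker_one, Complex.ofReal_mul, kroneckerMap_apply, Matrix.add_apply,
        Matrix.sub_apply, Matrix.smul_apply, smul_eq_mul]
      ring
    rw [e]
    exact h1.add h2
  · set t := opNorm (S ⊗ₖ T) with ht
    have ht0 : 0 ≤ t := opNorm_nonneg _
    have h1 := opNorm_smul_one_sub_posSemidef hST
    rw [← ht] at h1
    -- Compressing the second factor to w leaves a multiple of S alone, which bounds the
    -- expectations of T at every w.
    have hw : ∀ w : m → ℂ, opNorm S * (star w ⬝ᵥ (T *ᵥ w)).re ≤ t * (star w ⬝ᵥ w).re := by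
      intro w
      have h2 := h1.mul_mul_conjTranspose_same (evalRight n w)
      have e : evalRight n w * ((t : ℂ) • (1 : Matrix (n × m) (n × m) ℂ)) * (evalRight n w)ᴴ =
          (t : ℂ) • (star w ⬝ᵥ w) • (1 : Matrix n n ℂ) := by
        rw [Matrix.mul_smul, Matrix.mul_one, Matrix.smul_mul, evalRight_conj_one]
      rw [Matrix.mul_sub, Matrix.sub_mul, e, evalRight_conj_kronecker] at h2
      set b := (star w ⬝ᵥ (T *ᵥ w)).re with hb
      set c := (star w ⬝ᵥ w).re with hc
      have hb' : star w ⬝ᵥ (T *ᵥ w) = (b : ℂ) := by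
        have := Complex.le_def.1 (hT.dotProduct_mulVec_nonneg w)
        exact Complex.ext rfl (by simpa using this.2.symm)
      have hc' : star w ⬝ᵥ w = (c : ℂ) := by
        have := Complex.le_def.1 (dotProduct_star_self_nonneg w)
        exact Complex.ext rfl (by simpa using this.2.symm)
      have hb0 : 0 ≤ b := (Complex.le_def.1 (hT.dotProduct_mulVec_nonneg w)).1
      have hc0 : 0 ≤ c := (Complex.le_def.1 (dotProduct_star_self_nonneg w)).1
      rw [hb', hc', smul_smul, ← Complex.ofReal_mul,
        ← opNorm_le_iff (smul_posSemidef hS hb0) (mul_nonneg ht0 hc0)] at h2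
      have h3 : opNorm ((b : ℂ) • S) = b * opNorm S := by
        rw [opNorm, map_smul, norm_smul, Complex.norm_real, Real.norm_of_nonneg hb0, opNorm]
      rw [h3] at h2
      linarith
    have h4 : ((t : ℂ) • 1 - (opNorm S : ℂ) • T).PosSemidef := by
      refine PosSemidef.of_dotProduct_mulVec_nonneg ?_ fun w => ?_
      · exact (smul_posSemidef PosSemidef.one ht0).1.sub (smul_posSemidef hT (opNorm_nonneg S)).1
      · have h5 := hw w
        have hb' := Complex.le_def.1 (hT.dotProduct_mulVec_nonneg w)
        have hc' := Complex.le_def.1 (dotProduct_star_self_nonneg w)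
        rw [sub_mulVec, dotProduct_sub, smul_mulVec, smul_mulVec, one_mulVec, dotProduct_smul,
          dotProduct_smul, smul_eq_mul, smul_eq_mul, Complex.le_def]
        simp only [Complex.sub_re, Complex.sub_im, Complex.re_ofReal_mul, Complex.im_ofReal_mul,
          ← hb'.2, ← hc'.2, Complex.zero_re, Complex.zero_im, mul_zero, sub_zero, and_true]
        linarith
    rw [← opNorm_le_iff (smul_posSemidef hT (opNorm_nonneg S)) ht0] at h4
    have h3 : opNorm ((opNorm S : ℂ) • T) = opNorm S * opNorm T := by
      rw [opNorm, map_smul, norm_smul, Complex.norm_real, Real.norm_of_nonneg (opNorm_nonneg S),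
        opNorm, opNorm]
    rwa [h3] at h4

variable {A₁ B₁ A₂ B₂ : Type*} [Fintype A₁] [DecidableEq A₁] [Fintype B₁] [DecidableEq B₁]
  [Fintype A₂] [DecidableEq A₂] [Fintype B₂] [DecidableEq B₂]

theorem choi_tensorMap (N₁ : Matrix A₁ A₁ ℂ →ₗ[ℂ] Matrix B₁ B₁ ℂ)
    (N₂ : Matrix A₂ A₂ ℂ →ₗ[ℂ] Matrix B₂ B₂ ℂ) :
    choi (tensorMap N₁ N₂) = (choi N₁ ⊗ₖ choi N₂).submatrix
      (Equiv.prodProdProdComm A₁ A₂ B₁ B₂) (Equiv.prodProdProdComm A₁ A₂ B₁ B₂) := by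
  ext ⟨⟨a₁, a₂⟩, b₁, b₂⟩ ⟨⟨c₁, c₂⟩, d₁, d₂⟩
  rw [choi_apply]
  have : Matrix.single (a₁, a₂) (c₁, c₂) (1 : ℂ) =
      Matrix.single a₁ c₁ (1 : ℂ) ⊗ₖ Matrix.single a₂ c₂ (1 : ℂ) := by
    rw [single_kronecker_single, mul_one]
  simp only [this, tensorMap_kronecker, kroneckerMap_apply, submatrix_apply,
    Equiv.prodProdProdComm_apply, choi_apply]

theorem trace_swapMap (X : Matrix (A₁ × A₂) (A₁ × A₂) ℂ) : (swapMap A₁ A₂ X).trace = X.trace :=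
  trace_submatrix X (Equiv.prodComm A₂ A₁)

theorem swapMap_posSemidef {X : Matrix (A₁ × A₂) (A₁ × A₂) ℂ} (hX : X.PosSemidef) :
    (swapMap A₁ A₂ X).PosSemidef :=
  hX.submatrix (Equiv.prodComm A₂ A₁)

theorem IsCP.tensorMap {N₁ : Matrix A₁ A₁ ℂ →ₗ[ℂ] Matrix B₁ B₁ ℂ}
    {N₂ : Matrix A₂ A₂ ℂ →ₗ[ℂ] Matrix B₂ B₂ ℂ} (h₁ : IsCP N₁) (h₂ : IsCP N₂) :
    IsCP (tensorMap N₁ N₂) := by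
  refine isCP_of_choi_posSemidef ?_
  rw [choi_tensorMap]
  exact (h₁.choi_posSemidef.kronecker h₂.choi_posSemidef).submatrix _

theorem IsChannel.tensorMap {N₁ : Matrix A₁ A₁ ℂ →ₗ[ℂ] Matrix B₁ B₁ ℂ}
    {N₂ : Matrix A₂ A₂ ℂ →ₗ[ℂ] Matrix B₂ B₂ ℂ} (h₁ : IsChannel N₁) (h₂ : IsChannel N₂) :
    IsChannel (tensorMap N₁ N₂) := by
  refine ⟨h₁.1.tensorMap h₂.1, fun X => ?_⟩
  simp only [_root_.tensorMap, LinearMap.comp_apply]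
  rw [trace_swapMap, h₁.trace_idTensor, trace_swapMap, h₂.trace_idTensor]

theorem IsSubchannel.tensorMap {M₁ : Matrix A₁ A₁ ℂ →ₗ[ℂ] Matrix B₁ B₁ ℂ}
    {M₂ : Matrix A₂ A₂ ℂ →ₗ[ℂ] Matrix B₂ B₂ ℂ} (h₁ : IsSubchannel M₁) (h₂ : IsSubchannel M₂) :
    IsSubchannel (tensorMap M₁ M₂) := by
  refine ⟨h₁.1.tensorMap h₂.1, fun X hX => ?_⟩
  simp only [_root_.tensorMap, LinearMap.comp_apply]
  rw [trace_swapMap]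
  refine (h₁.trace_idTensor_le (swapMap_posSemidef (h₂.1.idTensor_posSemidef hX))).trans ?_
  rw [trace_swapMap]
  exact h₂.trace_idTensor_le hX

theorem IsChannel.choi_ne_zero [Nonempty A₁] {N : Matrix A₁ A₁ ℂ →ₗ[ℂ] Matrix B₁ B₁ ℂ}
    (hN : IsChannel N) : choi N ≠ 0 := by
  intro h
  obtain ⟨a, -, hφ⟩ := exists_isState_ketBra A₁
  have := (hN.isState hφ).2
  rw [idTensor_ketBra, h, Matrix.mul_zero, Matrix.zero_mul, trace_zero] at this
  exact zero_ne_one this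

theorem trRight_kronecker_submatrix (H₁ : Matrix (A₁ × B₁) (A₁ × B₁) ℂ)
    (H₂ : Matrix (A₂ × B₂) (A₂ × B₂) ℂ) :
    trRight ((H₁ ⊗ₖ H₂).submatrix (Equiv.prodProdProdComm A₁ A₂ B₁ B₂)
      (Equiv.prodProdProdComm A₁ A₂ B₁ B₂)) = trRight H₁ ⊗ₖ trRight H₂ := by
  ext ⟨a₁, a₂⟩ ⟨c₁, c₂⟩
  simp only [trRight, of_apply, submatrix_apply, Equiv.prodProdProdComm_apply, kroneckerMap_apply,
    Fintype.sum_prod_type, Finset.sum_mul_sum]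

theorem geoRenyiChannel_tensorMap [Nonempty A₁] [Nonempty A₂] {α : ℝ}
    (hα : α ∈ Set.Ioc (1 : ℝ) 2)
    {N₁ M₁ : Matrix A₁ A₁ ℂ →ₗ[ℂ] Matrix B₁ B₁ ℂ} {N₂ M₂ : Matrix A₂ A₂ ℂ →ₗ[ℂ] Matrix B₂ B₂ ℂ}
    (hN₁ : IsChannel N₁) (hM₁ : IsSubchannel M₁) (hN₂ : IsChannel N₂) (hM₂ : IsSubchannel M₂) :
    geoRenyiChannel α (tensorMap N₁ N₂) (tensorMap M₁ M₂) =
      geoRenyiChannel α N₁ M₁ + geoRenyiChannel α N₂ M₂ := by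
  have p₁ := hN₁.1.choi_posSemidef
  have p₂ := hN₂.1.choi_posSemidef
  have q₁ := hM₁.1.choi_posSemidef
  have q₂ := hM₂.1.choi_posSemidef
  -- Splitting the product inclusion needs nonzero Choi matrices N₁ and N₂, hence the
  -- trace-preserving property.
  have hs : SuppLE (choi (tensorMap N₁ N₂)) (choi (tensorMap M₁ M₂)) ↔
      SuppLE (choi N₁) (choi M₁) ∧ SuppLE (choi N₂) (choi M₂) := by
    rw [choi_tensorMap, choi_tensorMap, suppLE_submatrix_iff (p₁.kronecker p₂) (q₁.kronecker q₂)]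
    exact ⟨fun h => ⟨suppLE_left_of_kronecker p₁ q₁ p₂ q₂ h hN₂.choi_ne_zero,
      suppLE_right_of_kronecker p₁ q₁ p₂ q₂ h hN₁.choi_ne_zero⟩, fun h => kronecker_suppLE h.1 h.2⟩
  by_cases h₁ : SuppLE (choi N₁) (choi M₁)
  · by_cases h₂ : SuppLE (choi N₂) (choi M₂)
    · rw [geoRenyiChannel_eq (hN₁.tensorMap hN₂) (hM₁.tensorMap hM₂) (hs.2 ⟨h₁, h₂⟩) hα,
        geoRenyiChannel_eq hN₁ hM₁ h₁ hα, geoRenyiChannel_eq hN₂ hM₂ h₂ hα, ← EReal.coe_add,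
        EReal.coe_eq_coe_iff, choi_tensorMap, choi_tensorMap,
        perspective_submatrix (isPowOrLog_rpow (Set.Ioc_subset_Icc_self hα)) (p₁.kronecker p₂)
          (q₁.kronecker q₂) (kronecker_suppLE h₁ h₂), perspective_kronecker p₁ q₁ p₂ q₂,
        trRight_kronecker_submatrix, opNorm_kronecker, Real.logb_mul, mul_add]
      · linarith [one_le_opNorm hN₁ hM₁ h₁ hα]
      · linarith [one_le_opNorm hN₂ hM₂ h₂ hα]
      · exact trRight_posSemidef (perspective_posSemidef (fun x hx => Real.rpow_nonneg hx α) p₁ _)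
      · exact trRight_posSemidef (perspective_posSemidef (fun x hx => Real.rpow_nonneg hx α) p₂ _)
    · rw [geoRenyiChannel_eq_top (fun h => h₂ (hs.1 h).2), geoRenyiChannel_eq_top h₂,
        EReal.add_top_of_ne_bot]
      exact ne_of_gt (lt_of_lt_of_le EReal.bot_lt_zero (geoRenyiChannel_nonneg hN₁ hM₁ hα.1))
  · rw [geoRenyiChannel_eq_top (fun h => h₁ (hs.1 h).1), geoRenyiChannel_eq_top h₁,
      EReal.top_add_of_ne_bot]
    exact ne_of_gt (lt_of_lt_of_le EReal.bot_lt_zero (geoRenyiChannel_nonneg hN₂ hM₂ hα.1))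

end Additivity

/-! ### Block matrices and iterated geometric means -/

section Blocks

variable {n m : Type*} [Fintype n] [DecidableEq n] [Fintype m] [DecidableEq m]

theorem fromBlocks_row_conj {A B C D : Matrix n n ℂ} (h : (fromBlocks A B C D).PosSemidef)
    (K L : Matrix m n ℂ) :
    (K * A * Kᴴ + K * B * Lᴴ + (L * C * Kᴴ + L * D * Lᴴ)).PosSemidef := by
  have h1 := h.mul_mul_conjTranspose_same (fromCols K L)
  rw [fromCols_mul_fromBlocks, conjTranspose_fromCols_eq_fromRows_conjTranspose,
    fromCols_mul_fromRows] at h1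
  convert h1 using 1
  simp only [Matrix.add_mul]
  abel

theorem fromBlocks_conj {A B C D : Matrix n n ℂ} (h : (fromBlocks A B C D).PosSemidef)
    (K : Matrix m n ℂ) :
    (fromBlocks (K * A * Kᴴ) (K * B * Kᴴ) (K * C * Kᴴ) (K * D * Kᴴ)).PosSemidef := by
  have h1 := h.mul_mul_conjTranspose_same (fromBlocks K 0 0 K)
  rw [fromBlocks_conjTranspose, fromBlocks_multiply, fromBlocks_multiply] at h1
  simpa using h1

theorem fromBlocks_row_posSemidef (K L : Matrix n m ℂ) :
    (fromBlocks (K * Kᴴ) (K * Lᴴ) (L * Kᴴ) (L * Lᴴ)).PosSemidef := by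
  have h := posSemidef_self_mul_conjTranspose (fromRows K L)
  rwa [conjTranspose_fromRows_eq_fromCols_conjTranspose, fromRows_mul_fromCols] at h

/-- The added block matrix with all four blocks ε·1 is positive. Shifting every block alike makes
the regularized program have the same form. -/
theorem fromBlocks_add_smul_one {A B C D : Matrix n n ℂ} (h : (fromBlocks A B C D).PosSemidef)
    {ε : ℝ} (hε : 0 ≤ ε) :
    (fromBlocks (A + (ε : ℂ) • 1) (B + (ε : ℂ) • 1) (C + (ε : ℂ) • 1)
      (D + (ε : ℂ) • 1)).PosSemidef := by
  have h1 := smul_posSemidef (fromBlocks_row_posSemidef (1 : Matrix n n ℂ) 1) hε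
  rw [conjTranspose_one, Matrix.one_mul, fromBlocks_smul] at h1
  simpa [fromBlocks_add] using h.add h1

theorem posSemidef_right_of_fromBlocks {A B C D : Matrix n n ℂ}
    (h : (fromBlocks A B C D).PosSemidef) : D.PosSemidef := by
  exact h.submatrix Sum.inr

theorem posSemidef_left_of_fromBlocks {A B C D : Matrix n n ℂ}
    (h : (fromBlocks A B C D).PosSemidef) : A.PosSemidef := by
  exact h.submatrix Sum.inl

/-- In a factorization S Sᴴ of the block matrix, D is L Lᴴ and C is L Kᴴ for the lower and upper
rows L and K of S. -/
theorem suppLE_of_fromBlocks {A B C D : Matrix n n ℂ} (h : (fromBlocks A B C D).PosSemidef) :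
    SuppLE C D := by
  set S := sqr (fromBlocks A B C D) with hS
  have hSS : S * Sᴴ = fromBlocks A B C D := by
    rw [(sqr_isHermitian _).eq, sqr_mul_sqr h]
  have hD : D = S.toRows₂ * (S.toRows₂)ᴴ := by
    ext i j
    exact (congrFun (congrFun hSS (Sum.inr i)) (Sum.inr j)).symm
  have hC : C = S.toRows₂ * (S.toRows₁)ᴴ := by
    ext i j
    exact (congrFun (congrFun hSS (Sum.inr i)) (Sum.inl j)).symm
  have h1 : suppProj D * C = C := by
    rw [hC, ← Matrix.mul_assoc, hD, suppProj_mul_of_mul_conjTranspose]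
  have hDp := posSemidef_right_of_fromBlocks h
  have h2 : suppProj D = D * cfc (fun x : ℝ => x⁻¹) D := by
    nth_rw 2 [← cfc_id' ℝ D hDp.1.isSelfAdjoint]
    rw [cfc_mul_cfc, suppProj]
    congr 1
    ext x
    split_ifs with hx
    · simp [hx]
    · exact (mul_inv_cancel₀ hx).symm
  refine suppLE_iff_exists_mul.2 ⟨cfc (fun x : ℝ => x⁻¹) D * C, ?_⟩
  rw [← Matrix.mul_assoc, ← h2, h1]

theorem isClosed_posSemidef : IsClosed {X : Matrix n n ℂ | X.PosSemidef} := by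
  have : {X : Matrix n n ℂ | X.PosSemidef} =
      {X | Xᴴ = X} ∩ ⋂ v : n → ℂ, {X | 0 ≤ star v ⬝ᵥ (X *ᵥ v)} := by
    ext X
    simp only [Set.mem_ofPred_eq, Set.mem_inter_iff, Set.mem_iInter]
    exact ⟨fun h => ⟨h.1, h.dotProduct_mulVec_nonneg⟩,
      fun h => PosSemidef.of_dotProduct_mulVec_nonneg h.1 h.2⟩
  rw [this]
  refine (isClosed_eq (by fun_prop) (by fun_prop)).inter (isClosed_iInter fun v => ?_)
  exact isClosed_Ici.preimage (f := fun X : Matrix n n ℂ => star v ⬝ᵥ (X *ᵥ v)) (by fun_prop)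

end Blocks

/-! ### Iterated block inequalities and operator monotone roots. -/

section IteratedMean

open scoped MatrixOrder

variable {n m : Type*} [Fintype n] [DecidableEq n] [Fintype m] [DecidableEq m]

theorem cfc_rpow_cfc_rpow {A : Matrix n n ℂ} (hA : A.PosSemidef) (p q : ℝ) :
    cfc (fun x : ℝ => x ^ q) (cfc (fun x : ℝ => x ^ p) A) = cfc (fun x : ℝ => x ^ (p * q)) A := by
  obtain ⟨U, hU, d, hd, e⟩ := hA.exists_unitary_diag
  rw [cfc_eq_of_unitary_diag _ hU (cfc_eq_of_unitary_diag _ hU e), cfc_eq_of_unitary_diag _ hU e]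
  simp only [Real.rpow_mul (hd _)]

/-- If `B² ≤ A` then `B ≤ A ^ {1/2}`. -/
theorem le_cfc_rpow_half {A B : Matrix n n ℂ} (hB : B.PosSemidef)
    (h : (A - B * B).PosSemidef) : B ≤ cfc (fun x : ℝ => x ^ (2⁻¹ : ℝ)) A := by
  have hBB : (B * B).PosSemidef := by
    have := posSemidef_self_mul_conjTranspose B
    rwa [hB.1.eq] at this
  have h1 := cfc_rpow_le_cfc_rpow hBB h (p := 2⁻¹) ⟨by norm_num, by norm_num⟩
  have h2 : B * B = cfc (fun x : ℝ => x ^ (2 : ℝ)) B := by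
    nth_rw 1 2 [← cfc_id' ℝ B hB.1.isSelfAdjoint]
    rw [cfc_mul_cfc]
    congr 1
    ext x
    rw [Real.rpow_two, pow_two]
  rw [h2, cfc_rpow_cfc_rpow hB, hB.cfc_eq_self (fun x _ => by norm_num)] at h1
  exact Matrix.le_iff.2 h1

/-- Solutions of the iterated block inequalities are bounded by powers. -/
theorem le_cfc_rpow_of_fromBlocks_one {ℓ : ℕ} {T : Fin (ℓ + 1) → Matrix n n ℂ}
    (hT : ∀ i, (T i).PosSemidef)
    (h : ∀ i : Fin ℓ, (fromBlocks 1 (T i.succ) (T i.succ) (T i.castSucc)).PosSemidef)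
    (i : Fin (ℓ + 1)) : T i ≤ cfc (fun x : ℝ => x ^ ((2 : ℝ) ^ (i : ℕ))⁻¹) (T 0) := by
  induction i using Fin.induction with
  | zero =>
    rw [(hT 0).cfc_eq_self fun x _ => by simp]
  | succ i ih =>
    -- The row (-T_{i+1}, 1) realizes the Schur complement T_i - T_{i+1}² ≥ 0; the square root is
    -- then monotone and halves the exponent.
    have h1 := fromBlocks_row_conj (h i) (-(T i.succ)) 1
    have h2 : ((T i.castSucc) - T i.succ * T i.succ).PosSemidef := by
      convert h1 using 1
      simp only [conjTranspose_neg, conjTranspose_one, (hT _).1.eq, Matrix.mul_one, Matrix.one_mul,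
        Matrix.neg_mul, Matrix.mul_neg]
      abel
    have h3 := le_cfc_rpow_half (hT _) h2
    have h4 := cfc_rpow_le_cfc_rpow (hT i.castSucc) (Matrix.le_iff.1 ih) (p := 2⁻¹)
      ⟨by norm_num, by norm_num⟩
    rw [cfc_rpow_cfc_rpow (hT 0)] at h4
    refine h3.trans ((Matrix.le_iff.2 h4).trans (le_of_eq ?_))
    simp only [Fin.val_castSucc, Fin.val_succ, pow_succ, mul_inv]

/-- The block inequalities bound `M` from below by a geometric mean, positive definite case. -/
theorem geoMeanPos_le_of_fromBlocks {X M : Matrix n n ℂ} (hX : X.PosDef) {ℓ : ℕ}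
    {N : Fin (ℓ + 1) → Matrix n n ℂ} (hN : ∀ i, (N i).PosSemidef)
    (hM : (fromBlocks M X X (N (Fin.last ℓ))).PosSemidef)
    (h : ∀ i : Fin ℓ, (fromBlocks X (N i.succ) (N i.succ) (N i.castSucc)).PosSemidef) :
    (M - geoMeanPos (-((2 : ℝ) ^ ℓ)⁻¹) X (N 0)).PosSemidef := by
  have hXp := hX.posSemidef
  have e2 : isqr X * sqr X = 1 := by rw [isqr_mul_sqr hXp, suppProj_eq_one hX]
  have e3 : isqr X * X = sqr X := by
    nth_rw 2 [← sqr_mul_sqr hXp]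
    rw [← Matrix.mul_assoc, e2, Matrix.one_mul]
  set T : Fin (ℓ + 1) → Matrix n n ℂ := fun i => isqr X * N i * isqr X with hT
  have hTp : ∀ i, (T i).PosSemidef := fun i => isqr_conj_posSemidef (hN i) X
  have hTb : ∀ i : Fin ℓ, (fromBlocks 1 (T i.succ) (T i.succ) (T i.castSucc)).PosSemidef := by
    intro i
    have := fromBlocks_conj (h i) (isqr X)
    rwa [(isqr_isHermitian X).eq, isqr_mul_self_mul_isqr hXp, suppProj_eq_one hX] at this
  set p : ℝ := ((2 : ℝ) ^ ℓ)⁻¹ with hp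
  have hp0 : p ≠ 0 := by positivity
  have hl : T (Fin.last ℓ) ≤ cfc (fun x : ℝ => x ^ p) (T 0) :=
    le_cfc_rpow_of_fromBlocks_one hTp hTb (Fin.last ℓ)
  -- Q is used in place of the inverse of `T (Fin.last ℓ)`, of which only the upper bound by T₀^p is
  -- known.
  set Q := cfc (fun x : ℝ => x ^ (-p)) (T 0) with hQ
  have hQh : Qᴴ = Q := cfc_isHermitian _ _
  have e4 : Q * cfc (fun x : ℝ => x ^ p) (T 0) * Q = Q := by
    rw [hQ, cfc_mul_cfc, cfc_mul_cfc]
    refine (hTp 0).cfc_congr fun x hx => ?_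
    rcases hx.eq_or_lt with rfl | hx
    · simp [Real.zero_rpow hp0, Real.zero_rpow (neg_ne_zero.2 hp0)]
    · rw [← Real.rpow_add hx, ← Real.rpow_add hx]
      congr 1
      ring
  have hsX := (sqr_isHermitian X).eq
  have hiX := (isqr_isHermitian X).eq
  have hG : geoMeanPos (-p) X (N 0) = sqr X * Q * sqr X := rfl
  -- With G the geometric mean, this row gives M - 2G + X^{1/2} Q T_ℓ Q X^{1/2} ≥ 0. The last term
  -- is at most G because Q T₀^p Q = Q, hence M ≥ G.
  have key := fromBlocks_row_conj hM (1 : Matrix n n ℂ) (-(sqr X * Q * isqr X))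
  have e5 : (sqr X * Q * isqr X) * X = sqr X * Q * sqr X := by
    rw [Matrix.mul_assoc, e3]
  have e6 : X * (sqr X * Q * isqr X)ᴴ = sqr X * Q * sqr X := by
    have := congrArg conjTranspose e5
    rw [conjTranspose_mul, hXp.1.eq] at this
    rw [this]
    simp only [conjTranspose_mul, hsX, hQh, Matrix.mul_assoc]
  have e7 : (sqr X * Q * isqr X) * N (Fin.last ℓ) * (sqr X * Q * isqr X)ᴴ =
      sqr X * (Q * T (Fin.last ℓ) * Q) * sqr X := by
    simp only [hT, conjTranspose_mul, hsX, hQh, hiX, Matrix.mul_assoc]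
  have e8 : sqr X * (Q * T (Fin.last ℓ) * Q) * sqr X ≤ sqr X * Q * sqr X := by
    have h1 := conj_le_conj (conj_le_conj hl Q) (sqr X)
    rwa [hQh, hsX, e4] at h1
  have e9 : M - geoMeanPos (-p) X (N 0) =
      ((1 : Matrix n n ℂ) * M * 1ᴴ + 1 * X * (-(sqr X * Q * isqr X))ᴴ +
        (-(sqr X * Q * isqr X) * X * 1ᴴ +
          -(sqr X * Q * isqr X) * N (Fin.last ℓ) * (-(sqr X * Q * isqr X))ᴴ)) +
      (sqr X * Q * sqr X - sqr X * (Q * T (Fin.last ℓ) * Q) * sqr X) := by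
    rw [conjTranspose_neg, conjTranspose_one, Matrix.mul_neg, Matrix.mul_neg, Matrix.neg_mul,
      Matrix.neg_mul, Matrix.neg_mul, Matrix.neg_mul, neg_neg, Matrix.one_mul, Matrix.one_mul,
      Matrix.mul_one, Matrix.mul_one, e5, e6, e7, hG]
    abel
  rw [e9]
  exact key.add (Matrix.le_iff.1 e8)

end IteratedMean

/-! ### The block inequalities characterize the perspective for positive semidefinite operators. -/

section SDPBounds

variable {n m : Type*} [Fintype n] [DecidableEq n] [Fintype m] [DecidableEq m]

theorem suppLE_of_iterated_fromBlocks {X M : Matrix n n ℂ} {ℓ : ℕ}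
    {N : Fin (ℓ + 1) → Matrix n n ℂ}
    (hM : (fromBlocks M X X (N (Fin.last ℓ))).PosSemidef)
    (h : ∀ i : Fin ℓ, (fromBlocks X (N i.succ) (N i.succ) (N i.castSucc)).PosSemidef) :
    SuppLE X (N 0) := by
  have key : ∀ i, SuppLE (N i) (N 0) := fun i => by
    induction i using Fin.induction with
    | zero => exact SuppLE.refl _
    | succ i ih => exact (suppLE_of_fromBlocks (h i)).trans ih
  exact (suppLE_of_fromBlocks hM).trans (key _)

theorem posSemidef_of_iterated_fromBlocks {X M : Matrix n n ℂ} {ℓ : ℕ}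
    {N : Fin (ℓ + 1) → Matrix n n ℂ}
    (hM : (fromBlocks M X X (N (Fin.last ℓ))).PosSemidef)
    (h : ∀ i : Fin ℓ, (fromBlocks X (N i.succ) (N i.succ) (N i.castSucc)).PosSemidef)
    (i : Fin (ℓ + 1)) : (N i).PosSemidef := by
  induction i using Fin.lastCases with
  | last => exact posSemidef_right_of_fromBlocks hM
  | cast i => exact posSemidef_right_of_fromBlocks (h i)

/-- The block inequalities bound `M` from below by a perspective. -/
theorem perspective_le_of_iterated_fromBlocks {X M : Matrix n n ℂ} (hX : X.PosSemidef) {ℓ : ℕ}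
    {N : Fin (ℓ + 1) → Matrix n n ℂ}
    (hM : (fromBlocks M X X (N (Fin.last ℓ))).PosSemidef)
    (h : ∀ i : Fin ℓ, (fromBlocks X (N i.succ) (N i.succ) (N i.castSucc)).PosSemidef) :
    (M - perspective (fun x => x ^ (1 + ((2 : ℝ) ^ ℓ)⁻¹)) X (N 0)).PosSemidef := by
  have hN := posSemidef_of_iterated_fromBlocks hM h
  have hα : 0 < 1 + ((2 : ℝ) ^ ℓ)⁻¹ := by positivity
  have h1 := tendsto_geoMeanPos hX (hN 0) (suppLE_of_iterated_fromBlocks hM h) hα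
  have h2 : Tendsto (fun ε : ℝ => M + (ε : ℂ) • (1 : Matrix n n ℂ)) (𝓝[>] 0) (𝓝 M) := by
    have : Continuous fun ε : ℝ => M + (ε : ℂ) • (1 : Matrix n n ℂ) := by fun_prop
    have h3 := this.tendsto 0
    simp only [Complex.ofReal_zero, zero_smul, add_zero] at h3
    exact h3.mono_left nhdsWithin_le_nhds
  refine isClosed_posSemidef.mem_of_tendsto (h2.sub h1) ?_
  filter_upwards [self_mem_nhdsWithin] with ε hε
  have hε0 : (0 : ℝ) < ε := hε
  have h3 := geoMeanPos_le_of_fromBlocks (posDef_add_smul_one hX hε0)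
    (N := fun i => N i + (ε : ℂ) • 1) (fun i => (posDef_add_smul_one (hN i) hε0).posSemidef)
    (fromBlocks_add_smul_one hM hε0.le) (fun i => fromBlocks_add_smul_one (h i) hε0.le)
  rw [show 1 - (1 + ((2 : ℝ) ^ ℓ)⁻¹) = -((2 : ℝ) ^ ℓ)⁻¹ by ring]
  exact h3

theorem fromBlocks_rdiag_posSemidef (W : Matrix n m ℂ) (u v : m → ℝ) :
    (fromBlocks (W * rdiag (fun i => u i * u i) * Wᴴ) (W * rdiag (fun i => u i * v i) * Wᴴ)
      (W * rdiag (fun i => u i * v i) * Wᴴ) (W * rdiag (fun i => v i * v i) * Wᴴ)).PosSemidef := by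
  have h := fromBlocks_row_posSemidef (W * rdiag u) (W * rdiag v)
  have e : ∀ a b : m → ℝ, (W * rdiag a) * (W * rdiag b)ᴴ = W * rdiag (fun i => a i * b i) * Wᴴ := by
    intro a b
    rw [conjTranspose_mul, (rdiag_isHermitian b).eq, ← rdiag_mul]
    simp only [Matrix.mul_assoc]
  rw [e, e, e, e] at h
  simpa only [mul_comm (v _) (u _)] using h

/-- The perspective solves the block inequalities. -/
theorem exists_iterated_fromBlocks {X Y : Matrix n n ℂ} (hX : X.PosSemidef) (hY : Y.PosSemidef)
    (h : SuppLE X Y) (ℓ : ℕ) :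
    ∃ N : Fin (ℓ + 1) → Matrix n n ℂ, N 0 = Y ∧
      (fromBlocks (perspective (fun x => x ^ (1 + ((2 : ℝ) ^ ℓ)⁻¹)) X Y) X X
        (N (Fin.last ℓ))).PosSemidef ∧
      ∀ i : Fin ℓ, (fromBlocks X (N i.succ) (N i.succ) (N i.castSucc)).PosSemidef := by
  obtain ⟨W, d, hd, hYW, hXW, hf, -⟩ := exists_congr_diag hX hY h
  have hq : ∀ k : ℕ, 0 < ((2 : ℝ) ^ k)⁻¹ ∧ ((2 : ℝ) ^ k)⁻¹ ≤ 1 := fun k =>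
    ⟨by positivity, inv_le_one_of_one_le₀ (one_le_pow₀ (by norm_num))⟩
  -- In the classical coordinates every block inequality becomes a rank-one 2 × 2 condition with
  -- entries u², uv, uv, v². At i = 0 the exponent is 0, and the convention 0^0 = 1 makes N₀ = WWᴴ =
  -- Y even for singular D.
  refine ⟨fun i => W * rdiag (fun j => d j ^ (1 - ((2 : ℝ) ^ (i : ℕ))⁻¹)) * Wᴴ, ?_, ?_, fun i => ?_⟩
  · simp only [Fin.val_zero, pow_zero, inv_one, sub_self, Real.rpow_zero, rdiag_one,
      Matrix.mul_one, hYW]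
  · have h1 := fromBlocks_rdiag_posSemidef W (fun j => d j ^ ((1 + ((2 : ℝ) ^ ℓ)⁻¹) / 2))
      (fun j => d j ^ ((1 - ((2 : ℝ) ^ ℓ)⁻¹) / 2))
    have hl := hq ℓ
    simp only [← Real.rpow_add_of_nonneg (hd _) (show 0 ≤ (1 + ((2 : ℝ) ^ ℓ)⁻¹) / 2 by linarith)
        (show 0 ≤ (1 + ((2 : ℝ) ^ ℓ)⁻¹) / 2 by linarith),
      ← Real.rpow_add_of_nonneg (hd _) (show 0 ≤ (1 + ((2 : ℝ) ^ ℓ)⁻¹) / 2 by linarith)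
        (show 0 ≤ (1 - ((2 : ℝ) ^ ℓ)⁻¹) / 2 by linarith),
      ← Real.rpow_add_of_nonneg (hd _) (show 0 ≤ (1 - ((2 : ℝ) ^ ℓ)⁻¹) / 2 by linarith)
        (show 0 ≤ (1 - ((2 : ℝ) ^ ℓ)⁻¹) / 2 by linarith), add_halves,
      show (1 + ((2 : ℝ) ^ ℓ)⁻¹) / 2 + (1 - ((2 : ℝ) ^ ℓ)⁻¹) / 2 = 1 by ring, Real.rpow_one] at h1
    rw [← hXW] at h1
    rw [hf]
    exact h1
  · have h1 := fromBlocks_rdiag_posSemidef W (fun j => d j ^ ((1 : ℝ) / 2))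
      (fun j => d j ^ ((1 - ((2 : ℝ) ^ (i : ℕ))⁻¹) / 2))
    have hl := hq i
    simp only [← Real.rpow_add_of_nonneg (hd _) (show (0 : ℝ) ≤ 1 / 2 by norm_num)
        (show (0 : ℝ) ≤ 1 / 2 by norm_num),
      ← Real.rpow_add_of_nonneg (hd _) (show (0 : ℝ) ≤ 1 / 2 by norm_num)
        (show 0 ≤ (1 - ((2 : ℝ) ^ (i : ℕ))⁻¹) / 2 by linarith),
      ← Real.rpow_add_of_nonneg (hd _) (show 0 ≤ (1 - ((2 : ℝ) ^ (i : ℕ))⁻¹) / 2 by linarith)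
        (show 0 ≤ (1 - ((2 : ℝ) ^ (i : ℕ))⁻¹) / 2 by linarith), add_halves, Real.rpow_one,
      show (1 : ℝ) / 2 + (1 - ((2 : ℝ) ^ (i : ℕ))⁻¹) / 2 = 1 - ((2 : ℝ) ^ ((i : ℕ) + 1))⁻¹ by
        rw [pow_succ, mul_inv]; ring] at h1
    rw [← hXW] at h1
    simpa only [Fin.val_succ, Fin.val_castSucc] using h1

end SDPBounds

/-! ### Closure properties of semidefinite representable sets -/

section SemidefRep

variable {E E' : Type*} [AddCommGroup E] [Module ℝ E] [AddCommGroup E'] [Module ℝ E']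
variable {n m : Type*} [Fintype n] [DecidableEq n] [Fintype m] [DecidableEq m]

theorem isSemidefRep_of_lmi {κ : Type*} [Fintype κ]
    (F : (E × (κ → ℝ)) →ᵃ[ℝ] Matrix n n ℂ) (hF : ∀ p, (F p).IsHermitian) :
    IsSemidefRep {x | ∃ z, (F (x, z)).PosSemidef} := by
  let e := Fintype.equivFin κ
  let g := Fintype.equivFin n
  refine ⟨Fintype.card κ, Fintype.card n,
    (reindexLinearEquiv ℝ ℂ g g).toLinearMap.toAffineMap.comp
      (F.comp ((AffineMap.id ℝ E).prodMap (LinearMap.funLeft ℝ ℝ e).toAffineMap)),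
    fun p => (hF _).submatrix _, ?_⟩
  ext x
  constructor
  · rintro ⟨z, hz⟩
    refine ⟨z ∘ e.symm, ?_⟩
    have h : (z ∘ e.symm) ∘ e = z := by ext k; simp
    have h1 : (F (x, (z ∘ e.symm) ∘ e)).PosSemidef := by rwa [h]
    exact h1.submatrix g.symm
  · rintro ⟨z, hz⟩
    refine ⟨z ∘ e, ?_⟩
    have h1 : ((F (x, z ∘ e)).submatrix g.symm g.symm).PosSemidef := hz
    have h2 := h1.submatrix g
    rwa [submatrix_submatrix, Equiv.symm_comp_self, submatrix_id_id] at h2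

theorem isSemidefRep_posSemidef (F : E →ᵃ[ℝ] Matrix n n ℂ) (hF : ∀ x, (F x).IsHermitian) :
    IsSemidefRep {x | (F x).PosSemidef} := by
  have h := isSemidefRep_of_lmi (κ := Fin 0) (F.comp AffineMap.fst) fun p => hF p.1
  convert h using 1
  ext x
  exact ⟨fun hx => ⟨0, hx⟩, fun ⟨_, hx⟩ => hx⟩

theorem IsSemidefRep.preimage {S : Set E} (hS : IsSemidefRep S) (g : E' →ᵃ[ℝ] E) :
    IsSemidefRep (g ⁻¹' S) := by
  obtain ⟨k, s, F, hF, rfl⟩ := hS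
  exact ⟨k, s, F.comp (g.prodMap (AffineMap.id ℝ _)), fun p => hF _, rfl⟩

/-- The block diagonal sum as a linear map. -/
def blockDiag₂ (n m : Type*) : (Matrix n n ℂ × Matrix m m ℂ) →ₗ[ℝ] Matrix (n ⊕ m) (n ⊕ m) ℂ where
  toFun p := fromBlocks p.1 0 0 p.2
  map_add' p q := by simp [fromBlocks_add]
  map_smul' c p := by simp [fromBlocks_smul]

/-- Block matrices with equal off-diagonal blocks, as a linear map. -/
def symmBlock (n : Type*) : (Matrix n n ℂ × Matrix n n ℂ) →ₗ[ℝ] Matrix (n ⊕ n) (n ⊕ n) ℂ where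
  toFun p := fromBlocks 0 p.1 p.1 p.2
  map_add' p q := by simp [fromBlocks_add]
  map_smul' c p := by simp [fromBlocks_smul]

theorem fromBlocks_zero_posSemidef_iff {X : Matrix n n ℂ} {Y : Matrix m m ℂ} :
    (fromBlocks X 0 0 Y).PosSemidef ↔ X.PosSemidef ∧ Y.PosSemidef := by
  refine ⟨fun h => ⟨h.submatrix Sum.inl, h.submatrix Sum.inr⟩, fun ⟨hX, hY⟩ => ?_⟩
  have h1 := posSemidef_self_mul_conjTranspose (fromBlocks (sqr X) 0 0 (sqr Y))
  rw [fromBlocks_conjTranspose, fromBlocks_multiply, (sqr_isHermitian X).eq,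
    (sqr_isHermitian Y).eq] at h1
  simpa [sqr_mul_sqr hX, sqr_mul_sqr hY] using h1

theorem IsSemidefRep.inter {S T : Set E} (hS : IsSemidefRep S) (hT : IsSemidefRep T) :
    IsSemidefRep (S ∩ T) := by
  obtain ⟨k, s, F, hF, rfl⟩ := hS
  obtain ⟨k', s', G, hG, rfl⟩ := hT
  have h := isSemidefRep_of_lmi (κ := Fin k ⊕ Fin k')
    ((blockDiag₂ (Fin s) (Fin s')).toAffineMap.comp
      ((F.comp ((AffineMap.id ℝ E).prodMap (LinearMap.funLeft ℝ ℝ Sum.inl).toAffineMap)).prod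
      (G.comp ((AffineMap.id ℝ E).prodMap (LinearMap.funLeft ℝ ℝ Sum.inr).toAffineMap))))
    fun p => (hF _).fromBlocks (by simp) (hG _)
  convert h using 1
  ext x
  constructor
  · rintro ⟨⟨z, hz⟩, w, hw⟩
    exact ⟨Sum.elim z w, fromBlocks_zero_posSemidef_iff.2 ⟨hz, hw⟩⟩
  · rintro ⟨z, hz⟩
    obtain ⟨h1, h2⟩ := fromBlocks_zero_posSemidef_iff.1 hz
    exact ⟨⟨_, h1⟩, _, h2⟩

theorem isSemidefRep_univ : IsSemidefRep (Set.univ : Set E) := by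
  have h := isSemidefRep_posSemidef (n := Fin 0) (0 : E →ᵃ[ℝ] Matrix (Fin 0) (Fin 0) ℂ)
    fun _ => isHermitian_zero
  convert h using 1
  ext x
  exact ⟨fun _ => PosSemidef.zero, fun _ => trivial⟩

theorem IsSemidefRep.iInter {ι : Type*} [Finite ι] {S : ι → Set E}
    (hS : ∀ i, IsSemidefRep (S i)) : IsSemidefRep (⋂ i, S i) := by
  classical
  have := Fintype.ofFinite ι
  have key : ∀ s : Finset ι, IsSemidefRep (⋂ i ∈ s, S i) := fun s => by
    induction s using Finset.induction_on with
    | empty => simpa using isSemidefRep_univ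
    | insert i s _ ih =>
      rw [Finset.set_biInter_insert]
      exact (hS i).inter ih
  simpa using key Finset.univ

/-- Twice the Hermitian part. -/
def hermPart (n : Type*) : Matrix n n ℂ →ₗ[ℝ] Matrix n n ℂ where
  toFun X := X + Xᴴ
  map_add' X Y := by rw [conjTranspose_add]; abel
  map_smul' c X := by simp

/-- Twice the skew-Hermitian part, made Hermitian. -/
noncomputable def skewPart (n : Type*) : Matrix n n ℂ →ₗ[ℝ] Matrix n n ℂ where
  toFun X := Complex.I • (X - Xᴴ)
  map_add' X Y := by rw [conjTranspose_add, ← smul_add]; congr 1; abel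
  map_smul' c X := by rw [conjTranspose_smul, star_trivial, ← smul_sub, smul_comm, RingHom.id_apply]

theorem hermPart_isHermitian (X : Matrix n n ℂ) : (hermPart n X).IsHermitian := by
  change (X + Xᴴ)ᴴ = X + Xᴴ
  rw [conjTranspose_add, conjTranspose_conjTranspose, add_comm]

theorem skewPart_isHermitian (X : Matrix n n ℂ) : (skewPart n X).IsHermitian := by
  change (Complex.I • (X - Xᴴ))ᴴ = Complex.I • (X - Xᴴ)
  rw [conjTranspose_smul, conjTranspose_sub, conjTranspose_conjTranspose, RCLike.star_def,
    Complex.conj_I, neg_smul, ← smul_neg, neg_sub]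

theorem eq_zero_iff_posSemidef {X : Matrix n n ℂ} : X = 0 ↔ X.PosSemidef ∧ (-X).PosSemidef := by
  refine ⟨by rintro rfl; simpa using PosSemidef.zero, fun ⟨h1, h2⟩ => ?_⟩
  refine Matrix.ext_of_mulVec_single fun i => ?_
  rw [zero_mulVec]
  refine (h1.dotProduct_mulVec_zero_iff _).1 (le_antisymm ?_ (h1.dotProduct_mulVec_nonneg _))
  have := h2.dotProduct_mulVec_nonneg (Pi.single i 1)
  rwa [neg_mulVec, dotProduct_neg, Left.nonneg_neg_iff] at this

/-- A Hermitian equation is the pair of inequalities F ≥ 0 and -F ≥ 0. -/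
theorem isSemidefRep_eq_zero (F : E →ᵃ[ℝ] Matrix n n ℂ) (hF : ∀ x, (F x).IsHermitian) :
    IsSemidefRep {x | F x = 0} := by
  have h := (isSemidefRep_posSemidef F hF).inter
    (isSemidefRep_posSemidef (-F) fun x => (hF x).neg)
  convert h using 1
  ext x
  exact eq_zero_iff_posSemidef

/-- The program variables are arbitrary complex matrices, while a linear matrix inequality must be
Hermitian at every point. Hermiticity is therefore imposed as the vanishing of i(X - Xᴴ), which is
always Hermitian. -/
theorem isSemidefRep_isHermitian : IsSemidefRep {X : Matrix n n ℂ | X.IsHermitian} := by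
  convert isSemidefRep_eq_zero (skewPart n).toAffineMap skewPart_isHermitian using 1
  ext X
  change Xᴴ = X ↔ Complex.I • (X - Xᴴ) = 0
  rw [smul_eq_zero_iff_right Complex.I_ne_zero, sub_eq_zero, eq_comm]

theorem isSemidefRep_singleton_zero : IsSemidefRep {X : Matrix n n ℂ | X = 0} := by
  convert isSemidefRep_isHermitian.inter
    (isSemidefRep_eq_zero (hermPart n).toAffineMap hermPart_isHermitian) using 1
  ext X
  change X = 0 ↔ Xᴴ = X ∧ X + Xᴴ = 0
  refine ⟨by rintro rfl; simp, fun ⟨h1, h2⟩ => ?_⟩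
  rw [h1, ← two_smul ℂ] at h2
  exact (smul_eq_zero_iff_right two_ne_zero).1 h2

/-- X + Xᴴ is Hermitian for every X and equals 2X on the Hermitian matrices. -/
theorem isSemidefRep_setOf_posSemidef : IsSemidefRep {X : Matrix n n ℂ | X.PosSemidef} := by
  convert isSemidefRep_isHermitian.inter
    (isSemidefRep_posSemidef (hermPart n).toAffineMap hermPart_isHermitian) using 1
  ext X
  change X.PosSemidef ↔ Xᴴ = X ∧ (X + Xᴴ).PosSemidef
  refine ⟨fun h => ⟨h.1, h.add h.conjTranspose⟩, fun ⟨h1, h2⟩ => ?_⟩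
  rw [h1] at h2
  have h3 := smul_posSemidef h2 (t := 2⁻¹) (by norm_num)
  have h4 : (((2⁻¹ : ℝ) : ℂ)) • (X + X) = X := by
    rw [← two_smul ℂ X, smul_smul]; norm_num
  rwa [h4] at h3

/-- Preimages under a translated linear map. -/
theorem IsSemidefRep.preimage_add {S : Set E} (hS : IsSemidefRep S) (L : E' →ₗ[ℝ] E) (c : E) :
    IsSemidefRep {x | L x + c ∈ S} :=
  hS.preimage (L.toAffineMap + AffineMap.const ℝ E' c)

theorem IsSemidefRep.preimage_linear {S : Set E} (hS : IsSemidefRep S) (L : E' →ₗ[ℝ] E) :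
    IsSemidefRep {x | L x ∈ S} :=
  hS.preimage L.toAffineMap

end SemidefRep

/-! ### The program -/

section Program

variable {A B : Type*} [Fintype A] [DecidableEq A] [Fintype B] [DecidableEq B]

/-- The inverse of the Choi isomorphism. -/
def unchoi (J : Matrix (A × B) (A × B) ℂ) : Matrix A A ℂ →ₗ[ℂ] Matrix B B ℂ where
  toFun X := Matrix.of fun b b' => ∑ a, ∑ a', X a a' * J (a, b) (a', b')
  map_add' X Y := by
    ext b b'
    simp [add_mul, Finset.sum_add_distrib]
  map_smul' c X := by
    ext b b'
    simp [Finset.mul_sum, mul_assoc]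

/-- The inverse of the Choi isomorphism as a linear map. -/
def unchoiLin (A B : Type*) [Fintype A] [DecidableEq A] [Fintype B] [DecidableEq B] :
    Matrix (A × B) (A × B) ℂ →ₗ[ℝ] (Matrix A A ℂ →ₗ[ℂ] Matrix B B ℂ) where
  toFun := unchoi
  map_add' J K := by
    ext X b b'
    simp [unchoi, mul_add, Finset.sum_add_distrib]
  map_smul' c J := by
    ext X b b'
    simp [unchoi, Finset.mul_sum, mul_left_comm]

theorem choi_unchoi (J : Matrix (A × B) (A × B) ℂ) : choi (unchoi J) = J := by
  ext p q
  rw [choi_apply]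
  simp [unchoi, Matrix.single_apply, ite_and]

theorem choi_injective : Function.Injective
    (choi : (Matrix A A ℂ →ₗ[ℂ] Matrix B B ℂ) → Matrix (A × B) (A × B) ℂ) := by
  intro N M h
  refine LinearMap.ext fun X => ?_
  rw [matrix_eq_sum_single X]
  simp only [map_sum]
  refine Finset.sum_congr rfl fun a _ => Finset.sum_congr rfl fun a' _ => ?_
  have h1 : N (Matrix.single a a' 1) = M (Matrix.single a a' 1) := by
    ext b b'
    have := congrFun (congrFun h (a, b)) (a', b')
    rwa [choi_apply, choi_apply] at this
  have h2 : Matrix.single a a' (X a a') = X a a' • Matrix.single a a' (1 : ℂ) := by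
    rw [Matrix.smul_single, smul_eq_mul, mul_one]
  rw [h2, map_smul, map_smul, h1]

/-- The constraint on the Choi variable thereby becomes a linear preimage of V. -/
theorem exists_choi_eq_iff {V : Set (Matrix A A ℂ →ₗ[ℂ] Matrix B B ℂ)}
    {J : Matrix (A × B) (A × B) ℂ} : (∃ 𝓜 ∈ V, choi 𝓜 = J) ↔ unchoi J ∈ V := by
  constructor
  · rintro ⟨𝓜, h, rfl⟩
    rwa [choi_injective (choi_unchoi (choi 𝓜))]
  · exact fun h => ⟨_, h, choi_unchoi J⟩

/-- The matrix `y 1 - tr_B X` as a linear map of `y` and `X`. -/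
def subTrRight (A B : Type*) [DecidableEq A] [Fintype B] :
    (ℝ × Matrix (A × B) (A × B) ℂ) →ₗ[ℝ] Matrix A A ℂ where
  toFun p := (p.1 : ℂ) • (1 : Matrix A A ℂ) - trRight p.2
  map_add' p q := by
    ext a a'
    simp [trRight, Finset.sum_add_distrib, add_mul]
    ring
  map_smul' c p := by
    ext a a'
    simp [trRight, Finset.mul_sum, mul_assoc, mul_sub]

/-- The feasible set of the program is semidefinite representable. -/
theorem isSemidefRep_programFeasible (ℓ : ℕ) (N : Matrix A A ℂ →ₗ[ℂ] Matrix B B ℂ)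
    {V : Set (Matrix A A ℂ →ₗ[ℂ] Matrix B B ℂ)} (hV : IsSemidefRep V) :
    IsSemidefRep (programFeasible ℓ N V) := by
  let l1 : ProgramVars A B ℓ →ₗ[ℝ] Matrix (A × B) (A × B) ℂ := LinearMap.fst ℝ _ _
  let lN : Fin (ℓ + 1) → ProgramVars A B ℓ →ₗ[ℝ] Matrix (A × B) (A × B) ℂ := fun i =>
    LinearMap.proj i ∘ₗ LinearMap.fst ℝ _ _ ∘ₗ LinearMap.snd ℝ _ _
  let lJ : ProgramVars A B ℓ →ₗ[ℝ] Matrix (A × B) (A × B) ℂ :=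
    LinearMap.fst ℝ _ _ ∘ₗ LinearMap.snd ℝ _ _ ∘ₗ LinearMap.snd ℝ _ _
  let ly : ProgramVars A B ℓ →ₗ[ℝ] ℝ :=
    LinearMap.snd ℝ _ _ ∘ₗ LinearMap.snd ℝ _ _ ∘ₗ LinearMap.snd ℝ _ _
  let lM := blockDiag₂ (A × B) (A × B) ∘ₗ l1.prod (lN (Fin.last ℓ))
  let lB := fun i : Fin ℓ => symmBlock (A × B) ∘ₗ (lN i.succ).prod (lN i.castSucc)
  let lT := subTrRight A B ∘ₗ ly.prod l1
  have h := ((isSemidefRep_isHermitian (n := A × B)).preimage_linear l1).inter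
    ((IsSemidefRep.iInter fun i => (isSemidefRep_isHermitian (n := A × B)).preimage_linear
      (lN i)).inter
    (((isSemidefRep_isHermitian (n := A × B)).preimage_linear lJ).inter
    (((isSemidefRep_setOf_posSemidef (n := (A × B) ⊕ (A × B))).preimage_add lM
      (fromBlocks 0 (choi N) (choi N) 0)).inter
    ((IsSemidefRep.iInter fun i => (isSemidefRep_setOf_posSemidef
      (n := (A × B) ⊕ (A × B))).preimage_add (lB i) (fromBlocks (choi N) 0 0 0)).inter
    (((isSemidefRep_singleton_zero (n := A × B)).preimage_linear (lN 0 - lJ)).inter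
    (((isSemidefRep_setOf_posSemidef (n := A)).preimage_linear lT).inter
    (hV.preimage_linear (unchoiLin A B ∘ₗ lJ))))))))
  convert h using 1
  ext ⟨M, Ns, J, y⟩
  have e1 : fromBlocks M 0 0 (Ns (Fin.last ℓ)) + fromBlocks 0 (choi N) (choi N) 0 =
      fromBlocks M (choi N) (choi N) (Ns (Fin.last ℓ)) := by simp [fromBlocks_add]
  have e2 : ∀ i : Fin ℓ, (fromBlocks 0 (Ns i.succ) (Ns i.succ) (Ns i.castSucc) +
      fromBlocks (choi N) 0 0 0) =
      fromBlocks (choi N) (Ns i.succ) (Ns i.succ) (Ns i.castSucc) := fun i => by simp [fromBlocks_add]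
  simp only [programFeasible, Set.mem_inter_iff, Set.mem_iInter, Set.mem_ofPred_eq,
    exists_choi_eq_iff, ← e1, ← e2]
  rfl

end Program

/-! ### The optimal value -/

section OptimalValue

variable {A B : Type*} [Fintype A] [DecidableEq A] [Fintype B] [DecidableEq B]

theorem nonneg_of_smul_one_sub_posSemidef [Nonempty A] {S : Matrix A A ℂ} (hS : S.PosSemidef)
    {t : ℝ} (h : ((t : ℂ) • 1 - S).PosSemidef) : 0 ≤ t := by
  have h1 := h.add hS
  rw [sub_add_cancel] at h1
  obtain ⟨a⟩ := ‹Nonempty A›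
  have h2 := (h1.diag_nonneg (i := a))
  rw [Matrix.smul_apply, Matrix.one_apply_eq, smul_eq_mul, mul_one] at h2
  exact_mod_cast h2

/-- The feasible objective values in closed form. -/
theorem mem_programValues_iff [Nonempty A] {ℓ : ℕ} {N : Matrix A A ℂ →ₗ[ℂ] Matrix B B ℂ}
    (hN : IsChannel N) {V : Set (Matrix A A ℂ →ₗ[ℂ] Matrix B B ℂ)}
    (hV : ∀ M ∈ V, IsSubchannel M) {y : ℝ} :
    y ∈ programValues ℓ N V ↔ ∃ M ∈ V, SuppLE (choi N) (choi M) ∧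
      opNorm (trRight (perspective (fun x => x ^ (1 + ((2 : ℝ) ^ ℓ)⁻¹)) (choi N) (choi M))) ≤ y := by
  have hJ := hN.1.choi_posSemidef
  have hG : ∀ Y : Matrix (A × B) (A × B) ℂ,
      (perspective (fun x => x ^ (1 + ((2 : ℝ) ^ ℓ)⁻¹)) (choi N) Y).PosSemidef :=
    perspective_posSemidef (fun x hx => Real.rpow_nonneg hx _) hJ
  constructor
  · rintro ⟨⟨M, Ns, J, y'⟩, ⟨-, -, -, h1, h2, h3, h4, 𝓜, h𝓜, rfl⟩, rfl⟩
    have h0 := sub_eq_zero.1 h3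
    refine ⟨𝓜, h𝓜, h0 ▸ suppLE_of_iterated_fromBlocks h1 h2, ?_⟩
    -- Tracing out B, the constraint on y and the bound on M add up to y·1 ≥ tr_B of the
    -- perspective.
    have h5 := trRight_posSemidef (perspective_le_of_iterated_fromBlocks hJ h1 h2)
    rw [trRight_sub, h0] at h5
    have h6 := h4.add h5
    rw [sub_add_sub_cancel] at h6
    have hp := trRight_posSemidef (hG (choi 𝓜))
    exact (opNorm_le_iff hp (nonneg_of_smul_one_sub_posSemidef hp h6)).2 h6
  · rintro ⟨𝓜, h𝓜, hs, hy⟩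
    have hK := (hV _ h𝓜).1.choi_posSemidef
    obtain ⟨Ns, h0, h1, h2⟩ := exists_iterated_fromBlocks hJ hK hs ℓ
    have hp := trRight_posSemidef (hG (choi 𝓜))
    exact ⟨(_, Ns, choi 𝓜, y), ⟨(hG _).1, fun i => (posSemidef_of_iterated_fromBlocks h1 h2 i).1,
      hK.1, h1, h2, sub_eq_zero.2 h0,
      (opNorm_le_iff hp ((opNorm_nonneg _).trans hy)).1 hy, 𝓜, h𝓜, rfl⟩, rfl⟩

theorem one_add_inv_two_pow_mem (ℓ : ℕ) : 1 + ((2 : ℝ) ^ ℓ)⁻¹ ∈ Set.Ioc (1 : ℝ) 2 := by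
  have h1 : 0 < ((2 : ℝ) ^ ℓ)⁻¹ := by positivity
  have h2 : ((2 : ℝ) ^ ℓ)⁻¹ ≤ 1 := inv_le_one_of_one_le₀ (one_le_pow₀ (by norm_num))
  constructor <;> linarith

theorem one_le_of_mem_programValues [Nonempty A] {ℓ : ℕ} {N : Matrix A A ℂ →ₗ[ℂ] Matrix B B ℂ}
    (hN : IsChannel N) {V : Set (Matrix A A ℂ →ₗ[ℂ] Matrix B B ℂ)}
    (hV : ∀ M ∈ V, IsSubchannel M) {y : ℝ} (hy : y ∈ programValues ℓ N V) : 1 ≤ y := by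
  obtain ⟨M, hM, hs, h⟩ := (mem_programValues_iff hN hV).1 hy
  exact (one_le_opNorm hN (hV M hM) hs (one_add_inv_two_pow_mem ℓ)).trans h

theorem opNorm_mem_programValues [Nonempty A] {ℓ : ℕ} {N : Matrix A A ℂ →ₗ[ℂ] Matrix B B ℂ}
    (hN : IsChannel N) {V : Set (Matrix A A ℂ →ₗ[ℂ] Matrix B B ℂ)}
    (hV : ∀ M ∈ V, IsSubchannel M) {M : Matrix A A ℂ →ₗ[ℂ] Matrix B B ℂ} (hM : M ∈ V)
    (hs : SuppLE (choi N) (choi M)) :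
    opNorm (trRight (perspective (fun x => x ^ (1 + ((2 : ℝ) ^ ℓ)⁻¹)) (choi N) (choi M))) ∈
      programValues ℓ N V :=
  (mem_programValues_iff hN hV).2 ⟨M, hM, hs, le_rfl⟩

theorem geoRenyiChannel_eq_two_pow_mul [Nonempty A] (ℓ : ℕ) {N M : Matrix A A ℂ →ₗ[ℂ] Matrix B B ℂ}
    (hN : IsChannel N) (hM : IsSubchannel M) (h : SuppLE (choi N) (choi M)) :
    geoRenyiChannel (1 + ((2 : ℝ) ^ ℓ)⁻¹) N M = (((2 : ℝ) ^ ℓ * Real.logb 2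
      (opNorm (trRight (perspective (fun x => x ^ (1 + ((2 : ℝ) ^ ℓ)⁻¹)) (choi N) (choi M)))) : ℝ)
        : EReal) := by
  rw [geoRenyiChannel_eq hN hM h (one_add_inv_two_pow_mem ℓ), add_sub_cancel_left, one_div, inv_inv]

theorem two_pow_mul_logb_le (ℓ : ℕ) {x y : ℝ} (hx : 1 ≤ x) (h : x ≤ y) :
    (((2 : ℝ) ^ ℓ * Real.logb 2 x : ℝ) : EReal) ≤ (((2 : ℝ) ^ ℓ * Real.logb 2 y : ℝ) : EReal) := by
  rw [EReal.coe_le_coe_iff]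
  exact mul_le_mul_of_nonneg_left (Real.logb_le_logb_of_le (by norm_num) (by linarith) h)
    (by positivity)

/-- A feasible objective value bounds the divergence to some element of `V`. -/
theorem exists_geoRenyiChannel_le [Nonempty A] {ℓ : ℕ} {N : Matrix A A ℂ →ₗ[ℂ] Matrix B B ℂ}
    (hN : IsChannel N) {V : Set (Matrix A A ℂ →ₗ[ℂ] Matrix B B ℂ)}
    (hV : ∀ M ∈ V, IsSubchannel M) {y : ℝ} (hy : y ∈ programValues ℓ N V) :
    ∃ M ∈ V, geoRenyiChannel (1 + ((2 : ℝ) ^ ℓ)⁻¹) N M ≤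
      (((2 : ℝ) ^ ℓ * Real.logb 2 y : ℝ) : EReal) := by
  obtain ⟨M, hM, hs, h⟩ := (mem_programValues_iff hN hV).1 hy
  refine ⟨M, hM, ?_⟩
  rw [geoRenyiChannel_eq_two_pow_mul ℓ hN (hV M hM) hs]
  exact two_pow_mul_logb_le ℓ (one_le_opNorm hN (hV M hM) hs (one_add_inv_two_pow_mem ℓ)) h

/-- A lower bound on the objective values bounds the divergences. -/
theorem le_geoRenyiChannel_of_mem_lowerBounds [Nonempty A] {ℓ : ℕ}
    {N : Matrix A A ℂ →ₗ[ℂ] Matrix B B ℂ}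
    (hN : IsChannel N) {V : Set (Matrix A A ℂ →ₗ[ℂ] Matrix B B ℂ)}
    (hV : ∀ M ∈ V, IsSubchannel M) {y : ℝ} (hy1 : 1 ≤ y) (hy : y ∈ lowerBounds (programValues ℓ N V))
    {M : Matrix A A ℂ →ₗ[ℂ] Matrix B B ℂ} (hM : M ∈ V) :
    (((2 : ℝ) ^ ℓ * Real.logb 2 y : ℝ) : EReal) ≤ geoRenyiChannel (1 + ((2 : ℝ) ^ ℓ)⁻¹) N M := by
  by_cases hs : SuppLE (choi N) (choi M)
  · rw [geoRenyiChannel_eq_two_pow_mul ℓ hN (hV M hM) hs]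
    exact two_pow_mul_logb_le ℓ hy1 (hy (opNorm_mem_programValues hN hV hM hs))
  · rw [geoRenyiChannel_eq_top hs]
    exact le_top

theorem iInf_geoRenyiChannel_eq [Nonempty A] {ℓ : ℕ} {N : Matrix A A ℂ →ₗ[ℂ] Matrix B B ℂ}
    (hN : IsChannel N) {V : Set (Matrix A A ℂ →ₗ[ℂ] Matrix B B ℂ)}
    (hV : ∀ M ∈ V, IsSubchannel M) (hne : (programValues ℓ N V).Nonempty) :
    ⨅ M ∈ V, geoRenyiChannel (1 + ((2 : ℝ) ^ ℓ)⁻¹) N M =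
      (((2 : ℝ) ^ ℓ * Real.logb 2 (sInf (programValues ℓ N V)) : ℝ) : EReal) := by
  have hbdd : BddBelow (programValues ℓ N V) := ⟨1, fun y => one_le_of_mem_programValues hN hV⟩
  have h1 : 1 ≤ sInf (programValues ℓ N V) :=
    le_csInf hne fun y => one_le_of_mem_programValues hN hV
  refine le_antisymm ?_ (le_iInf₂ fun M hM => le_geoRenyiChannel_of_mem_lowerBounds hN hV h1
    (fun y hy => csInf_le hbdd hy) hM)
  obtain ⟨y, -, hy, hmem⟩ := exists_seq_tendsto_sInf hne hbdd
  have h2 : Tendsto (fun k => (((2 : ℝ) ^ ℓ * Real.logb 2 (y k) : ℝ) : EReal)) atTop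
      (𝓝 (((2 : ℝ) ^ ℓ * Real.logb 2 (sInf (programValues ℓ N V)) : ℝ) : EReal)) := by
    refine (continuous_coe_real_ereal.tendsto _).comp (Tendsto.const_mul _ ?_)
    -- Objective values are at least 1, so log is continuous at their infimum and commutes with it.
    have h3 : ContinuousAt (Real.logb 2) (sInf (programValues ℓ N V)) := by
      have := (Real.continuousAt_log (show sInf (programValues ℓ N V) ≠ 0 by linarith)).div_const
        (Real.log 2)
      exact this
    exact h3.tendsto.comp hy
  refine ge_of_tendsto' h2 fun k => ?_
  obtain ⟨M, hM, h⟩ := exists_geoRenyiChannel_le hN hV (hmem k)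
  exact (iInf₂_le M hM).trans h

theorem geoRenyiChannel_eq_top_of_infeasible [Nonempty A] {ℓ : ℕ}
    {N : Matrix A A ℂ →ₗ[ℂ] Matrix B B ℂ}
    (hN : IsChannel N) {V : Set (Matrix A A ℂ →ₗ[ℂ] Matrix B B ℂ)}
    (hV : ∀ M ∈ V, IsSubchannel M) (hne : ¬ (programValues ℓ N V).Nonempty)
    {M : Matrix A A ℂ →ₗ[ℂ] Matrix B B ℂ} (hM : M ∈ V) (α : ℝ) : geoRenyiChannel α N M = ⊤ :=
  geoRenyiChannel_eq_top (fun hs => hne ⟨_, opNorm_mem_programValues hN hV hM hs⟩) α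

end OptimalValue

/-! ### Attainment -/

section Attainment

variable {n : Type*} [Fintype n] [DecidableEq n]

theorem isCompact_matrix_norm_le (n : Type*) [Finite n] (c : ℝ) :
    IsCompact {X : Matrix n n ℂ | ∀ i j, ‖X i j‖ ≤ c} := by
  have h := isCompact_univ_pi (X := fun _ : n => n → ℂ) fun _ =>
    isCompact_univ_pi (X := fun _ : n => ℂ) fun _ => isCompact_closedBall (0 : ℂ) c
  have e : {X : Matrix n n ℂ | ∀ i j, ‖X i j‖ ≤ c} = Set.pi Set.univ fun _ : n =>
      Set.pi Set.univ fun _ : n => Metric.closedBall (0 : ℂ) c := by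
    ext X
    exact ⟨fun h i _ j _ => mem_closedBall_zero_iff.2 (h i j),
      fun h i j => mem_closedBall_zero_iff.1 (h i trivial j trivial)⟩
  rw [e]
  exact h

/-- Entries are inner products of rows of the square root, whose squared norms are the diagonal
entries. -/
theorem Matrix.PosSemidef.norm_apply_le_trace {X : Matrix n n ℂ} (hX : X.PosSemidef) (i j : n) :
    ‖X i j‖ ≤ X.trace.re := by
  set S := sqr X with hS
  have hSS : S * Sᴴ = X := by rw [(sqr_isHermitian _).eq, sqr_mul_sqr hX]
  have hrow : ∀ i, ∑ k, ‖S i k‖ ^ 2 = (X i i).re := by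
    intro i
    rw [← hSS, mul_apply, Complex.re_sum]
    refine Finset.sum_congr rfl fun k _ => ?_
    rw [conjTranspose_apply, RCLike.star_def, Complex.mul_conj, Complex.ofReal_re,
      Complex.normSq_eq_norm_sq]
  have hd : ∀ i, 0 ≤ (X i i).re := fun i => by rw [← hrow]; positivity
  have hle : ∀ i, (X i i).re ≤ X.trace.re := fun i => by
    rw [Matrix.trace, Complex.re_sum]
    exact Finset.single_le_sum (f := fun i => (X i i).re) (fun i _ => hd i) (Finset.mem_univ i)
  have h1 : ‖X i j‖ ≤ ∑ k, ‖S i k‖ * ‖S j k‖ := by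
    rw [← hSS, mul_apply]
    refine (norm_sum_le _ _).trans (le_of_eq (Finset.sum_congr rfl fun k _ => ?_))
    rw [conjTranspose_apply, norm_mul, norm_star]
  have h2 : ∑ k, ‖S i k‖ * ‖S j k‖ ≤ ∑ k, (‖S i k‖ ^ 2 + ‖S j k‖ ^ 2) / 2 :=
    Finset.sum_le_sum fun k _ => by nlinarith [two_mul_le_add_sq ‖S i k‖ ‖S j k‖]
  rw [← Finset.sum_div, Finset.sum_add_distrib, hrow, hrow] at h2
  linarith [hle i, hle j]

theorem trace_re_le_card_mul {X : Matrix n n ℂ} {c : ℝ} (h : ∀ i j, ‖X i j‖ ≤ c) :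
    X.trace.re ≤ Fintype.card n * c := by
  rw [Matrix.trace, Complex.re_sum]
  refine (Finset.sum_le_sum fun i _ => (Complex.re_le_norm _).trans (h i i)).trans (le_of_eq ?_)
  simp

theorem trace_fromBlocks_re (X Y Z : Matrix n n ℂ) :
    (fromBlocks X Y Y Z).trace.re = X.trace.re + Z.trace.re := by
  simp [Matrix.trace, Fintype.sum_sum_type]

variable {A B : Type*} [Fintype A] [DecidableEq A] [Fintype B] [DecidableEq B]

theorem trace_choi (M : Matrix A A ℂ →ₗ[ℂ] Matrix B B ℂ) :
    (choi M).trace = ∑ a, (M (Matrix.single a a 1)).trace := by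
  simp only [Matrix.trace, diag_apply, Fintype.sum_prod_type, choi_apply]

theorem IsSubchannel.trace_choi_le {M : Matrix A A ℂ →ₗ[ℂ] Matrix B B ℂ} (hM : IsSubchannel M) :
    (choi M).trace.re ≤ Fintype.card A := by
  rw [trace_choi, Complex.re_sum]
  have h : ∀ a : A, (M (Matrix.single a a 1)).trace.re ≤ 1 := fun a => by
    have hp : (Matrix.single a a (1 : ℂ)).PosSemidef := by
      have := posSemidef_self_mul_conjTranspose (Matrix.single a a (1 : ℂ))
      rwa [conjTranspose_single, star_one, single_mul_single_same, one_mul] at this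
    refine (hM.2 _ hp).trans (le_of_eq ?_)
    rw [trace_single_eq_same, Complex.one_re]
  exact (Finset.sum_le_sum fun a _ => h a).trans (le_of_eq (by simp))

theorem isClosed_forall_mem {ι X : Type*} [TopologicalSpace X] {S : ι → Set X}
    (h : ∀ i, IsClosed (S i)) : IsClosed {x | ∀ i, x ∈ S i} := by
  rw [← Set.iInter_ofPred]
  exact isClosed_iInter h

theorem isClosed_programFeasible (ℓ : ℕ) (N : Matrix A A ℂ →ₗ[ℂ] Matrix B B ℂ)
    {V : Set (Matrix A A ℂ →ₗ[ℂ] Matrix B B ℂ)} (hV : IsClosed (choi '' V)) :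
    IsClosed (programFeasible ℓ N V) := by
  have hH : IsClosed {X : Matrix (A × B) (A × B) ℂ | X.IsHermitian} :=
    isClosed_eq (f := fun X : Matrix (A × B) (A × B) ℂ => Xᴴ) (by fun_prop) continuous_id
  have hP := isClosed_posSemidef (n := (A × B) ⊕ (A × B))
  have c1 : Continuous fun p : ProgramVars A B ℓ => p.1 := continuous_fst
  have cN : ∀ i, Continuous fun p : ProgramVars A B ℓ => p.2.1 i := fun i =>
    (continuous_apply i).comp (continuous_fst.comp continuous_snd)
  have cJ : Continuous fun p : ProgramVars A B ℓ => p.2.2.1 :=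
    continuous_fst.comp (continuous_snd.comp continuous_snd)
  have cy : Continuous fun p : ProgramVars A B ℓ => p.2.2.2 :=
    continuous_snd.comp (continuous_snd.comp continuous_snd)
  have ct : Continuous fun p : ProgramVars A B ℓ =>
      (p.2.2.2 : ℂ) • (1 : Matrix A A ℂ) - trRight p.1 := by
    refine ((Complex.continuous_ofReal.comp cy).smul continuous_const).sub ?_
    refine continuous_matrix fun a a' => ?_
    simp only [trRight, of_apply]
    exact continuous_finsetSum _ fun b _ => c1.matrix_elem _ _
  exact (hH.preimage c1).inter
    ((isClosed_forall_mem fun i => hH.preimage (cN i)).inter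
    ((hH.preimage cJ).inter
    ((hP.preimage (c1.matrix_fromBlocks continuous_const continuous_const (cN _))).inter
    ((isClosed_forall_mem fun i => hP.preimage
      (continuous_const.matrix_fromBlocks (cN _) (cN _) (cN _))).inter
    ((isClosed_singleton.preimage ((cN 0).sub cJ)).inter
    ((isClosed_posSemidef.preimage ct).inter (hV.preimage cJ)))))))

/-- Feasible points of bounded objective value have bounded entries. -/
theorem programFeasible_subset (ℓ : ℕ) {N : Matrix A A ℂ →ₗ[ℂ] Matrix B B ℂ}
    {V : Set (Matrix A A ℂ →ₗ[ℂ] Matrix B B ℂ)} (hV : ∀ M ∈ V, IsSubchannel M) (y₀ : ℝ) :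
    ∃ (c : ℝ) (d : Fin (ℓ + 1) → ℝ), ∀ M Ns J y, (M, Ns, J, y) ∈ programFeasible ℓ N V → y ≤ y₀ →
      (∀ i j, ‖M i j‖ ≤ c) ∧ (∀ k i j, ‖Ns k i j‖ ≤ d k) ∧ ∀ i j, ‖J i j‖ ≤ Fintype.card A := by
  have hJ : ∀ M Ns J y, (M, Ns, J, y) ∈ programFeasible ℓ N V → y ≤ y₀ →
      ∀ i j, ‖J i j‖ ≤ Fintype.card A := by
    rintro M Ns J y ⟨-, -, -, h1, h2, h3, h4, 𝓜, h𝓜, rfl⟩ - i j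
    exact ((hV _ h𝓜).1.choi_posSemidef.norm_apply_le_trace i j).trans (hV _ h𝓜).trace_choi_le
  have hN : ∀ k, ∃ d : ℝ, ∀ M Ns J y, (M, Ns, J, y) ∈ programFeasible ℓ N V → y ≤ y₀ →
      ∀ i j, ‖Ns k i j‖ ≤ d := by
    intro k
    induction k using Fin.induction with
    | zero =>
      refine ⟨Fintype.card A, fun M Ns J y hp hy i j => ?_⟩
      have h3 := hp.2.2.2.2.2.1
      rw [sub_eq_zero.1 h3]
      exact hJ M Ns J y hp hy i j
    | succ k ih =>
      obtain ⟨d, hd⟩ := ih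
      refine ⟨(choi N).trace.re + Fintype.card (A × B) * d, fun M Ns J y hp hy i j => ?_⟩
      -- N_{k+1} is an off-diagonal block of a positive matrix whose diagonal blocks are the fixed
      -- Choi matrix and the already bounded N_k.
      have h2 := (hp.2.2.2.2.1 k).norm_apply_le_trace (Sum.inl i) (Sum.inr j)
      rw [trace_fromBlocks_re, fromBlocks_apply₁₂] at h2
      exact h2.trans (add_le_add le_rfl (trace_re_le_card_mul (hd M Ns J y hp hy)))
  choose d hd using hN
  refine ⟨y₀ * Fintype.card A, d, fun M Ns J y hp hy =>
    ⟨fun i j => ?_, fun k => hd k M Ns J y hp hy, hJ M Ns J y hp hy⟩⟩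
  have hM := posSemidef_left_of_fromBlocks hp.2.2.2.1
  have ht := (Complex.le_def.1 hp.2.2.2.2.2.2.1.trace_nonneg).1
  rw [trace_sub, trace_smul, trace_one, trace_trRight, smul_eq_mul, Complex.sub_re,
    Complex.re_ofReal_mul, Complex.natCast_re, Complex.zero_re] at ht
  have hy' : y * Fintype.card A ≤ y₀ * Fintype.card A :=
    mul_le_mul_of_nonneg_right hy (Nat.cast_nonneg _)
  linarith [hM.norm_apply_le_trace i j]

/-- The program attains its minimum if `V` is closed. -/
theorem exists_isLeast_programValues [Nonempty A] {ℓ : ℕ} {N : Matrix A A ℂ →ₗ[ℂ] Matrix B B ℂ}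
    (hN : IsChannel N) {V : Set (Matrix A A ℂ →ₗ[ℂ] Matrix B B ℂ)}
    (hV : ∀ M ∈ V, IsSubchannel M) (hcl : IsClosed (choi '' V))
    (hne : (programValues ℓ N V).Nonempty) : ∃ y, IsLeast (programValues ℓ N V) y := by
  obtain ⟨y₀, hy₀⟩ := hne
  obtain ⟨c, d, hcd⟩ := programFeasible_subset ℓ (N := N) hV y₀
  have cy : Continuous fun p : ProgramVars A B ℓ => p.2.2.2 :=
    continuous_snd.comp (continuous_snd.comp continuous_snd)
  have hK : IsCompact ({X : Matrix (A × B) (A × B) ℂ | ∀ i j, ‖X i j‖ ≤ c} ×ˢ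
      ((Set.pi Set.univ fun k => {X : Matrix (A × B) (A × B) ℂ | ∀ i j, ‖X i j‖ ≤ d k}) ×ˢ
      ({X : Matrix (A × B) (A × B) ℂ | ∀ i j, ‖X i j‖ ≤ Fintype.card A} ×ˢ Set.Icc 1 y₀))) :=
    (isCompact_matrix_norm_le _ _).prod ((isCompact_univ_pi fun k =>
      isCompact_matrix_norm_le _ _).prod ((isCompact_matrix_norm_le _ _).prod isCompact_Icc))
  -- The sublevel set of one feasible value is closed and bounded, so the continuous objective
  -- attains its minimum there.
  have hS : IsCompact (programFeasible ℓ N V ∩ {p | p.2.2.2 ≤ y₀}) := by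
    refine hK.of_isClosed_subset ((isClosed_programFeasible ℓ N hcl).inter
      (isClosed_Iic.preimage cy)) ?_
    rintro ⟨M, Ns, J, y⟩ ⟨hp, hy⟩
    obtain ⟨h1, h2, h3⟩ := hcd M Ns J y hp hy
    exact ⟨h1, fun k _ => h2 k, h3, one_le_of_mem_programValues hN hV ⟨_, hp, rfl⟩, hy⟩
  obtain ⟨p₀, hp₀, rfl⟩ := hy₀
  obtain ⟨y, ⟨p, hp, rfl⟩, hmin⟩ := (hS.image cy).exists_isLeast ⟨_, p₀, ⟨hp₀, le_refl p₀.2.2.2⟩, rfl⟩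
  refine ⟨_, ⟨p, hp.1, rfl⟩, ?_⟩
  rintro _ ⟨q, hq, rfl⟩
  rcases le_total q.2.2.2 p₀.2.2.2 with h | h
  · exact hmin ⟨q, ⟨hq, h⟩, rfl⟩
  · exact hp.2.trans h

theorem exists_forall_geoRenyiChannel_le [Nonempty A] (ℓ : ℕ)
    {N : Matrix A A ℂ →ₗ[ℂ] Matrix B B ℂ}
    (hN : IsChannel N) {V : Set (Matrix A A ℂ →ₗ[ℂ] Matrix B B ℂ)}
    (hV : ∀ M ∈ V, IsSubchannel M) (hcl : IsClosed (choi '' V)) (hne : V.Nonempty) :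
    ∃ M₀ ∈ V, ∀ M ∈ V, geoRenyiChannel (1 + ((2 : ℝ) ^ ℓ)⁻¹) N M₀ ≤
      geoRenyiChannel (1 + ((2 : ℝ) ^ ℓ)⁻¹) N M := by
  by_cases hv : (programValues ℓ N V).Nonempty
  · obtain ⟨y, hy, hmin⟩ := exists_isLeast_programValues hN hV hcl hv
    obtain ⟨M₀, hM₀, h⟩ := exists_geoRenyiChannel_le hN hV hy
    exact ⟨M₀, hM₀, fun M hM => h.trans (le_geoRenyiChannel_of_mem_lowerBounds hN hV
      (one_le_of_mem_programValues hN hV hy) hmin hM)⟩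
  · obtain ⟨M₀, hM₀⟩ := hne
    refine ⟨M₀, hM₀, fun M hM => ?_⟩
    rw [geoRenyiChannel_eq_top_of_infeasible hN hV hv hM]
    exact le_top

end Attainment

theorem mainTheorem1 :
    -- comparison with the Umegaki and the max-relative entropy
    (∀ (A : Type u) [Fintype A] [DecidableEq A] (α : ℝ), α ∈ Set.Ioc (1 : ℝ) 2 →
      ∀ ρ σ : Matrix A A ℂ, IsState ρ → IsSubState σ → SuppLE ρ σ →
        umegaki ρ σ ≤ geoRenyi α ρ σ ∧ geoRenyi α ρ σ ≤ dMax ρ σ) ∧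
    -- closed form of the geometric Rényi channel divergence
    (∀ (A B : Type u) [Fintype A] [DecidableEq A] [Nonempty A] [Fintype B] [DecidableEq B]
      (α : ℝ), α ∈ Set.Ioc (1 : ℝ) 2 →
      ∀ N M : Matrix A A ℂ →ₗ[ℂ] Matrix B B ℂ, IsChannel N → IsSubchannel M →
        (SuppLE (choi N) (choi M) → geoRenyiChannel α N M =
          ((1 / (α - 1) *
            Real.logb 2 (opNorm (trRight (geoMean (1 - α) (choi N) (choi M)))) : ℝ) : EReal)) ∧
        (¬ SuppLE (choi N) (choi M) → geoRenyiChannel α N M = ⊤)) ∧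
    -- closed form of the Belavkin–Staszewski channel divergence
    (∀ (A B : Type u) [Fintype A] [DecidableEq A] [Nonempty A] [Fintype B] [DecidableEq B],
      ∀ N M : Matrix A A ℂ →ₗ[ℂ] Matrix B B ℂ, IsChannel N → IsSubchannel M →
        (SuppLE (choi N) (choi M) → bsChannel N M =
          ((opNorm (trRight (bsOp (choi N) (choi M))) : ℝ) : EReal)) ∧
        (¬ SuppLE (choi N) (choi M) → bsChannel N M = ⊤)) ∧
    -- additivity under tensor products
    (∀ (A₁ B₁ A₂ B₂ : Type u) [Fintype A₁] [DecidableEq A₁] [Nonempty A₁]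
      [Fintype B₁] [DecidableEq B₁] [Fintype A₂] [DecidableEq A₂] [Nonempty A₂]
      [Fintype B₂] [DecidableEq B₂] (α : ℝ), α ∈ Set.Ioc (1 : ℝ) 2 →
      ∀ (N₁ M₁ : Matrix A₁ A₁ ℂ →ₗ[ℂ] Matrix B₁ B₁ ℂ) (N₂ M₂ : Matrix A₂ A₂ ℂ →ₗ[ℂ] Matrix B₂ B₂ ℂ),
        IsChannel N₁ → IsSubchannel M₁ → IsChannel N₂ → IsSubchannel M₂ →
        geoRenyiChannel α (tensorMap N₁ N₂) (tensorMap M₁ M₂) =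
          geoRenyiChannel α N₁ M₁ + geoRenyiChannel α N₂ M₂) ∧
    -- chain rule
    (∀ (R A B : Type u) [Fintype R] [DecidableEq R] [Fintype A] [DecidableEq A]
      [Fintype B] [DecidableEq B] (α : ℝ), α ∈ Set.Ioc (1 : ℝ) 2 →
      ∀ (ρ σ : Matrix (R × A) (R × A) ℂ) (N M : Matrix A A ℂ →ₗ[ℂ] Matrix B B ℂ),
        IsState ρ → IsSubState σ → IsChannel N → IsSubchannel M →
        geoRenyi α (idTensor R N ρ) (idTensor R M σ) ≤
          geoRenyi α ρ σ + geoRenyiChannel α N M) ∧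
    -- amortization collapse
    (∀ (A B : Type u) [Fintype A] [DecidableEq A] [Nonempty A] [Fintype B] [DecidableEq B]
      (α : ℝ), α ∈ Set.Ioc (1 : ℝ) 2 →
      ∀ N M : Matrix A A ℂ →ₗ[ℂ] Matrix B B ℂ, IsChannel N → IsSubchannel M →
        amortizedGeoRenyi α N M = geoRenyiChannel α N M) ∧
    -- sub-additivity under composition
    (∀ (A B C : Type u) [Fintype A] [DecidableEq A] [Nonempty A] [Fintype B] [DecidableEq B]
      [Fintype C] [DecidableEq C] (α : ℝ), α ∈ Set.Ioc (1 : ℝ) 2 →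
      ∀ (N₁ M₁ : Matrix A A ℂ →ₗ[ℂ] Matrix B B ℂ) (N₂ M₂ : Matrix B B ℂ →ₗ[ℂ] Matrix C C ℂ),
        IsChannel N₁ → IsSubchannel M₁ → IsChannel N₂ → IsSubchannel M₂ →
        geoRenyiChannel α (N₂ ∘ₗ N₁) (M₂ ∘ₗ M₁) ≤
          geoRenyiChannel α N₁ M₁ + geoRenyiChannel α N₂ M₂) ∧
    -- semidefinite representation for `α = 1 + 2^{-ℓ}`
    (∀ (A B : Type u) [Fintype A] [DecidableEq A] [Nonempty A] [Fintype B] [DecidableEq B]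
      (V : Set (Matrix A A ℂ →ₗ[ℂ] Matrix B B ℂ)), (∀ M ∈ V, IsSubchannel M) → IsSemidefRep V →
      ∀ (N : Matrix A A ℂ →ₗ[ℂ] Matrix B B ℂ), IsChannel N → ∀ (ℓ : ℕ) (α : ℝ),
        α = 1 + ((2 : ℝ) ^ ℓ)⁻¹ →
        -- the program is a semidefinite program, bounded below
        IsSemidefRep (programFeasible ℓ N V) ∧ BddBelow (programValues ℓ N V) ∧
        -- its optimal value gives the optimal divergence
        ((programValues ℓ N V).Nonempty → ⨅ M ∈ V, geoRenyiChannel α N M =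
          (((2 : ℝ) ^ ℓ * Real.logb 2 (sInf (programValues ℓ N V)) : ℝ) : EReal)) ∧
        (¬ (programValues ℓ N V).Nonempty → ⨅ M ∈ V, geoRenyiChannel α N M = ⊤) ∧
        -- both minima are attained if `V` is closed
        (IsClosed (choi '' V) →
          (V.Nonempty → ∃ M₀ ∈ V, ∀ M ∈ V, geoRenyiChannel α N M₀ ≤ geoRenyiChannel α N M) ∧
          ((programValues ℓ N V).Nonempty → ∃ y, IsLeast (programValues ℓ N V) y))) := by
  refine ⟨?_, ?_, ?_, ?_, ?_, ?_, ?_, ?_⟩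
  · intro A _ _ α hα ρ σ hρ hσ h
    exact ⟨umegaki_le_geoRenyi hρ hσ h hα.1, geoRenyi_le_dMax hρ hσ h hα.1⟩
  · intro A B _ _ _ _ _ α hα N M hN hM
    refine ⟨fun h => ?_, fun h => geoRenyiChannel_eq_top h α⟩
    rw [geoRenyiChannel_eq hN hM h hα, geoMean_eq_perspective hN.1.choi_posSemidef
      hM.1.choi_posSemidef h (by linarith [hα.1])]
  · intro A B _ _ _ _ _ N M hN hM
    refine ⟨fun h => ?_, fun h => bsChannel_eq_top h⟩
    rw [bsChannel_eq hN hM h, bsOp_eq_perspective hN.1.choi_posSemidef hM.1.choi_posSemidef h]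
  · intro A₁ B₁ A₂ B₂ _ _ _ _ _ _ _ _ _ _ α hα N₁ M₁ N₂ M₂ hN₁ hM₁ hN₂ hM₂
    exact geoRenyiChannel_tensorMap hα hN₁ hM₁ hN₂ hM₂
  · intro R A B _ _ _ _ _ _ α hα ρ σ N M hρ hσ hN hM
    exact geoRenyi_idTensor_le hα hρ hσ hN hM
  · intro A B _ _ _ _ _ α hα N M hN hM
    exact amortizedGeoRenyi_eq hα hN hM
  · intro A B C _ _ _ _ _ _ _ α hα N₁ M₁ N₂ M₂ hN₁ hM₁ hN₂ hM₂
    exact geoRenyiChannel_comp_le hα hN₁ hM₁ hN₂ hM₂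
  · rintro A B _ _ _ _ _ V hV hVs N hN ℓ _ rfl
    exact ⟨isSemidefRep_programFeasible ℓ N hVs,
      ⟨1, fun y hy => one_le_of_mem_programValues hN hV hy⟩,
      fun hne => iInf_geoRenyiChannel_eq hN hV hne,
      fun hne => iInf₂_eq_top.2 fun M hM => geoRenyiChannel_eq_top_of_infeasible hN hV hne hM _,
      fun hcl => ⟨fun hne => exists_forall_geoRenyiChannel_le ℓ hN hV hcl hne,
        fun hne => exists_isLeast_programValues hN hV hcl hne⟩⟩
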